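/- Let $\Sigma$ be a Riemann surface (second countable, not necessarily closed), let $\phi:\Sigma\to\mathbb R^3$ be a smooth minimal immersion (mean curvature $\equiv 0$; conformality with respect to the given complex structure is not required), with induced metric $g$, Gauss curvature $K_g$ and unit normal $\vec n$ (for the orientation of $\Sigma$), and let $w\in C^\infty(\Sigma,\mathbb R)$, $\vec w=w\,\vec n$. For a Borel set $\Omega\subset\Sigma$ (for example $\Omega=\Sigma$) and a smooth map $\psi:\Sigma\to\mathbb R^3$ that is an immersion at the points of $\Omega$, with induced metric $g_\psi$, put $$\mathscr W_\Omega(\psi)=\int_\Omega\big(|\vec H_{g_\psi}|^2-K_{g_\psi}\big)\,d\mathrm{vol}_{g_\psi}.$$ Let $(\phi_t)_{t\in I}$ be a family of class $C^2(I,C^\infty(\Sigma,\mathbb R^3))$ over an open interval $I\ni 0$, where $C^\infty(\Sigma,\mathbb R^3)$ carries the topology of locally uniform convergence of all derivatives, such that each $\phi_t$ is an immersion at the points of $\Omega$, $\phi_0=\phi$, $\frac{d}{dt}\phi_t|_{t=0}=\vec w$, and the acceleration $\frac{d^2}{dt^2}\phi_t|_{t=0}$ has compact support contained in the interior of $\Omega$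 (for example $\phi_t=\phi+t\,w\,\vec n$, or any family that is constant in $t$ outside a compact subset of the interior of $\Omega$). Assume that either $\overline\Omega$ is compact, or the forms $(|\vec H_{g_t}|^2-K_{g_t})\,d\mathrm{vol}_{g_t}$ together with their first two $t$-derivatives are, for all $t$ near $0$, dominated on $\Omega$ by one integrable $2$-form. Then $\mathscr W_\Omega(\phi_t)$ is an absolutely convergent integral for $t$ near $0$, the function $t\mapsto\mathscr W_\Omega(\phi_t)$ is differentiable near $0$ and twice differentiable at $0$, the $2$-form on the right-hand side below is absolutely integrable on $\Omega$, and $$D^2\mathscr W_\Omega(\phi)[\vec w,\vec w]:=\frac{d^2}{dt^2}\mathscr W_\Omega(\phi_t)\Big|_{t=0}=\int_{\Omega}\Big\{\tfrac12\big(\Delta_g w-2K_g w\big)^2\,d\mathrm{vol}_g-d\Big(\big(\Delta_g w+2K_g w\big)\star dw-\tfrac12\star d|dw|_g^2\Big)\Big\},$$ where $\Delta_g$ is the Laplace–Beltrami operator ($\Delta_g=\partial_1^2+\partial_2^2$ for the flat metric) and $\star$ is the Hodge star of $g$ on $1$-forms ($\star dx_1=dx_2$, $\star dx_2=-dx_1$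 in oriented conformal coordinates). -/

import Mathlib

open Set Filter MeasureTheory
open scoped Manifold ContDiff Topology

namespace WillmoreSurface

noncomputable section

/-- Euclidean three-space. -/
abbrev E3 : Type := EuclideanSpace ℝ (Fin 3)

/-! ### Surface geometry in a coordinate domain of `ℂ = ℝ²`

The coordinates are `x₁ + i x₂`; index `0` stands for `x₁` and index `1` for `x₂`.  The map `u` is
the immersion read in the coordinates.  No conformality of the coordinates is assumed. -/

/-- The partial derivatives `∂₁ f = Df(1)` and `∂₂ f = Df(i)` of a function on `ℂ = ℝ²`. -/
def pd {F : Type*} [NormedAddCommGroup F] [NormedSpace ℝ F]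
    (i : Fin 2) (f : ℂ → F) (z : ℂ) : F :=
  fderiv ℝ f z (![1, Complex.I] i)

/-- The cross product of `ℝ³`. -/
def cross (a b : E3) : E3 := WithLp.toLp 2 (crossProduct (WithLp.ofLp a) (WithLp.ofLp b))

/-- The first fundamental form `g_ij = ⟨∂ᵢu, ∂ⱼu⟩`. -/
def metric (u : ℂ → E3) (z : ℂ) : Matrix (Fin 2) (Fin 2) ℝ :=
  Matrix.of fun i j => inner ℝ (pd i u z) (pd j u z)

/-- The density `√(det g)` of the volume form with respect to `dx₁ ∧ dx₂`. -/
def volDensity (u : ℂ → E3) (z : ℂ) : ℝ := Real.sqrt (metric u z).det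

/-- The unit normal `(∂₁u × ∂₂u) / |∂₁u × ∂₂u|`. -/
def unitNormal (u : ℂ → E3) (z : ℂ) : E3 :=
  ‖cross (pd 0 u z) (pd 1 u z)‖⁻¹ • cross (pd 0 u z) (pd 1 u z)

/-- The second fundamental form `h_ij = ⟨∂ᵢ∂ⱼu, n⟩`, so that the normal part of `∂ᵢ∂ⱼu` is
`h_ij n`. -/
def secondForm (u : ℂ → E3) (z : ℂ) : Matrix (Fin 2) (Fin 2) ℝ :=
  Matrix.of fun i j => inner ℝ (pd i (pd j u) z) (unitNormal u z)

/-- The mean curvature `H = ½ ∑ g^{ij} h_ij`; the mean curvature vector is `H n`. -/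
def meanCurv (u : ℂ → E3) (z : ℂ) : ℝ :=
  (1 / 2) * ∑ i, ∑ j, (metric u z)⁻¹ i j * secondForm u z i j

/-- The Gauss curvature `K = (h₁₁ h₂₂ - h₁₂²) / det g`. -/
def gaussCurv (u : ℂ → E3) (z : ℂ) : ℝ := (secondForm u z).det / (metric u z).det

/-- The Laplace–Beltrami operator `Δ_g f = (det g)^{-1/2} ∑ ∂ᵢ((det g)^{1/2} g^{ij} ∂ⱼf)`. -/
def laplacian (u : ℂ → E3) (f : ℂ → ℝ) (z : ℂ) : ℝ :=
  (volDensity u z)⁻¹ *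
    ∑ i, pd i (fun y => volDensity u y * ∑ j, (metric u y)⁻¹ i j * pd j f y) z

/-- `|df|_g² = ∑ g^{ij} ∂ᵢf ∂ⱼf`. -/
def normSqD (u : ℂ → E3) (f : ℂ → ℝ) (z : ℂ) : ℝ :=
  ∑ i, ∑ j, (metric u z)⁻¹ i j * pd i f z * pd j f z

/-- The Hodge star of the one-form `α = α₁ dx₁ + α₂ dx₂` for the metric `g` and the orientation
`dx₁ ∧ dx₂`: `⋆α = √(det g) (g^{1j} αⱼ dx₂ - g^{2j} αⱼ dx₁)`.  In conformal coordinates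
`⋆dx₁ = dx₂` and `⋆dx₂ = -dx₁`. -/
def hodgeStar (u : ℂ → E3) (α : Fin 2 → ℂ → ℝ) : Fin 2 → ℂ → ℝ :=
  ![fun z => -(volDensity u z * ∑ j, (metric u z)⁻¹ 1 j * α j z),
    fun z => volDensity u z * ∑ j, (metric u z)⁻¹ 0 j * α j z]

/-- The components of the differential `df = ∂₁f dx₁ + ∂₂f dx₂`. -/
def d0 (f : ℂ → ℝ) : Fin 2 → ℂ → ℝ := fun i => pd i f

/-- The coefficient of `dx₁ ∧ dx₂` in the exterior derivative of `α₁ dx₁ + α₂ dx₂`. -/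
def d1 (α : Fin 2 → ℂ → ℝ) (z : ℂ) : ℝ := pd 0 (α 1) z - pd 1 (α 0) z

/-- The one-form `(Δ_g f + 2 K f) ⋆df - ½ ⋆d|df|_g²`. -/
def boundaryOneForm (u : ℂ → E3) (f : ℂ → ℝ) : Fin 2 → ℂ → ℝ := fun i z =>
  (laplacian u f z + 2 * gaussCurv u z * f z) * hodgeStar u (d0 f) i z
    - (1 / 2) * hodgeStar u (d0 (normSqD u f)) i z

/-! ### Two-forms on a Riemann surface and their integrals -/

/-- A two-form on the Riemann surface `M`, given by its coefficient with respect to `dx₁ ∧ dx₂`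
in each holomorphic chart. -/
abbrev TwoForm (M : Type*) [TopologicalSpace M] : Type _ := OpenPartialHomeomorph M ℂ → ℂ → ℝ

/-- A locally finite partition of `M` into countably many Borel pieces, each of them relatively
compact in the domain of a holomorphic chart.  It serves to integrate two-forms over `M`, which is
oriented by its holomorphic charts; by the change of variables formula the value of the integral
does not depend on the partition. -/
structure ChartPartition (M : Type*) [TopologicalSpace M] [ChartedSpace ℂ M]
    [MeasurableSpace M] where
  chart : ℕ → OpenPartialHomeomorph M ℂ
  chart_mem : ∀ n, chart n ∈ atlas ℂ M
  piece : ℕ → Set M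
  measurableSet_piece : ∀ n, MeasurableSet (piece n)
  disjoint : Pairwise (Function.onFun Disjoint piece)
  iUnion_piece : ⋃ n, piece n = univ
  locallyFinite : LocallyFinite piece
  isCompact_closure : ∀ n, IsCompact (closure (piece n))
  closure_subset : ∀ n, closure (piece n) ⊆ (chart n).source

/-- Every Riemann surface has such a partition. -/
theorem ChartPartition.nonempty (M : Type*) [TopologicalSpace M] [T2Space M]
    [SecondCountableTopology M] [ChartedSpace ℂ M] [MeasurableSpace M] [BorelSpace M]
    [Nonempty M] : Nonempty (ChartPartition M) := by
  classical
  have : LocallyCompactSpace M := ChartedSpace.locallyCompactSpace ℂ M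
  have hB : ∀ x : M, (𝓝 x).HasBasis
      (fun s : Set M => s ∈ 𝓝 x ∧ IsCompact s ∧ s ⊆ (chartAt ℂ x).source) (fun s => s) := by
    intro x
    refine ⟨fun t => ⟨fun ht => ?_, fun ⟨s, hs, hst⟩ => mem_of_superset hs.1 hst⟩⟩
    obtain ⟨s, hs, hst, hc⟩ := local_compact_nhds
      (inter_mem ht ((chartAt ℂ x).open_source.mem_nhds (mem_chart_source ℂ x)))
    exact ⟨s, ⟨hs, hc, fun y hy => (hst hy).2⟩, fun y hy => (hst hy).1⟩
  obtain ⟨α, c, r, hr, hcov, hfin⟩ := refinement_of_locallyCompact_sigmaCompact_of_nhds_basis hB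
  have hne : ∀ a, (r a).Nonempty := fun a => ⟨c a, mem_of_mem_nhds (hr a).1⟩
  have : Countable α := countable_univ_iff.1 (hfin.countable_univ hne)
  have : Encodable α := Encodable.ofCountable α
  have x₀ : M := Classical.arbitrary M
  let s : ℕ → Set M := fun n => (Encodable.decode₂ α n).elim ∅ r
  let e : ℕ → OpenPartialHomeomorph M ℂ := fun n =>
    (Encodable.decode₂ α n).elim (chartAt ℂ x₀) (fun a => chartAt ℂ (c a))
  have hs_compact : ∀ n, IsCompact (s n) := by
    intro n
    rcases h : Encodable.decode₂ α n with _ | a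
    · simp [s, h]
    · simpa [s, h] using (hr a).2.1
  have hs_source : ∀ n, s n ⊆ (e n).source := by
    intro n
    rcases h : Encodable.decode₂ α n with _ | a
    · simp [s, h]
    · simpa [s, e, h] using (hr a).2.2
  have hs_cov : ⋃ n, s n = univ := by
    refine eq_univ_of_forall fun x => ?_
    obtain ⟨a, ha⟩ := mem_iUnion.1 (hcov.symm ▸ mem_univ x : x ∈ ⋃ a, r a)
    exact mem_iUnion.2 ⟨Encodable.encode a, by simpa [s, Encodable.encodek₂] using ha⟩
  have hs_fin : LocallyFinite s := by
    intro x
    obtain ⟨t, ht, hf⟩ := hfin x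
    refine ⟨t, ht, (hf.image Encodable.encode).subset ?_⟩
    intro n hn
    rcases h : Encodable.decode₂ α n with _ | a
    · simp [s, h] at hn
    · exact ⟨a, by simpa [s, h] using hn, Encodable.decode₂_eq_some.1 h⟩
  have hsub : ∀ n, closure (disjointed s n) ⊆ s n := fun n =>
    closure_minimal (disjointed_subset s n) (hs_compact n).isClosed
  exact ⟨{
    chart := e
    chart_mem := by
      intro n
      rcases h : Encodable.decode₂ α n with _ | a <;> simp [e, h]
    piece := disjointed s
    measurableSet_piece := fun n =>
      MeasurableSet.disjointed (fun n => (hs_compact n).isClosed.measurableSet) n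
    disjoint := disjoint_disjointed s
    iUnion_piece := by rw [iUnion_disjointed, hs_cov]
    locallyFinite := hs_fin.subset fun n => disjointed_subset s n
    isCompact_closure := fun n => (hs_compact n).of_isClosed_subset isClosed_closure (hsub n)
    closure_subset := fun n => (hsub n).trans (hs_source n) }⟩

section Integration

variable {M : Type*} [TopologicalSpace M] [ChartedSpace ℂ M] [MeasurableSpace M]

/-- The set `Ω` cut along the partition and read in the charts: all `(n, z)` such that `z` is the
coordinate of a point of the `n`-th piece that lies in `Ω`. -/
def ChartPartition.region (P : ChartPartition M) (Ω : Set M) : Set (ℕ × ℂ) :=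
  {x | x.2 ∈ (P.chart x.1).target ∧ (P.chart x.1).symm x.2 ∈ P.piece x.1 ∩ Ω}

/-- A two-form as a function on the coordinate pieces. -/
def ChartPartition.coeff (P : ChartPartition M) (η : TwoForm M) (x : ℕ × ℂ) : ℝ :=
  η (P.chart x.1) x.2

/-- The sum over `n` of the Lebesgue measures on the coordinate pieces. -/
def coordMeasure : Measure (ℕ × ℂ) := (Measure.count : Measure ℕ).prod (volume : Measure ℂ)

/-- (Absolute) integrability of a two-form over `Ω`. -/
def ChartPartition.FormIntegrableOn (P : ChartPartition M) (Ω : Set M) (η : TwoForm M) : Prop :=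
  IntegrableOn (P.coeff η) (P.region Ω) coordMeasure

/-- The integral `∫_Ω η` of a two-form: the sum over `n` of the Lebesgue integrals of its
coefficient over the coordinate images of `piece n ∩ Ω`. -/
def ChartPartition.formIntegral (P : ChartPartition M) (Ω : Set M) (η : TwoForm M) : ℝ :=
  ∫ x in P.region Ω, P.coeff η x ∂coordMeasure

end Integration

/-! ### Immersed surfaces, the Willmore energy and its second variation -/

section Surface

variable {M : Type*} [TopologicalSpace M] [ChartedSpace ℂ M]

/-- Smooth (in the real sense) maps from the surface. -/
def IsSmooth {F : Type*} [NormedAddCommGroup F] [NormedSpace ℝ F] (f : M → F) : Prop :=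
  ContMDiff 𝓘(ℝ, ℂ) 𝓘(ℝ, F) ∞ f

/-- `ψ` is an immersion at `p`: its differential there is injective. -/
def IsImmersedAt (ψ : M → E3) (p : M) : Prop :=
  Function.Injective (mfderiv 𝓘(ℝ, ℂ) 𝓘(ℝ, E3) ψ p)

/-- The unit normal field (Gauss map) of an immersion, for the orientation of the Riemann
surface. -/
def normalField (ψ : M → E3) (p : M) : E3 :=
  unitNormal (ψ ∘ (chartAt ℂ p).symm) (chartAt ℂ p p)

/-- A smooth minimal immersion: a smooth immersion whose mean curvature vanishes identically. -/
structure IsMinimalImmersion (φ : M → E3) : Prop where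
  smooth : IsSmooth φ
  immersed : ∀ p, IsImmersedAt φ p
  meanCurv_eq_zero : ∀ p, meanCurv (φ ∘ (chartAt ℂ p).symm) (chartAt ℂ p p) = 0

/-- The two-form `(|H_g|² - K_g) dvol_g` of an immersion, `g` being the induced metric. -/
def willmoreForm (ψ : M → E3) : TwoForm M := fun e z =>
  (meanCurv (ψ ∘ e.symm) z ^ 2 - gaussCurv (ψ ∘ e.symm) z) * volDensity (ψ ∘ e.symm) z

/-- The two-form
`½ (Δ_g w - 2 K_g w)² dvol_g - d((Δ_g w + 2 K_g w) ⋆dw - ½ ⋆d|dw|_g²)`. -/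
def secondVariationForm (φ : M → E3) (w : M → ℝ) : TwoForm M := fun e z =>
  (1 / 2) * (laplacian (φ ∘ e.symm) (w ∘ e.symm) z
      - 2 * gaussCurv (φ ∘ e.symm) z * (w ∘ e.symm) z) ^ 2 * volDensity (φ ∘ e.symm) z
    - d1 (boundaryOneForm (φ ∘ e.symm) (w ∘ e.symm)) z

/-- The conformal Willmore energy `𝒲_Ω(ψ) = ∫_Ω (|H_g|² - K_g) dvol_g`. -/
def willmoreEnergy [MeasurableSpace M] (P : ChartPartition M) (Ω : Set M) (ψ : M → E3) : ℝ :=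
  P.formIntegral Ω (willmoreForm ψ)

/-- The `m`-th order spatial derivative of a time-dependent map, in the chart `e`. -/
def spaceDeriv (Φ : ℝ → M → E3) (e : OpenPartialHomeomorph M ℂ) (m : ℕ) (t : ℝ) (z : ℂ) :
    ContinuousMultilinearMap ℝ (fun _ : Fin m => ℂ) E3 :=
  iteratedFDeriv ℝ m (Φ t ∘ e.symm) z

/-- `Φ : I → C^∞(M, ℝ³)` is continuous, for local uniform convergence of all derivatives. -/
structure IsContinuousFamily (I : Set ℝ) (Φ : ℝ → M → E3) : Prop where
  smooth : ∀ t ∈ I, IsSmooth (Φ t)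
  continuousOn : ∀ e ∈ atlas ℂ M, ∀ m : ℕ,
    ContinuousOn (fun x : ℝ × ℂ => spaceDeriv Φ e m x.1 x.2) (I ×ˢ e.target)

/-- `V` is the time derivative of the family `Φ` in `C^∞(M, ℝ³)`: it is so for all spatial
derivatives. -/
def IsTimeDeriv (I : Set ℝ) (Φ V : ℝ → M → E3) : Prop :=
  ∀ e ∈ atlas ℂ M, ∀ m : ℕ, ∀ t ∈ I, ∀ z ∈ e.target,
    HasDerivAt (fun s => spaceDeriv Φ e m s z) (spaceDeriv V e m t z) t

/-- `Φ` is a family of class `C²(I, C^∞(M, ℝ³))`, with first and second time derivatives `V`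
and `A`, over an open interval `I` that contains `0`. -/
structure IsC2Family (I : Set ℝ) (Φ V A : ℝ → M → E3) : Prop where
  isOpen : IsOpen I
  ordConnected : I.OrdConnected
  zero_mem : (0 : ℝ) ∈ I
  continuous_zero : IsContinuousFamily I Φ
  continuous_one : IsContinuousFamily I V
  continuous_two : IsContinuousFamily I A
  deriv_zero : IsTimeDeriv I Φ V
  deriv_one : IsTimeDeriv I V A

/-- For times near `0` the forms `(|H|² - K) dvol` of the family and their first two time
derivatives are bounded on `Ω` by one integrable two-form. -/
def IsDominatedOn [MeasurableSpace M] (P : ChartPartition M) (Ω : Set M) (Φ : ℝ → M → E3) :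
    Prop :=
  ∃ ε > 0, ∃ G : ℕ × ℂ → ℝ, IntegrableOn G (P.region Ω) coordMeasure ∧
    ∀ x ∈ P.region Ω, ∀ t : ℝ, |t| < ε → ∀ j ≤ 2,
      |iteratedDeriv j (fun s => P.coeff (willmoreForm (Φ s)) x) t| ≤ G x

/-- `f` is differentiable near `t`, and its derivative has derivative `c` at `t`. -/
def HasSecondDerivAt (f : ℝ → ℝ) (c t : ℝ) : Prop :=
  ∃ f' : ℝ → ℝ, (∀ᶠ s in 𝓝 t, HasDerivAt f (f' s) s) ∧ HasDerivAt f' c t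

end Surface

end

end WillmoreSurface

open WillmoreSurface

open Set Filter MeasureTheory
open scoped Manifold ContDiff Topology

namespace WillmoreSurface

noncomputable section

/-! ### Vector algebra in `ℝ³` -/

/-! In a chart the density of `(|H|² - K) dvol` is a fixed function of the two-jet of the immersion.
With `N = ∂₁u × ∂₂u` and `s = |N|` it is `f = Q² / (4 s⁵) - k / s³`, where `Q / (2 s³)` is the mean
curvature and `k / s³` is the density of `K dvol` (`jetWillmore`). By the chain rule its second time
derivative at `t = 0` is `D²f(J)[J', J'] + Df(J)[J'']`, where `J`, `J'`, `J''` are the jets of `φ`,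
of `w n` and of the acceleration (`willmoreDeriv₂_zero`).

The quadratic term does not see the acceleration, so it can be computed along the straight line `u +
t w n`, whose Gauss map is jointly smooth in time and position. Minimality means `Q = 0` at `t = 0`,
so `Q²` contributes only through `Q'²`; here `Q' = s³ (Δw - 2Kw)` is the Jacobi operator, and this
gives the square (`mean_variation_algebra`). The other summand, `K dvol`, is the pull-back `⟨n, ∂₁n
× ∂₂n⟩` of the area form of the sphere. Closedness of the area form makes its time derivative equal
to `dβ` with `β = ⟨n, ∂ₜn × dn⟩` (`dirDeriv_det3_unit`), and `∂ₜβ` at `t = 0` is the one-form in the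
divergence term (`gauss_variation_algebra`). The identity is pointwise, so it needs no boundary
condition on `w`.

The linear term is the first variation in the direction of the acceleration. Again `Q = 0` removes
the mean curvature part and leaves `-dβ`, now for a field of compact support in `Ω`. Its integral
vanishes by Stokes' theorem in one chart, a partition of unity, and the fact that the first
variation transforms as a two-form under holomorphic changes of coordinates
(`formIntegral_firstVariationForm_univ`).

The passage from the integrand to the energy is differentiation under the integral sign, twice
(`hasSecondDerivAt_integral`). The integrable bound is either assumed or obtained from compactness
of the closure of `Ω` by the tube lemma. -/

theorem inner_eq_sum (x y : E3) : inner ℝ x y = x 0 * y 0 + x 1 * y 1 + x 2 * y 2 := by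
  simp [PiLp.inner_apply, Fin.sum_univ_three, mul_comm]

theorem cross_zero_coord (a b : E3) : cross a b 0 = a 1 * b 2 - a 2 * b 1 := by
  simp [cross, cross_apply]

theorem cross_one_coord (a b : E3) : cross a b 1 = a 2 * b 0 - a 0 * b 2 := by
  simp [cross, cross_apply]

theorem cross_two_coord (a b : E3) : cross a b 2 = a 0 * b 1 - a 1 * b 0 := by
  simp [cross, cross_apply]

theorem ext_coord {x y : E3} (h0 : x 0 = y 0) (h1 : x 1 = y 1) (h2 : x 2 = y 2) : x = y := by
  ext i
  fin_cases i
  exacts [h0, h1, h2]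

/-- The triple product of `ℝ³`. -/
def det3 (x y z : E3) : ℝ := inner ℝ x (cross y z)

theorem det3_eq (x y z : E3) : det3 x y z =
    x 0 * (y 1 * z 2 - y 2 * z 1) + x 1 * (y 2 * z 0 - y 0 * z 2)
      + x 2 * (y 0 * z 1 - y 1 * z 0) := by
  rw [det3, inner_eq_sum, cross_zero_coord, cross_one_coord, cross_two_coord]

/-- The cross product as a continuous bilinear map. -/
def crossL : E3 →L[ℝ] E3 →L[ℝ] E3 :=
  (LinearMap.mk₂ ℝ cross
    (fun a b c => by simp [cross]) (fun r a b => by simp [cross])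
    (fun a b c => by simp [cross]) (fun r a b => by simp [cross])).toContinuousBilinearMap

theorem crossL_apply (a b : E3) : crossL a b = cross a b := rfl

theorem cross_inner_cross (a b c d : E3) :
    inner ℝ (cross a b) (cross c d)
      = inner ℝ a c * inner ℝ b d - inner ℝ a d * inner ℝ b c := by
  simp only [inner_eq_sum, cross_zero_coord, cross_one_coord, cross_two_coord]
  ring

theorem norm_cross_sq (a b : E3) :
    ‖cross a b‖ ^ 2 = inner ℝ a a * inner ℝ b b - inner ℝ a b ^ 2 := by
  rw [← real_inner_self_eq_norm_sq, cross_inner_cross, real_inner_comm a b]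
  ring

theorem inner_cross_left (a b : E3) : inner ℝ a (cross a b) = 0 := by
  simp only [inner_eq_sum, cross_zero_coord, cross_one_coord, cross_two_coord]
  ring

theorem inner_cross_right (a b : E3) : inner ℝ b (cross a b) = 0 := by
  simp only [inner_eq_sum, cross_zero_coord, cross_one_coord, cross_two_coord]
  ring

/-- The expansion of a vector in the frame `a, b, a × b`. -/
theorem frame_expansion (a b x : E3) :
    ‖cross a b‖ ^ 2 • x
      = (inner ℝ b b * inner ℝ x a - inner ℝ a b * inner ℝ x b) • a
        + (inner ℝ a a * inner ℝ x b - inner ℝ a b * inner ℝ x a) • b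
        + inner ℝ x (cross a b) • cross a b := by
  rw [norm_cross_sq]
  refine ext_coord ?_ ?_ ?_ <;>
  · simp only [PiLp.add_apply, PiLp.smul_apply, smul_eq_mul, inner_eq_sum, cross_zero_coord,
      cross_one_coord, cross_two_coord]
    ring

theorem exists_tangent_coords {a b x : E3} (hab : cross a b ≠ 0)
    (hx : inner ℝ x (cross a b) = 0) : ∃ α β : ℝ, x = α • a + β • b := by
  have h := frame_expansion a b x
  have hs : ‖cross a b‖ ^ 2 ≠ 0 := pow_ne_zero 2 (norm_ne_zero_iff.2 hab)
  rw [hx, zero_smul, add_zero] at h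
  refine ⟨(‖cross a b‖ ^ 2)⁻¹ * (inner ℝ b b * inner ℝ x a - inner ℝ a b * inner ℝ x b),
    (‖cross a b‖ ^ 2)⁻¹ * (inner ℝ a a * inner ℝ x b - inner ℝ a b * inner ℝ x a), ?_⟩
  rw [mul_smul, mul_smul, ← smul_add, ← h, smul_smul, inv_mul_cancel₀ hs, one_smul]

theorem eq_of_inner_frame {a b x y : E3} (hab : cross a b ≠ 0)
    (ha : inner ℝ x a = inner ℝ y a) (hb : inner ℝ x b = inner ℝ y b)
    (hn : inner ℝ x (cross a b) = inner ℝ y (cross a b)) : x = y := by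
  have hs : ‖cross a b‖ ^ 2 ≠ 0 := pow_ne_zero 2 (norm_ne_zero_iff.2 hab)
  have h := frame_expansion a b x
  rw [ha, hb, hn, ← frame_expansion a b y] at h
  exact smul_right_injective _ hs h

/-- The triple product of three vectors orthogonal to a nonzero vector vanishes. -/
theorem det3_eq_zero_of_orthogonal {n x y z : E3} (hn : n ≠ 0) (hx : inner ℝ n x = 0)
    (hy : inner ℝ n y = 0) (hz : inner ℝ n z = 0) : det3 x y z = 0 := by
  -- Cramer's rule expands `det3 x y z • n` in `x`, `y`, `z`; this is its inner product with `n`.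
  have h : inner ℝ n n * det3 x y z
      = inner ℝ n x * det3 n y z + inner ℝ n y * det3 x n z + inner ℝ n z * det3 x y n := by
    simp only [det3_eq, inner_eq_sum]
    ring
  rw [hx, hy, hz, zero_mul, zero_mul, zero_mul, add_zero, add_zero] at h
  exact (mul_eq_zero.1 h).resolve_left (inner_self_ne_zero.2 hn)

/-! ### The Willmore integrand as a function of the two-jet -/

/-- The two-jet `(∂₁u, ∂₂u, ∂₁∂₁u, ∂₁∂₂u, ∂₂∂₂u)`. -/
def jet (u : ℂ → E3) (z : ℂ) : Fin 5 → E3 :=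
  ![pd 0 u z, pd 1 u z, pd 0 (pd 0 u) z, pd 0 (pd 1 u) z, pd 1 (pd 1 u) z]

/-- The normal vector `∂₁u × ∂₂u`. -/
def jetNormal (J : Fin 5 → E3) : E3 := cross (J 0) (J 1)

/-- The numerator `Q` of the mean curvature `Q / (2 |∂₁u × ∂₂u|³)`. -/
def jetMean (J : Fin 5 → E3) : ℝ :=
  inner ℝ (J 1) (J 1) * inner ℝ (J 2) (jetNormal J)
    - 2 * inner ℝ (J 0) (J 1) * inner ℝ (J 3) (jetNormal J)
    + inner ℝ (J 0) (J 0) * inner ℝ (J 4) (jetNormal J)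

/-- The numerator of the Gauss curvature. -/
def jetGauss (J : Fin 5 → E3) : ℝ :=
  inner ℝ (J 2) (jetNormal J) * inner ℝ (J 4) (jetNormal J) - inner ℝ (J 3) (jetNormal J) ^ 2

/-- The density of `(|H|² - K) dvol` as a function of the two-jet. -/
def jetWillmore (J : Fin 5 → E3) : ℝ :=
  jetMean J ^ 2 / (4 * ‖jetNormal J‖ ^ 5) - jetGauss J / ‖jetNormal J‖ ^ 3

theorem det_metric (u : ℂ → E3) (z : ℂ) :
    (metric u z).det = ‖cross (pd 0 u z) (pd 1 u z)‖ ^ 2 := by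
  rw [norm_cross_sq, Matrix.det_fin_two]
  simp only [metric, Matrix.of_apply]
  rw [real_inner_comm (pd 0 u z) (pd 1 u z)]
  ring

theorem volDensity_eq (u : ℂ → E3) (z : ℂ) :
    volDensity u z = ‖cross (pd 0 u z) (pd 1 u z)‖ := by
  rw [volDensity, det_metric, Real.sqrt_sq (norm_nonneg _)]

theorem metric_inv (u : ℂ → E3) (z : ℂ) :
    (metric u z)⁻¹ = (‖cross (pd 0 u z) (pd 1 u z)‖ ^ 2)⁻¹ •
      !![inner ℝ (pd 1 u z) (pd 1 u z), -inner ℝ (pd 0 u z) (pd 1 u z);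
        -inner ℝ (pd 0 u z) (pd 1 u z), inner ℝ (pd 0 u z) (pd 0 u z)] := by
  rw [Matrix.inv_def, det_metric, Ring.inverse_eq_inv', Matrix.adjugate_fin_two]
  simp only [metric, Matrix.of_apply]
  rw [real_inner_comm (pd 0 u z) (pd 1 u z)]

theorem pd_comm {F : Type*} [NormedAddCommGroup F] [NormedSpace ℝ F] {u : ℂ → F} {z : ℂ}
    (hu : ContDiffAt ℝ 2 u z) (i j : Fin 2) : pd i (pd j u) z = pd j (pd i u) z := by
  have hd : DifferentiableAt ℝ (fderiv ℝ u) z :=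
    (hu.fderiv_right (m := 1) (by norm_num)).differentiableAt (by norm_num)
  have key : ∀ v w : ℂ, fderiv ℝ (fun y => fderiv ℝ u y v) z w = fderiv ℝ (fderiv ℝ u) z w v := by
    intro v w
    rw [fderiv_clm_apply hd (differentiableAt_const v)]
    simp
  have hs : IsSymmSndFDerivAt ℝ u z := hu.isSymmSndFDerivAt (by simp)
  change fderiv ℝ (fun y => fderiv ℝ u y _) z _ = fderiv ℝ (fun y => fderiv ℝ u y _) z _
  rw [key, key, hs]

theorem secondForm_eq (u : ℂ → E3) (z : ℂ) (i j : Fin 2) :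
    secondForm u z i j = ‖cross (pd 0 u z) (pd 1 u z)‖⁻¹ *
      inner ℝ (pd i (pd j u) z) (cross (pd 0 u z) (pd 1 u z)) := by
  simp only [secondForm, Matrix.of_apply, unitNormal, inner_smul_right]

theorem meanCurv_eq {u : ℂ → E3} {z : ℂ} (hu : ContDiffAt ℝ 2 u z) :
    meanCurv u z = jetMean (jet u z) / (2 * ‖jetNormal (jet u z)‖ ^ 3) := by
  have h10 := pd_comm hu 1 0
  simp only [meanCurv, Fin.sum_univ_two, metric_inv, secondForm_eq, h10]
  simp only [jetMean, jetNormal, jet, Matrix.smul_apply, Matrix.of_apply, Matrix.cons_val_zero,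
    Matrix.cons_val_one, Matrix.cons_val, smul_eq_mul]
  -- Where `u` is not immersed both sides are zero, because division by zero gives zero.
  by_cases h : ‖cross (pd 0 u z) (pd 1 u z)‖ = 0
  · simp [h]
  · field_simp
    ring

theorem gaussCurv_mul_volDensity {u : ℂ → E3} {z : ℂ} (hu : ContDiffAt ℝ 2 u z) :
    gaussCurv u z * volDensity u z = jetGauss (jet u z) / ‖jetNormal (jet u z)‖ ^ 3 := by
  have h10 := pd_comm hu 1 0
  rw [gaussCurv, det_metric, volDensity_eq, Matrix.det_fin_two]
  simp only [secondForm_eq, h10]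
  simp only [jetGauss, jetNormal, jet, Matrix.cons_val_zero,
    Matrix.cons_val_one, Matrix.cons_val]
  by_cases h : ‖cross (pd 0 u z) (pd 1 u z)‖ = 0
  · simp [h]
  · field_simp

/-- After this the energy density is a fixed function composed with the jet, so all time derivatives
reduce to the chain rule. No immersion hypothesis is needed, since at degenerate points every
quotient is zero. -/
theorem willmore_coeff {u : ℂ → E3} {z : ℂ} (hu : ContDiffAt ℝ 2 u z) :
    (meanCurv u z ^ 2 - gaussCurv u z) * volDensity u z = jetWillmore (jet u z) := by
  rw [sub_mul, gaussCurv_mul_volDensity hu, meanCurv_eq hu, volDensity_eq, jetWillmore]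
  have : cross (pd 0 u z) (pd 1 u z) = jetNormal (jet u z) := rfl
  rw [this]
  by_cases h : ‖jetNormal (jet u z)‖ = 0
  · simp [h]
  · field_simp
    ring

/-- The two-jets of immersions. -/
def regularJets : Set (Fin 5 → E3) := {J | jetNormal J ≠ 0}

theorem contDiff_cross {E : Type*} [NormedAddCommGroup E] [NormedSpace ℝ E] {n : ℕ∞ω}
    {f g : E → E3} (hf : ContDiff ℝ n f) (hg : ContDiff ℝ n g) :
    ContDiff ℝ n fun x => cross (f x) (g x) :=
  crossL.isBoundedBilinearMap.contDiff.comp (hf.prodMk hg)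

theorem contDiff_jetNormal : ContDiff ℝ ∞ jetNormal :=
  contDiff_cross (contDiff_apply ℝ E3 0) (contDiff_apply ℝ E3 1)

theorem contDiff_jetMean : ContDiff ℝ ∞ jetMean := by
  have h := contDiff_jetNormal
  have hc : ∀ i, ContDiff ℝ ∞ fun J : Fin 5 → E3 => J i := fun i => contDiff_apply ℝ E3 i
  exact (((hc 1).inner ℝ (hc 1)).mul ((hc 2).inner ℝ h)).sub
    ((contDiff_const.mul ((hc 0).inner ℝ (hc 1))).mul ((hc 3).inner ℝ h)) |>.add
    (((hc 0).inner ℝ (hc 0)).mul ((hc 4).inner ℝ h))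

theorem contDiff_jetGauss : ContDiff ℝ ∞ jetGauss := by
  have h := contDiff_jetNormal
  have hc : ∀ i, ContDiff ℝ ∞ fun J : Fin 5 → E3 => J i := fun i => contDiff_apply ℝ E3 i
  exact (((hc 2).inner ℝ h).mul ((hc 4).inner ℝ h)).sub (((hc 3).inner ℝ h).pow 2)

theorem isOpen_regularJets : IsOpen regularJets :=
  isOpen_ne_fun contDiff_jetNormal.continuous continuous_const

theorem contDiffOn_jetWillmore : ContDiffOn ℝ ∞ jetWillmore regularJets := by
  have hn : ContDiffOn ℝ ∞ (fun J => ‖jetNormal J‖) regularJets :=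
    contDiff_jetNormal.contDiffOn.norm ℝ fun J hJ => hJ
  have h0 : ∀ J ∈ regularJets, ‖jetNormal J‖ ≠ 0 := fun J hJ => norm_ne_zero_iff.2 hJ
  exact ((contDiff_jetMean.contDiffOn.pow 2).div (contDiffOn_const.mul (hn.pow 5))
    fun J hJ => mul_ne_zero (by norm_num) (pow_ne_zero 5 (h0 J hJ))).sub
    (contDiff_jetGauss.contDiffOn.div (hn.pow 3) fun J hJ => pow_ne_zero 3 (h0 J hJ))

/-! ### Behaviour under holomorphic changes of coordinates -/

/-- The two-jet of `u ∘ τ`, where `τ' = p + i q`, `∂₁p = p₁` and `∂₁q = q₁`; by the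
Cauchy-Riemann equations `∂₂p = -q₁` and `∂₂q = p₁`. -/
def jetChange (p q p₁ q₁ : ℝ) (J : Fin 5 → E3) : Fin 5 → E3 :=
  ![p • J 0 + q • J 1, -q • J 0 + p • J 1,
    p₁ • J 0 + q₁ • J 1 + (p ^ 2) • J 2 + (2 * p * q) • J 3 + (q ^ 2) • J 4,
    -q₁ • J 0 + p₁ • J 1 - (p * q) • J 2 + (p ^ 2 - q ^ 2) • J 3 + (p * q) • J 4,
    -p₁ • J 0 - q₁ • J 1 + (q ^ 2) • J 2 - (2 * p * q) • J 3 + (p ^ 2) • J 4]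

section

variable (p q p₁ q₁ : ℝ) (J : Fin 5 → E3)

theorem jetNormal_jetChange :
    jetNormal (jetChange p q p₁ q₁ J) = (p ^ 2 + q ^ 2) • jetNormal J := by
  simp only [jetNormal, jetChange, Matrix.cons_val_zero, Matrix.cons_val_one]
  refine ext_coord ?_ ?_ ?_ <;>
  · simp only [PiLp.add_apply, PiLp.smul_apply, smul_eq_mul, cross_zero_coord,
      cross_one_coord, cross_two_coord]
    ring

theorem inner_jetNormal_zero : inner ℝ (J 0) (jetNormal J) = 0 := inner_cross_left _ _

theorem inner_jetNormal_one : inner ℝ (J 1) (jetNormal J) = 0 := inner_cross_right _ _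

theorem inner_jetChange_two :
    inner ℝ (jetChange p q p₁ q₁ J 2) (jetNormal J) = p ^ 2 * inner ℝ (J 2) (jetNormal J)
      + 2 * p * q * inner ℝ (J 3) (jetNormal J) + q ^ 2 * inner ℝ (J 4) (jetNormal J) := by
  simp only [jetChange, Matrix.cons_val, inner_add_left, real_inner_smul_left,
    inner_jetNormal_zero, inner_jetNormal_one]
  ring

theorem inner_jetChange_three :
    inner ℝ (jetChange p q p₁ q₁ J 3) (jetNormal J) = -(p * q * inner ℝ (J 2) (jetNormal J))
      + (p ^ 2 - q ^ 2) * inner ℝ (J 3) (jetNormal J)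
      + p * q * inner ℝ (J 4) (jetNormal J) := by
  simp only [jetChange, Matrix.cons_val, inner_add_left, inner_sub_left, real_inner_smul_left,
    inner_jetNormal_zero, inner_jetNormal_one]
  ring

theorem inner_jetChange_four :
    inner ℝ (jetChange p q p₁ q₁ J 4) (jetNormal J) = q ^ 2 * inner ℝ (J 2) (jetNormal J)
      - 2 * p * q * inner ℝ (J 3) (jetNormal J) + p ^ 2 * inner ℝ (J 4) (jetNormal J) := by
  simp only [jetChange, Matrix.cons_val, inner_add_left, inner_sub_left, real_inner_smul_left,
    inner_jetNormal_zero, inner_jetNormal_one]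
  ring

/-- Write `λ = p² + q²`. The terms with `p₁`, `q₁` are tangential and vanish against the normal. The
metric, the second derivatives and the normal each contribute one factor `λ`; the rotation by the
argument of `τ'` cancels in the contraction. -/
theorem jetMean_jetChange :
    jetMean (jetChange p q p₁ q₁ J) = (p ^ 2 + q ^ 2) ^ 3 * jetMean J := by
  have h00 : inner ℝ (jetChange p q p₁ q₁ J 0) (jetChange p q p₁ q₁ J 0)
      = p ^ 2 * inner ℝ (J 0) (J 0) + 2 * p * q * inner ℝ (J 0) (J 1)
        + q ^ 2 * inner ℝ (J 1) (J 1) := by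
    simp only [jetChange, Matrix.cons_val_zero, inner_add_left, inner_add_right,
      real_inner_smul_left, real_inner_smul_right, real_inner_comm (J 0) (J 1)]
    ring
  have h01 : inner ℝ (jetChange p q p₁ q₁ J 0) (jetChange p q p₁ q₁ J 1)
      = -(p * q * inner ℝ (J 0) (J 0)) + (p ^ 2 - q ^ 2) * inner ℝ (J 0) (J 1)
        + p * q * inner ℝ (J 1) (J 1) := by
    simp only [jetChange, Matrix.cons_val_zero, Matrix.cons_val_one, inner_add_left,
      inner_add_right, real_inner_smul_left, real_inner_smul_right, real_inner_comm (J 0) (J 1)]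
    ring
  have h11 : inner ℝ (jetChange p q p₁ q₁ J 1) (jetChange p q p₁ q₁ J 1)
      = q ^ 2 * inner ℝ (J 0) (J 0) - 2 * p * q * inner ℝ (J 0) (J 1)
        + p ^ 2 * inner ℝ (J 1) (J 1) := by
    simp only [jetChange, Matrix.cons_val_one, Matrix.cons_val_zero, inner_add_left,
      inner_add_right, real_inner_smul_left, real_inner_smul_right, real_inner_comm (J 0) (J 1)]
    ring
  rw [jetMean, jetNormal_jetChange]
  simp only [real_inner_smul_right, h00, h01, h11, inner_jetChange_two, inner_jetChange_three,
    inner_jetChange_four]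
  rw [jetMean]
  ring

theorem jetGauss_jetChange :
    jetGauss (jetChange p q p₁ q₁ J) = (p ^ 2 + q ^ 2) ^ 4 * jetGauss J := by
  rw [jetGauss, jetNormal_jetChange]
  simp only [real_inner_smul_right, inner_jetChange_two, inner_jetChange_three,
    inner_jetChange_four]
  rw [jetGauss]
  ring

/-- The weights are `2 · 3 - 5` for the mean curvature part and `4 - 3` for the Gauss part. Both
equal one, so the density is multiplied by the Jacobian `|τ'|²`, as a two-form must be. -/
theorem jetWillmore_jetChange :
    jetWillmore (jetChange p q p₁ q₁ J) = (p ^ 2 + q ^ 2) * jetWillmore J := by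
  rw [jetWillmore, jetMean_jetChange, jetGauss_jetChange, jetNormal_jetChange, norm_smul,
    Real.norm_of_nonneg (by positivity), jetWillmore]
  by_cases h : ‖jetNormal J‖ = 0
  · simp [h]
  by_cases h' : p ^ 2 + q ^ 2 = 0
  · simp [h']
  · field_simp

end


/-! ### Directional derivatives -/

section Calculus

variable {E F : Type*} [NormedAddCommGroup E] [NormedSpace ℝ E] [NormedAddCommGroup F]
  [NormedSpace ℝ F]

theorem two_le_infty : (2 : ℕ∞ω) ≤ ∞ := by
  exact WithTop.coe_le_coe.2 (le_top : (2 : ℕ∞) ≤ ⊤)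

/-- The derivative of `f` in the direction `v`, as a function of the base point. -/
def dirDeriv (v : E) (f : E → F) (x : E) : F := fderiv ℝ f x v

theorem ContDiffOn.dirDeriv {f : E → F} {U : Set E} (hU : IsOpen U) (hf : ContDiffOn ℝ ∞ f U)
    (v : E) : ContDiffOn ℝ ∞ (dirDeriv v f) U :=
  (hf.fderiv_of_isOpen hU (by simp)).clm_apply contDiffOn_const

theorem ContDiffOn.differentiableAt_of_mem {f : E → F} {U : Set E} (hU : IsOpen U)
    (hf : ContDiffOn ℝ ∞ f U) {x : E} (hx : x ∈ U) : DifferentiableAt ℝ f x :=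
  (hf.contDiffAt (hU.mem_nhds hx)).differentiableAt (by simp)

theorem dirDeriv_comm {f : E → F} {x : E} (hf : ContDiffAt ℝ 2 f x) (v w : E) :
    dirDeriv v (dirDeriv w f) x = dirDeriv w (dirDeriv v f) x := by
  have hd : DifferentiableAt ℝ (fderiv ℝ f) x :=
    (hf.fderiv_right (m := 1) (by norm_num)).differentiableAt (by norm_num)
  have key : ∀ v w : E, fderiv ℝ (fun y => fderiv ℝ f y v) x w = fderiv ℝ (fderiv ℝ f) x w v := by
    intro v w
    rw [fderiv_clm_apply hd (differentiableAt_const v)]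
    simp
  have hs : IsSymmSndFDerivAt ℝ f x := hf.isSymmSndFDerivAt (by simp)
  change fderiv ℝ (fun y => fderiv ℝ f y _) x _ = fderiv ℝ (fun y => fderiv ℝ f y _) x _
  rw [key, key, hs]

theorem dirDeriv_congr {f g : E → F} {x : E} (h : f =ᶠ[𝓝 x] g) (v : E) :
    dirDeriv v f x = dirDeriv v g x := by
  rw [dirDeriv, dirDeriv, h.fderiv_eq]

theorem dirDeriv_inner {f g : E → E3} {x : E} (hf : DifferentiableAt ℝ f x)
    (hg : DifferentiableAt ℝ g x) (v : E) :
    dirDeriv v (fun y => inner ℝ (f y) (g y)) x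
      = inner ℝ (dirDeriv v f x) (g x) + inner ℝ (f x) (dirDeriv v g x) := by
  rw [dirDeriv, fderiv_inner_apply ℝ hf hg, add_comm]
  rfl

theorem dirDeriv_cross {f g : E → E3} {x : E} (hf : DifferentiableAt ℝ f x)
    (hg : DifferentiableAt ℝ g x) (v : E) :
    dirDeriv v (fun y => cross (f y) (g y)) x
      = cross (dirDeriv v f x) (g x) + cross (f x) (dirDeriv v g x) := by
  have h := crossL.fderiv_of_bilinear hf hg
  change fderiv ℝ (fun y => crossL (f y) (g y)) x v = _
  rw [h, add_comm]
  rfl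

theorem differentiableAt_cross {f g : E → E3} {x : E} (hf : DifferentiableAt ℝ f x)
    (hg : DifferentiableAt ℝ g x) : DifferentiableAt ℝ (fun y => cross (f y) (g y)) x :=
  (crossL.hasFDerivAt_of_bilinear hf.hasFDerivAt hg.hasFDerivAt).differentiableAt

theorem dirDeriv_det3 {f g h : E → E3} {x : E} (hf : DifferentiableAt ℝ f x)
    (hg : DifferentiableAt ℝ g x) (hh : DifferentiableAt ℝ h x) (v : E) :
    dirDeriv v (fun y => det3 (f y) (g y) (h y)) x
      = det3 (dirDeriv v f x) (g x) (h x) + det3 (f x) (dirDeriv v g x) (h x)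
        + det3 (f x) (g x) (dirDeriv v h x) := by
  have := dirDeriv_inner hf (differentiableAt_cross hg hh) v
  rw [dirDeriv_cross hg hh, inner_add_right, ← add_assoc] at this
  exact this

theorem contDiffOn_cross {f g : E → E3} {U : Set E} (hf : ContDiffOn ℝ ∞ f U)
    (hg : ContDiffOn ℝ ∞ g U) : ContDiffOn ℝ ∞ (fun y => cross (f y) (g y)) U :=
  crossL.isBoundedBilinearMap.contDiff.comp_contDiffOn (hf.prodMk hg)

theorem contDiffOn_det3 {f g h : E → E3} {U : Set E} (hf : ContDiffOn ℝ ∞ f U)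
    (hg : ContDiffOn ℝ ∞ g U) (hh : ContDiffOn ℝ ∞ h U) :
    ContDiffOn ℝ ∞ (fun y => det3 (f y) (g y) (h y)) U :=
  hf.inner ℝ (contDiffOn_cross hg hh)

theorem dirDeriv_smul {c : E → ℝ} {f : E → F} {x : E} (hc : DifferentiableAt ℝ c x)
    (hf : DifferentiableAt ℝ f x) (v : E) :
    dirDeriv v (fun y => c y • f y) x = dirDeriv v c x • f x + c x • dirDeriv v f x := by
  rw [dirDeriv, fderiv_fun_smul hc hf, add_comm]
  rfl

theorem dirDeriv_add {f g : E → F} {x : E} (hf : DifferentiableAt ℝ f x)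
    (hg : DifferentiableAt ℝ g x) (v : E) :
    dirDeriv v (fun y => f y + g y) x = dirDeriv v f x + dirDeriv v g x := by
  rw [dirDeriv, fderiv_fun_add hf hg]
  rfl

/-- A unit vector field is orthogonal to its derivatives. -/
theorem inner_dirDeriv_unit {ν : E → E3} {U : Set E} (hU : IsOpen U) (hν : ContDiffOn ℝ ∞ ν U)
    (hunit : ∀ x ∈ U, inner ℝ (ν x) (ν x) = 1) {x : E} (hx : x ∈ U) (v : E) :
    inner ℝ (ν x) (dirDeriv v ν x) = 0 := by
  have hd := ContDiffOn.differentiableAt_of_mem hU hν hx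
  have h := dirDeriv_inner hd hd v
  have h1 : dirDeriv v (fun y => inner ℝ (ν y) (ν y)) x = 0 := by
    rw [dirDeriv_congr (g := fun _ => (1 : ℝ)) (by
      filter_upwards [hU.mem_nhds hx] with y hy using hunit y hy)]
    simp [dirDeriv]
  rw [h1, real_inner_comm] at h
  linarith

/-- The variation of the area form of the Gauss map is exact. -/
theorem dirDeriv_det3_unit {ν : E → E3} {U : Set E} (hU : IsOpen U) (hν : ContDiffOn ℝ ∞ ν U)
    (hunit : ∀ x ∈ U, inner ℝ (ν x) (ν x) = 1) {x : E} (hx : x ∈ U) (a b c : E) :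
    dirDeriv a (fun y => det3 (ν y) (dirDeriv b ν y) (dirDeriv c ν y)) x
      = dirDeriv b (fun y => det3 (ν y) (dirDeriv a ν y) (dirDeriv c ν y)) x
        - dirDeriv c (fun y => det3 (ν y) (dirDeriv a ν y) (dirDeriv b ν y)) x := by
  have hd := ContDiffOn.differentiableAt_of_mem hU hν hx
  have hd' : ∀ v, DifferentiableAt ℝ (dirDeriv v ν) x := fun v =>
    ContDiffOn.differentiableAt_of_mem hU (ContDiffOn.dirDeriv hU hν v) hx
  have hc : ContDiffAt ℝ 2 ν x := (hν.contDiffAt (hU.mem_nhds hx)).of_le two_le_infty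
  have hn : ν x ≠ 0 := by
    intro h0
    have := hunit x hx
    simp [h0] at this
  -- All three derivatives are tangent to the sphere at `ν x`. Once the symmetric second derivatives
  -- cancel, the two sides differ by three times this triple product: it is the closedness of the
  -- area form.
  have h0 : det3 (dirDeriv a ν x) (dirDeriv b ν x) (dirDeriv c ν x) = 0 :=
    det3_eq_zero_of_orthogonal hn (inner_dirDeriv_unit hU hν hunit hx a)
      (inner_dirDeriv_unit hU hν hunit hx b) (inner_dirDeriv_unit hU hν hunit hx c)
  rw [dirDeriv_det3 hd (hd' b) (hd' c), dirDeriv_det3 hd (hd' a) (hd' c),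
    dirDeriv_det3 hd (hd' a) (hd' b), dirDeriv_comm hc b a, dirDeriv_comm hc c a,
    dirDeriv_comm hc c b]
  simp only [det3_eq] at h0 ⊢
  linear_combination 3 * h0

end Calculus

/-! ### Twice differentiable functions of one variable -/

/-- Any two candidates for the first derivative agree near `t`. This lets a chain-rule computation
be compared with a geometric one. -/
theorem HasSecondDerivAt.unique {f : ℝ → ℝ} {c₁ c₂ t : ℝ} (h₁ : HasSecondDerivAt f c₁ t)
    (h₂ : HasSecondDerivAt f c₂ t) : c₁ = c₂ := by
  obtain ⟨g₁, hg₁, h₁⟩ := h₁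
  obtain ⟨g₂, hg₂, h₂⟩ := h₂
  have : g₁ =ᶠ[𝓝 t] g₂ := by
    filter_upwards [hg₁, hg₂] with s h h' using h.unique h'
  exact (h₁.congr_of_eventuallyEq this.symm).unique h₂

theorem HasSecondDerivAt.sub {f g : ℝ → ℝ} {c d t : ℝ} (hf : HasSecondDerivAt f c t)
    (hg : HasSecondDerivAt g d t) : HasSecondDerivAt (fun s => f s - g s) (c - d) t := by
  obtain ⟨f', hf', hf⟩ := hf
  obtain ⟨g', hg', hg⟩ := hg
  refine ⟨fun s => f' s - g' s, ?_, hf.sub hg⟩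
  filter_upwards [hf', hg'] with s h h' using h.sub h'

theorem HasSecondDerivAt.congr {f g : ℝ → ℝ} {c t : ℝ} (hf : HasSecondDerivAt f c t)
    (h : f =ᶠ[𝓝 t] g) : HasSecondDerivAt g c t := by
  obtain ⟨f', hf', hf⟩ := hf
  refine ⟨f', ?_, hf⟩
  filter_upwards [hf', h.eventuallyEq_nhds] with s h1 h2 using h1.congr_of_eventuallyEq h2.symm

/-- Every term of the second derivative that keeps a factor `q` vanishes at `t`. In the application
`q` is the numerator of the mean curvature, and this is how minimality enters the quadratic term. -/
theorem hasSecondDerivAt_sq_mul {q r : ℝ → ℝ} {t q₁ : ℝ} (hq : ContDiffAt ℝ ∞ q t)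
    (hr : ContDiffAt ℝ ∞ r t) (h0 : q t = 0) (h1 : HasDerivAt q q₁ t) :
    HasSecondDerivAt (fun s => q s ^ 2 * r s) (2 * q₁ ^ 2 * r t) t := by
  have hev : ∀ {f : ℝ → ℝ}, ContDiffAt ℝ ∞ f t → ∀ᶠ s in 𝓝 t, HasDerivAt f (deriv f s) s := by
    intro f hf
    filter_upwards [(hf.of_le (show (1 : ℕ∞ω) ≤ ∞ by exact_mod_cast le_top)).eventually
      (by simp)] with s hs
    exact (hs.differentiableAt (by simp)).hasDerivAt
  have hd : ∀ {f : ℝ → ℝ}, ContDiffAt ℝ ∞ f t → DifferentiableAt ℝ (deriv f) t := by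
    intro f hf
    have := (hf.of_le two_le_infty)
    exact ((this.fderiv_right (m := 1) (by norm_num)).differentiableAt (by norm_num)).clm_apply
      (differentiableAt_const 1)
  have hr0 := (hr.differentiableAt (by simp)).hasDerivAt
  refine ⟨fun s => 2 * q s * deriv q s * r s + q s ^ 2 * deriv r s, ?_, ?_⟩
  · filter_upwards [hev hq, hev hr] with s hs hs'
    refine ((hs.fun_pow 2).fun_mul hs').congr_deriv ?_
    norm_num
  · refine ((((h1.const_mul 2).fun_mul (hd hq).hasDerivAt).fun_mul hr0).fun_add
      ((h1.fun_pow 2).fun_mul (hd hr).hasDerivAt)).congr_deriv ?_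
    rw [h1.deriv, h0]
    push_cast
    ring

/-! ### Functions of time and position -/

/-- The time direction of `ℝ × ℂ`. -/
def timeDir : ℝ × ℂ := (1, 0)

/-- The coordinate directions of `ℝ × ℂ`. -/
def spaceDir (i : Fin 2) : ℝ × ℂ := (0, ![1, Complex.I] i)

section Slices

variable {F : Type*} [NormedAddCommGroup F] [NormedSpace ℝ F]

theorem pd_eq_dirDeriv (i : Fin 2) (f : ℂ → F) : pd i f = dirDeriv (![1, Complex.I] i) f := rfl

theorem hasDerivAt_slice {g : ℝ × ℂ → F} {t : ℝ} {z : ℂ} (hg : DifferentiableAt ℝ g (t, z)) :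
    HasDerivAt (fun s => g (s, z)) (dirDeriv timeDir g (t, z)) t := by
  have h1 : HasDerivAt (fun s : ℝ => (s, z)) ((1 : ℝ), (0 : ℂ)) t :=
    (hasDerivAt_id t).prodMk (hasDerivAt_const t z)
  exact hg.hasFDerivAt.comp_hasDerivAt t h1

theorem pd_slice {g : ℝ × ℂ → F} {t : ℝ} {z : ℂ} (hg : DifferentiableAt ℝ g (t, z)) (i : Fin 2) :
    pd i (fun y => g (t, y)) z = dirDeriv (spaceDir i) g (t, z) := by
  have h1 : HasFDerivAt (fun y : ℂ => (t, y)) (ContinuousLinearMap.inr ℝ ℝ ℂ) z :=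
    hasFDerivAt_prodMk_right t z
  have := (hg.hasFDerivAt.comp z h1).fderiv
  rw [pd]
  change fderiv ℝ (g ∘ fun y => (t, y)) z _ = _
  rw [this]
  simp [dirDeriv, spaceDir]

theorem hasSecondDerivAt_slice {g : ℝ × ℂ → ℝ} {O : Set (ℝ × ℂ)} (hO : IsOpen O)
    (hg : ContDiffOn ℝ ∞ g O) {t : ℝ} {z : ℂ} (hz : (t, z) ∈ O) :
    HasSecondDerivAt (fun s => g (s, z)) (dirDeriv timeDir (dirDeriv timeDir g) (t, z)) t := by
  refine ⟨fun s => dirDeriv timeDir g (s, z), ?_, hasDerivAt_slice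
    (ContDiffOn.differentiableAt_of_mem hO (ContDiffOn.dirDeriv hO hg _) hz)⟩
  have : ∀ᶠ s in 𝓝 t, (s, z) ∈ O :=
    (Continuous.prodMk_left z).continuousAt.preimage_mem_nhds (hO.mem_nhds hz)
  filter_upwards [this] with s hs
  exact hasDerivAt_slice (ContDiffOn.differentiableAt_of_mem hO hg hs)

end Slices

/-! ### The geometry of one immersion -/

section Immersion

variable {u : ℂ → E3} {U : Set ℂ}

theorem contDiffOn_pd {F : Type*} [NormedAddCommGroup F] [NormedSpace ℝ F] {f : ℂ → F}
    (hU : IsOpen U) (hf : ContDiffOn ℝ ∞ f U) (i : Fin 2) : ContDiffOn ℝ ∞ (pd i f) U :=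
  ContDiffOn.dirDeriv hU hf _

theorem contDiffAt_two {F : Type*} [NormedAddCommGroup F] [NormedSpace ℝ F] {f : ℂ → F}
    (hU : IsOpen U) (hf : ContDiffOn ℝ ∞ f U) {z : ℂ} (hz : z ∈ U) : ContDiffAt ℝ 2 f z :=
  (hf.contDiffAt (hU.mem_nhds hz)).of_le two_le_infty

theorem cross_eq_smul_unitNormal (u : ℂ → E3) (z : ℂ) :
    cross (pd 0 u z) (pd 1 u z) = ‖cross (pd 0 u z) (pd 1 u z)‖ • unitNormal u z := by
  by_cases h : cross (pd 0 u z) (pd 1 u z) = 0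
  · simp [h]
  · rw [unitNormal, smul_smul, mul_inv_cancel₀ (norm_ne_zero_iff.2 h), one_smul]

theorem inner_unitNormal_self {z : ℂ} (h : cross (pd 0 u z) (pd 1 u z) ≠ 0) :
    inner ℝ (unitNormal u z) (unitNormal u z) = 1 := by
  rw [real_inner_self_eq_norm_sq, unitNormal, norm_smul, norm_inv, norm_norm,
    inv_mul_cancel₀ (norm_ne_zero_iff.2 h), one_pow]

theorem inner_unitNormal_pd (u : ℂ → E3) (z : ℂ) (i : Fin 2) :
    inner ℝ (unitNormal u z) (pd i u z) = 0 := by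
  rw [unitNormal, real_inner_smul_left, real_inner_comm]
  fin_cases i
  · exact mul_eq_zero_of_right _ (inner_cross_left _ _)
  · exact mul_eq_zero_of_right _ (inner_cross_right _ _)

theorem contDiffOn_unitNormal (hU : IsOpen U) (hu : ContDiffOn ℝ ∞ u U)
    (himm : ∀ z ∈ U, cross (pd 0 u z) (pd 1 u z) ≠ 0) : ContDiffOn ℝ ∞ (unitNormal u) U := by
  have hc := contDiffOn_cross (contDiffOn_pd hU hu 0) (contDiffOn_pd hU hu 1)
  exact ((hc.norm ℝ himm).inv fun z hz => norm_ne_zero_iff.2 (himm z hz)).smul hc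

/-- The derivatives of a normal field against the coordinate fields. -/
theorem inner_pd_unitNormal (hU : IsOpen U) (hu : ContDiffOn ℝ ∞ u U)
    (himm : ∀ z ∈ U, cross (pd 0 u z) (pd 1 u z) ≠ 0) {z : ℂ} (hz : z ∈ U) (i j : Fin 2) :
    inner ℝ (pd i (unitNormal u) z) (pd j u z)
      = -inner ℝ (unitNormal u z) (pd i (pd j u) z) := by
  have h := dirDeriv_inner
    (ContDiffOn.differentiableAt_of_mem hU (contDiffOn_unitNormal hU hu himm) hz)
    (ContDiffOn.differentiableAt_of_mem hU (contDiffOn_pd hU hu j) hz) (![1, Complex.I] i)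
  have h0 : (fun y => inner ℝ (unitNormal u y) (pd j u y)) = fun _ => (0 : ℝ) :=
    funext fun y => inner_unitNormal_pd u y j
  rw [h0] at h
  simp only [dirDeriv, fderiv_fun_const, Pi.zero_apply, _root_.zero_apply] at h
  simp only [pd] at h ⊢
  linarith

theorem inner_unitNormal_pd_unitNormal (hU : IsOpen U) (hu : ContDiffOn ℝ ∞ u U)
    (himm : ∀ z ∈ U, cross (pd 0 u z) (pd 1 u z) ≠ 0) {z : ℂ} (hz : z ∈ U) (i : Fin 2) :
    inner ℝ (unitNormal u z) (pd i (unitNormal u) z) = 0 :=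
  inner_dirDeriv_unit hU (contDiffOn_unitNormal hU hu himm)
    (fun y hy => inner_unitNormal_self (himm y hy)) hz _

/-- `K dvol` is the pull-back of the area form of the sphere by the Gauss map. -/
theorem jetGauss_div_eq_det3 (hU : IsOpen U) (hu : ContDiffOn ℝ ∞ u U)
    (himm : ∀ z ∈ U, cross (pd 0 u z) (pd 1 u z) ≠ 0) {z : ℂ} (hz : z ∈ U) :
    jetGauss (jet u z) / ‖jetNormal (jet u z)‖ ^ 3
      = det3 (unitNormal u z) (pd 0 (unitNormal u) z) (pd 1 (unitNormal u) z) := by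
  -- Lagrange's identity for `⟨∂₁n × ∂₂n, ∂₁u × ∂₂u⟩`. By the Weingarten equations the right side
  -- becomes `h₁₁ h₂₂ - h₁₂²`; the left side is `s ⟨n, ∂₁n × ∂₂n⟩`.
  have hB := cross_inner_cross (pd 0 (unitNormal u) z) (pd 1 (unitNormal u) z)
    (pd 0 u z) (pd 1 u z)
  simp only [inner_pd_unitNormal hU hu himm hz] at hB
  rw [pd_comm (contDiffAt_two hU hu hz) 1 0] at hB
  have hs : ‖cross (pd 0 u z) (pd 1 u z)‖ ≠ 0 := norm_ne_zero_iff.2 (himm z hz)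
  have hn : ∀ x : E3, inner ℝ x (cross (pd 0 u z) (pd 1 u z))
      = ‖cross (pd 0 u z) (pd 1 u z)‖ * inner ℝ (unitNormal u z) x := by
    intro x
    conv_lhs => rw [cross_eq_smul_unitNormal]
    rw [real_inner_smul_right, real_inner_comm]
  rw [hn] at hB
  simp only [jetGauss, jetNormal, jet, Matrix.cons_val_zero, Matrix.cons_val_one, Matrix.cons_val]
  simp only [hn, det3]
  rw [div_eq_iff (pow_ne_zero 3 hs)]
  linear_combination (-‖cross (pd 0 u z) (pd 1 u z)‖ ^ 2) * hB

/-- The Hodge star of a one-form in terms of the dual tangent field. -/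
theorem hodgeStar_eq_det3 {z : ℂ} (himm : cross (pd 0 u z) (pd 1 u z) ≠ 0)
    {X : E3} {α : Fin 2 → ℂ → ℝ} (hXn : inner ℝ X (unitNormal u z) = 0)
    (hX : ∀ i, inner ℝ X (pd i u z) = α i z) (i : Fin 2) :
    hodgeStar u α i z = det3 (unitNormal u z) X (pd i u z) := by
  have hs : ‖cross (pd 0 u z) (pd 1 u z)‖ ≠ 0 := norm_ne_zero_iff.2 himm
  have hXc : inner ℝ X (cross (pd 0 u z) (pd 1 u z)) = 0 := by
    rw [cross_eq_smul_unitNormal, real_inner_smul_right, hXn, mul_zero]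
  -- For `X = ξ ∂₁u + η ∂₂u` both sides are the components `(-s η, s ξ)`: the star turns the dual
  -- field by a right angle.
  obtain ⟨ξ, η, rfl⟩ := exists_tangent_coords himm hXc
  have hd : det3 (unitNormal u z) (pd 0 u z) (pd 1 u z) = ‖cross (pd 0 u z) (pd 1 u z)‖ := by
    rw [det3]
    conv_lhs => rw [cross_eq_smul_unitNormal]
    rw [real_inner_smul_right, inner_unitNormal_self himm, mul_one]
  have hsq := norm_cross_sq (pd 0 u z) (pd 1 u z)
  have h0 := hX 0
  have h1 := hX 1
  rw [inner_add_left, real_inner_smul_left, real_inner_smul_left] at h0 h1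
  rw [real_inner_comm (pd 0 u z) (pd 1 u z)] at h0
  have hd0 : det3 (unitNormal u z) (ξ • pd 0 u z + η • pd 1 u z) (pd 0 u z)
      = -η * ‖cross (pd 0 u z) (pd 1 u z)‖ := by
    rw [← hd]
    simp only [det3_eq, PiLp.add_apply, PiLp.smul_apply, smul_eq_mul]
    ring
  have hd1 : det3 (unitNormal u z) (ξ • pd 0 u z + η • pd 1 u z) (pd 1 u z)
      = ξ * ‖cross (pd 0 u z) (pd 1 u z)‖ := by
    rw [← hd]
    simp only [det3_eq, PiLp.add_apply, PiLp.smul_apply, smul_eq_mul]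
    ring
  set s := ‖cross (pd 0 u z) (pd 1 u z)‖ with hsdef
  match i with
  | 0 =>
    rw [hd0]
    simp only [hodgeStar, Matrix.cons_val_zero, volDensity_eq, metric_inv, Fin.sum_univ_two,
      Matrix.smul_apply, Matrix.of_apply, Matrix.cons_val_one, smul_eq_mul, ← h0, ← h1]
    rw [← hsdef]
    field_simp
    rw [hsq]
    ring
  | 1 =>
    rw [hd1]
    simp only [hodgeStar, Matrix.cons_val_zero, volDensity_eq, metric_inv, Fin.sum_univ_two,
      Matrix.smul_apply, Matrix.of_apply, Matrix.cons_val_one, smul_eq_mul, ← h0, ← h1]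
    rw [← hsdef]
    field_simp
    rw [hsq]
    ring

theorem normSqD_eq_inner {z : ℂ} (himm : cross (pd 0 u z) (pd 1 u z) ≠ 0)
    {X : E3} {w : ℂ → ℝ} (hXn : inner ℝ X (unitNormal u z) = 0)
    (hX : ∀ i, inner ℝ X (pd i u z) = pd i w z) : normSqD u w z = inner ℝ X X := by
  have hs : ‖cross (pd 0 u z) (pd 1 u z)‖ ≠ 0 := norm_ne_zero_iff.2 himm
  have hXc : inner ℝ X (cross (pd 0 u z) (pd 1 u z)) = 0 := by
    rw [cross_eq_smul_unitNormal, real_inner_smul_right, hXn, mul_zero]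
  obtain ⟨ξ, η, rfl⟩ := exists_tangent_coords himm hXc
  have hsq := norm_cross_sq (pd 0 u z) (pd 1 u z)
  have h0 := hX 0
  have h1 := hX 1
  rw [inner_add_left, real_inner_smul_left, real_inner_smul_left] at h0 h1
  rw [real_inner_comm (pd 0 u z) (pd 1 u z)] at h0
  simp only [normSqD, metric_inv, Fin.sum_univ_two,
      Matrix.smul_apply, Matrix.of_apply, Matrix.cons_val_one, Matrix.cons_val_zero, smul_eq_mul,
      ← h0, ← h1, inner_add_left, inner_add_right, real_inner_smul_left, real_inner_smul_right,
      real_inner_comm (pd 0 u z) (pd 1 u z)]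
  field_simp
  rw [hsq]
  ring

/-- The Laplace-Beltrami operator as the divergence of the tangential gradient. -/
theorem volDensity_mul_laplacian (hU : IsOpen U) (hu : ContDiffOn ℝ ∞ u U)
    (himm : ∀ z ∈ U, cross (pd 0 u z) (pd 1 u z) ≠ 0) {X : ℂ → E3} {w : ℂ → ℝ}
    (hXs : ContDiffOn ℝ ∞ X U)
    (hXn : ∀ z ∈ U, inner ℝ (X z) (unitNormal u z) = 0)
    (hX : ∀ z ∈ U, ∀ i, inner ℝ (X z) (pd i u z) = pd i w z) {z : ℂ} (hz : z ∈ U) :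
    volDensity u z * laplacian u w z
      = det3 (unitNormal u z) (pd 0 X z) (pd 1 u z)
        + det3 (unitNormal u z) (pd 0 u z) (pd 1 X z) := by
  have hs : volDensity u z ≠ 0 := by
    rw [volDensity_eq]
    exact norm_ne_zero_iff.2 (himm z hz)
  have hU' := hU.mem_nhds hz
  -- The fluxes in the divergence are, up to sign, the components of `⋆dw`, hence triple products
  -- with `X`.
  have e0 : (fun y => volDensity u y * ∑ j, (metric u y)⁻¹ 0 j * pd j w y)
      =ᶠ[𝓝 z] fun y => det3 (unitNormal u y) (X y) (pd 1 u y) := by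
    filter_upwards [hU'] with y hy
    exact hodgeStar_eq_det3 (α := d0 w) (himm y hy) (hXn y hy) (hX y hy) 1
  have e1 : (fun y => volDensity u y * ∑ j, (metric u y)⁻¹ 1 j * pd j w y)
      =ᶠ[𝓝 z] fun y => -det3 (unitNormal u y) (X y) (pd 0 u y) := by
    filter_upwards [hU'] with y hy
    rw [← hodgeStar_eq_det3 (α := d0 w) (himm y hy) (hXn y hy) (hX y hy) 0]
    simp [hodgeStar, d0]
  have hn := ContDiffOn.differentiableAt_of_mem hU (contDiffOn_unitNormal hU hu himm) hz
  have hXd := ContDiffOn.differentiableAt_of_mem hU hXs hz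
  have hud : ∀ i, DifferentiableAt ℝ (pd i u) z := fun i =>
    ContDiffOn.differentiableAt_of_mem hU (contDiffOn_pd hU hu i) hz
  have hneg : ∀ (f : ℂ → ℝ) (i : Fin 2), pd i (fun y => -f y) z = -pd i f z := by
    intro f i
    simp only [pd, fderiv_fun_neg]
    rfl
  have hcong : ∀ (f g : ℂ → ℝ) (i : Fin 2), f =ᶠ[𝓝 z] g → pd i f z = pd i g z := by
    intro f g i h
    rw [pd, pd, h.fderiv_eq]
  rw [laplacian, ← mul_assoc, mul_inv_cancel₀ hs, one_mul, Fin.sum_univ_two,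
    hcong _ _ 0 e0, hcong _ _ 1 e1, hneg]
  have l0 := dirDeriv_det3 hn hXd (hud 1) (![1, Complex.I] 0)
  have l1 := dirDeriv_det3 hn hXd (hud 0) (![1, Complex.I] 1)
  simp only [← pd_eq_dirDeriv] at l0 l1
  rw [l0, l1, pd_comm (contDiffAt_two hU hu hz) 1 0]
  have hn0 : unitNormal u z ≠ 0 := by
    intro h0
    have := inner_unitNormal_self (himm z hz)
    simp [h0] at this
  -- Where the derivative falls on `n`, three tangent vectors meet in the triple product and it
  -- vanishes. The terms with `∂₁∂₂u` cancel by symmetry.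
  have z0 : det3 (pd 0 (unitNormal u) z) (X z) (pd 1 u z) = 0 :=
    det3_eq_zero_of_orthogonal hn0 (inner_unitNormal_pd_unitNormal hU hu himm hz 0)
      (by rw [real_inner_comm]; exact hXn z hz) (inner_unitNormal_pd u z 1)
  have z1 : det3 (pd 1 (unitNormal u) z) (X z) (pd 0 u z) = 0 :=
    det3_eq_zero_of_orthogonal hn0 (inner_unitNormal_pd_unitNormal hU hu himm hz 1)
      (by rw [real_inner_comm]; exact hXn z hz) (inner_unitNormal_pd u z 0)
  rw [z0, z1]
  simp only [det3_eq]
  ring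

end Immersion

/-- The pointwise identity between the variation of the Gauss map form and the boundary
one-form. -/
theorem gauss_variation_algebra {a b n X X₁ X₂ n₁ n₂ T Y : E3} {w s Δ K : ℝ}
    (hab : cross a b = s • n) (hs : s ≠ 0) (hn : inner ℝ n n = 1)
    (hX : inner ℝ X n = 0)
    (hsym : inner ℝ n₁ b = inner ℝ n₂ a)
    (hT₁ : inner ℝ T a = 2 * w * inner ℝ X n₁) (hT₂ : inner ℝ T b = 2 * w * inner ℝ X n₂)
    (hXsym : inner ℝ X₁ b = inner ℝ X₂ a)
    (hΔ : s * Δ = det3 n X₁ b + det3 n a X₂) (hK : s * K = det3 n n₁ n₂)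
    (hYa : inner ℝ Y a = 2 * inner ℝ X X₁) (hYb : inner ℝ Y b = 2 * inner ℝ X X₂) :
    det3 n T n₁ + det3 n X X₁ = (Δ + 2 * K * w) * det3 n X a - 1 / 2 * det3 n Y a ∧
    det3 n T n₂ + det3 n X X₂ = (Δ + 2 * K * w) * det3 n X b - 1 / 2 * det3 n Y b := by
  have hn0 : n ≠ 0 := by
    rintro rfl
    simp at hn
  have hab0 : cross a b ≠ 0 := by
    rw [hab]
    exact smul_ne_zero hs hn0
  have hXc : inner ℝ X (cross a b) = 0 := by
    rw [hab, real_inner_smul_right, hX, mul_zero]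
  obtain ⟨ξ, η, rfl⟩ := exists_tangent_coords hab0 hXc
  have hd : det3 n a b = s := by
    rw [det3, hab, real_inner_smul_right, hn, mul_one]
  have hna : inner ℝ n a = 0 := by
    have := inner_cross_left a b
    rw [hab, real_inner_smul_right, real_inner_comm] at this
    exact (mul_eq_zero.1 this).resolve_left hs
  have hnb : inner ℝ n b = 0 := by
    have := inner_cross_right a b
    rw [hab, real_inner_smul_right, real_inner_comm] at this
    exact (mul_eq_zero.1 this).resolve_left hs
  -- Vectors with the same products against `a` and `b` differ by a multiple of `n`, which `det3 n`
  -- ignores. By symmetry of the Weingarten map and of the Hessian, `T` may thus be replaced by `2w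
  -- dn(X)` and `Y` by twice the derivative of the field `X` in the direction `X`.
  have key : ∀ Z Z' : E3, inner ℝ Z a = inner ℝ Z' a → inner ℝ Z b = inner ℝ Z' b →
      Z = Z' + (inner ℝ Z n - inner ℝ Z' n) • n := by
    intro Z Z' h1 h2
    refine eq_of_inner_frame hab0 ?_ ?_ ?_
    · rw [inner_add_left, real_inner_smul_left, hna, mul_zero, add_zero, h1]
    · rw [inner_add_left, real_inner_smul_left, hnb, mul_zero, add_zero, h2]
    · rw [hab, inner_add_left, real_inner_smul_left]
      simp only [real_inner_smul_right, hn]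
      ring
  have hT := key T ((2 * w * ξ) • n₁ + (2 * w * η) • n₂)
    (by
      rw [hT₁]
      simp only [inner_add_left, real_inner_smul_left]
      rw [real_inner_comm n₁ a, real_inner_comm n₁ b, hsym]
      ring)
    (by
      rw [hT₂]
      simp only [inner_add_left, real_inner_smul_left]
      rw [real_inner_comm n₂ a, real_inner_comm n₂ b, hsym]
      ring)
  have hY := key Y ((2 * ξ) • X₁ + (2 * η) • X₂)
    (by
      rw [hYa]
      simp only [inner_add_left, real_inner_smul_left]
      rw [real_inner_comm X₁ a, real_inner_comm X₁ b, hXsym]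
      ring)
    (by
      rw [hYb]
      simp only [inner_add_left, real_inner_smul_left]
      rw [real_inner_comm X₂ a, real_inner_comm X₂ b, hXsym]
      ring)
  generalize inner ℝ T n - inner ℝ ((2 * w * ξ) • n₁ + (2 * w * η) • n₂) n = γ at hT
  generalize inner ℝ Y n - inner ℝ ((2 * ξ) • X₁ + (2 * η) • X₂) n = γ' at hY
  subst hT hY
  have ea : det3 n (ξ • a + η • b) a = -η * s := by
    rw [← hd]
    simp only [det3_eq, PiLp.add_apply, PiLp.smul_apply, smul_eq_mul]
    ring
  have eb : det3 n (ξ • a + η • b) b = ξ * s := by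
    rw [← hd]
    simp only [det3_eq, PiLp.add_apply, PiLp.smul_apply, smul_eq_mul]
    ring
  rw [ea, eb]
  simp only [det3_eq, PiLp.add_apply, PiLp.smul_apply, smul_eq_mul] at hΔ hK ⊢
  -- In the tangent plane `det(SX, e) + det(X, Se) = tr S · det(X, e)`, used for the Hessian `S` of
  -- `w`, with `tr S = Δ`. The Gauss part is `det(dn X, dn e) = K det(X, e)`.
  constructor
  · linear_combination η * hΔ + 2 * w * η * hK
  · linear_combination -ξ * hΔ - 2 * w * ξ * hK

/-- The pointwise computation of the variation of the mean curvature of a minimal surface in the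
direction `w n`. -/
theorem mean_variation_algebra {a b n X X₁ X₂ n₁ n₂ p q r a' b' p' q' r' : E3}
    {w w₁ w₂ w₁₁ w₁₂ w₂₂ s Δ K : ℝ}
    (hab : cross a b = s • n) (hs : s ≠ 0) (hn : inner ℝ n n = 1)
    (hXn : inner ℝ X n = 0) (hXa : inner ℝ X a = w₁) (hXb : inner ℝ X b = w₂)
    (hn₁ : inner ℝ n n₁ = 0) (hn₂ : inner ℝ n n₂ = 0)
    (h11 : inner ℝ n₁ a = -inner ℝ n p) (h12 : inner ℝ n₁ b = -inner ℝ n q)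
    (h21 : inner ℝ n₂ a = -inner ℝ n q) (h22 : inner ℝ n₂ b = -inner ℝ n r)
    (hX11 : inner ℝ X₁ a + inner ℝ X p = w₁₁) (hX12 : inner ℝ X₁ b + inner ℝ X q = w₁₂)
    (hX21 : inner ℝ X₂ a + inner ℝ X q = w₁₂) (hX22 : inner ℝ X₂ b + inner ℝ X r = w₂₂)
    (ha' : a' = w₁ • n + w • n₁) (hb' : b' = w₂ • n + w • n₂)
    (hp' : inner ℝ p' n = w₁₁ - w * inner ℝ n₁ n₁) (hq' : inner ℝ q' n = w₁₂ - w * inner ℝ n₁ n₂)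
    (hr' : inner ℝ r' n = w₂₂ - w * inner ℝ n₂ n₂)
    (hΔ : s * Δ = det3 n X₁ b + det3 n a X₂) (hK : s * K = det3 n n₁ n₂)
    (hmin : inner ℝ b b * inner ℝ p n - 2 * inner ℝ a b * inner ℝ q n
      + inner ℝ a a * inner ℝ r n = 0) :
    2 * inner ℝ b' b * inner ℝ p (cross a b)
        + inner ℝ b b * (inner ℝ p' (cross a b) + inner ℝ p (cross a' b + cross a b'))
        - 2 * (inner ℝ a' b + inner ℝ a b') * inner ℝ q (cross a b)
        - 2 * inner ℝ a b * (inner ℝ q' (cross a b) + inner ℝ q (cross a' b + cross a b'))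
        + 2 * inner ℝ a' a * inner ℝ r (cross a b)
        + inner ℝ a a * (inner ℝ r' (cross a b) + inner ℝ r (cross a' b + cross a b'))
      = s ^ 3 * (Δ - 2 * K * w) := by
  have hn0 : n ≠ 0 := by
    rintro rfl
    simp at hn
  have hab0 : cross a b ≠ 0 := by
    rw [hab]
    exact smul_ne_zero hs hn0
  have hna : inner ℝ n a = 0 := by
    have := inner_cross_left a b
    rw [hab, real_inner_smul_right, real_inner_comm] at this
    exact (mul_eq_zero.1 this).resolve_left hs
  have hnb : inner ℝ n b = 0 := by
    have := inner_cross_right a b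
    rw [hab, real_inner_smul_right, real_inner_comm] at this
    exact (mul_eq_zero.1 this).resolve_left hs
  have hs2 : s ^ 2 = inner ℝ a a * inner ℝ b b - inner ℝ a b ^ 2 := by
    rw [← norm_cross_sq, hab, ← real_inner_self_eq_norm_sq, real_inner_smul_left,
      real_inner_smul_right, hn]
    ring
  have hd : ∀ x y, s * det3 n x y = inner ℝ a x * inner ℝ b y - inner ℝ a y * inner ℝ b x := by
    intro x y
    rw [← cross_inner_cross, hab, real_inner_smul_left, det3]
  -- the variation of the normal vector
  have hN : cross a' b + cross a b' = -s • X := by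
    refine eq_of_inner_frame hab0 ?_ ?_ ?_
    · have : inner ℝ (cross a' b + cross a b') a = - det3 a' a b := by
        simp only [det3_eq, inner_eq_sum, PiLp.add_apply, cross_zero_coord, cross_one_coord,
          cross_two_coord]
        ring
      rw [this, det3, hab, ha', real_inner_smul_right, inner_add_left, real_inner_smul_left,
        real_inner_smul_left, real_inner_smul_left, hn, real_inner_comm n n₁]
      rw [hn₁, hXa]
      ring
    · have : inner ℝ (cross a' b + cross a b') b = - det3 b' a b := by
        simp only [det3_eq, inner_eq_sum, PiLp.add_apply, cross_zero_coord, cross_one_coord,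
          cross_two_coord]
        ring
      rw [this, det3, hab, hb', real_inner_smul_right, inner_add_left, real_inner_smul_left,
        real_inner_smul_left, real_inner_smul_left, hn, real_inner_comm n n₂]
      rw [hn₂, hXb]
      ring
    -- The normal component is the change of the area density, a multiple of `w H`, and vanishes by
    -- `hmin`.
    · rw [real_inner_comm, inner_add_right, cross_inner_cross, cross_inner_cross,
        real_inner_smul_left, hab, real_inner_smul_right, hXn, ha', hb']
      simp only [inner_add_right, real_inner_smul_right, real_inner_comm n a,
        real_inner_comm n b, hna, hnb, real_inner_comm n₁ a, real_inner_comm n₁ b,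
        real_inner_comm n₂ a, real_inner_comm n₂ b, h11, h12, h21, h22]
      simp only [real_inner_comm n p, real_inner_comm n q, real_inner_comm n r] at hmin ⊢
      rw [real_inner_comm a b]
      linear_combination (-w) * hmin
  have hfr : ∀ x y : E3, inner ℝ n y = 0 → s ^ 2 * inner ℝ x y
      = inner ℝ b b * (inner ℝ x a * inner ℝ y a)
        - inner ℝ a b * (inner ℝ x a * inner ℝ y b + inner ℝ x b * inner ℝ y a)
        + inner ℝ a a * (inner ℝ x b * inner ℝ y b) := by
    intro x y hy
    have h := congrArg (fun v => inner ℝ v y) (frame_expansion a b x)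
    simp only [inner_add_left, real_inner_smul_left] at h
    rw [← hs2.trans (norm_cross_sq a b).symm] at h
    rw [h, hab, real_inner_smul_left, hy, real_inner_comm y a, real_inner_comm y b]
    ring
  have e11 := hfr n₁ n₁ hn₁
  have e12 := hfr n₁ n₂ hn₂
  have e22 := hfr n₂ n₂ hn₂
  rw [h11, h12] at e11 e12
  rw [h21, h22] at e12 e22
  have hΔ' : s ^ 2 * Δ = inner ℝ b b * inner ℝ X₁ a - inner ℝ a b * inner ℝ X₁ b
      + inner ℝ a a * inner ℝ X₂ b - inner ℝ a b * inner ℝ X₂ a := by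
    have d1 := hd X₁ b
    have d2 := hd a X₂
    rw [real_inner_comm X₁ a, real_inner_comm X₁ b] at d1
    rw [real_inner_comm X₂ a, real_inner_comm X₂ b, real_inner_comm a b] at d2
    linear_combination s * hΔ + d1 + d2
  have hK' : s ^ 2 * K = inner ℝ n p * inner ℝ n r - inner ℝ n q ^ 2 := by
    have d := hd n₁ n₂
    rw [real_inner_comm n₁ a, real_inner_comm n₁ b, real_inner_comm n₂ a,
      real_inner_comm n₂ b, h11, h12, h21, h22] at d
    linear_combination s * hK + d
  rw [real_inner_comm n p, real_inner_comm n q, real_inner_comm n r] at hmin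
  -- The trace of the third fundamental form is `4H² - 2K`, hence `-2K` on a minimal surface.
  have hNN : inner ℝ b b * inner ℝ n₁ n₁ - 2 * inner ℝ a b * inner ℝ n₁ n₂
      + inner ℝ a a * inner ℝ n₂ n₂ = -2 * s ^ 2 * K := by
    refine mul_left_cancel₀ (pow_ne_zero 2 hs) ?_
    linear_combination inner ℝ b b * e11 - 2 * inner ℝ a b * e12 + inner ℝ a a * e22
      + 2 * s ^ 2 * hK' + (inner ℝ b b * inner ℝ n p - 2 * inner ℝ a b * inner ℝ n q
        + inner ℝ a a * inner ℝ n r) * hmin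
      + 2 * (inner ℝ n p * inner ℝ n r - inner ℝ n q ^ 2) * hs2
  have hbb : inner ℝ b' b = -w * inner ℝ n r := by
    rw [hb', inner_add_left, real_inner_smul_left, real_inner_smul_left, hnb, h22]
    ring
  have haa : inner ℝ a' a = -w * inner ℝ n p := by
    rw [ha', inner_add_left, real_inner_smul_left, real_inner_smul_left, hna, h11]
    ring
  have hab' : inner ℝ a' b + inner ℝ a b' = -2 * w * inner ℝ n q := by
    rw [real_inner_comm b' a, ha', hb', inner_add_left, inner_add_left, real_inner_smul_left,
      real_inner_smul_left, real_inner_smul_left, real_inner_smul_left, hna, hnb, h12, h21]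
    ring
  -- The change of the metric contributes `-4 s³ K w` and the third fundamental form `+2 s³ K w`.
  -- The second derivatives of `w`, corrected by the rotation of the normal, form the Hessian and
  -- give `s³ Δ`.
  rw [hN, hbb, haa, hab', hab]
  simp only [real_inner_smul_right, hp', hq', hr', real_inner_comm n p, real_inner_comm n q,
    real_inner_comm n r, real_inner_comm X p, real_inner_comm X q, real_inner_comm X r]
  linear_combination (-s * w) * hNN - s * hΔ' + 4 * w * s * hK' - s * inner ℝ b b * hX11
    + s * inner ℝ a b * (hX12 + hX21) - s * inner ℝ a a * hX22

/-! ### Linear variations of an immersion -/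

section Jets

theorem pd_congr {F : Type*} [NormedAddCommGroup F] [NormedSpace ℝ F] {f g : ℂ → F} {z : ℂ}
    (h : f =ᶠ[𝓝 z] g) (i : Fin 2) : pd i f z = pd i g z := by
  rw [pd, pd, h.fderiv_eq]

theorem pd_congr_eventually {F : Type*} [NormedAddCommGroup F] [NormedSpace ℝ F] {f g : ℂ → F}
    {z : ℂ} (h : f =ᶠ[𝓝 z] g) (i : Fin 2) : pd i f =ᶠ[𝓝 z] pd i g := by
  filter_upwards [h.eventuallyEq_nhds] with y hy using pd_congr hy i

theorem jet_congr {u v : ℂ → E3} {z : ℂ} (h : u =ᶠ[𝓝 z] v) : jet u z = jet v z := by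
  simp only [jet, pd_congr h, pd_congr (pd_congr_eventually h _)]

theorem pd_add_smul {F : Type*} [NormedAddCommGroup F] [NormedSpace ℝ F] {u v : ℂ → F} {z : ℂ}
    (hu : DifferentiableAt ℝ u z) (hv : DifferentiableAt ℝ v z) (t : ℝ) (i : Fin 2) :
    pd i (fun y => u y + t • v y) z = pd i u z + t • pd i v z := by
  rw [pd, fderiv_fun_add hu (hv.fun_const_smul t), fderiv_fun_const_smul hv]
  rfl

theorem pd_pd_add_smul {F : Type*} [NormedAddCommGroup F] [NormedSpace ℝ F] {u v : ℂ → F} {z : ℂ}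
    (hu : ContDiffAt ℝ 2 u z) (hv : ContDiffAt ℝ 2 v z) (t : ℝ) (i j : Fin 2) :
    pd i (pd j (fun y => u y + t • v y)) z = pd i (pd j u) z + t • pd i (pd j v) z := by
  have hd : ∀ {f : ℂ → F}, ContDiffAt ℝ 2 f z → DifferentiableAt ℝ (pd j f) z := fun hf =>
    ((hf.fderiv_right (m := 1) (by norm_num)).differentiableAt (by norm_num)).clm_apply
      (differentiableAt_const _)
  rw [← pd_add_smul (hd hu) (hd hv)]
  refine pd_congr ?_ i
  filter_upwards [hu.eventually (by simp), hv.eventually (by simp)] with y h1 h2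
  exact pd_add_smul (h1.differentiableAt (by simp)) (h2.differentiableAt (by simp)) t j

theorem jet_add_smul {u v : ℂ → E3} {z : ℂ} (hu : ContDiffAt ℝ 2 u z) (hv : ContDiffAt ℝ 2 v z)
    (t : ℝ) : jet (fun y => u y + t • v y) z = jet u z + t • jet v z := by
  have hu' := hu.differentiableAt (by simp)
  have hv' := hv.differentiableAt (by simp)
  funext k
  fin_cases k
  exacts [pd_add_smul hu' hv' t 0, pd_add_smul hu' hv' t 1, pd_pd_add_smul hu hv t 0 0,
    pd_pd_add_smul hu hv t 0 1, pd_pd_add_smul hu hv t 1 1]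

end Jets

/-- The coordinate fields `∂ᵢ(u + tB)` as functions of time and position. -/
def frameMap (u B : ℂ → E3) (i : Fin 2) (p : ℝ × ℂ) : E3 := pd i u p.2 + p.1 • pd i B p.2

/-- The normal vector of `u + tB` as a function of time and position. -/
def normalMap (u B : ℂ → E3) (p : ℝ × ℂ) : E3 := cross (frameMap u B 0 p) (frameMap u B 1 p)

/-- The Gauss map of `u + tB` as a function of time and position. -/
def gaussMap (u B : ℂ → E3) (p : ℝ × ℂ) : E3 := ‖normalMap u B p‖⁻¹ • normalMap u B p

/-- The times and positions at which `u + tB` is an immersion. -/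
def gaussDomain (u B : ℂ → E3) (U : Set ℂ) : Set (ℝ × ℂ) :=
  (univ ×ˢ U) ∩ {p | normalMap u B p ≠ 0}

/-- The one-form `⟨n, ∂ₜn × dn⟩`. -/
def gaussForm (u B : ℂ → E3) (i : Fin 2) (p : ℝ × ℂ) : ℝ :=
  det3 (gaussMap u B p) (dirDeriv timeDir (gaussMap u B) p) (dirDeriv (spaceDir i) (gaussMap u B) p)

/-! ### The Gauss map of a straight-line variation in space-time -/

section Variation

variable {u B : ℂ → E3} {U : Set ℂ}

theorem contDiffOn_frameMap (hU : IsOpen U) (hu : ContDiffOn ℝ ∞ u U) (hB : ContDiffOn ℝ ∞ B U)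
    (i : Fin 2) : ContDiffOn ℝ ∞ (frameMap u B i) (univ ×ˢ U) := by
  have hm : MapsTo (Prod.snd : ℝ × ℂ → ℂ) (univ ×ˢ U) U := fun p hp => hp.2
  exact ((contDiffOn_pd hU hu i).comp contDiff_snd.contDiffOn hm).add
    (contDiff_fst.contDiffOn.smul ((contDiffOn_pd hU hB i).comp contDiff_snd.contDiffOn hm))

theorem contDiffOn_normalMap (hU : IsOpen U) (hu : ContDiffOn ℝ ∞ u U)
    (hB : ContDiffOn ℝ ∞ B U) : ContDiffOn ℝ ∞ (normalMap u B) (univ ×ˢ U) :=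
  contDiffOn_cross (contDiffOn_frameMap hU hu hB 0) (contDiffOn_frameMap hU hu hB 1)

theorem isOpen_gaussDomain (hU : IsOpen U) (hu : ContDiffOn ℝ ∞ u U)
    (hB : ContDiffOn ℝ ∞ B U) : IsOpen (gaussDomain u B U) :=
  (contDiffOn_normalMap hU hu hB).continuousOn.isOpen_inter_preimage (isOpen_univ.prod hU)
    isOpen_ne

theorem contDiffOn_gaussMap (hU : IsOpen U) (hu : ContDiffOn ℝ ∞ u U)
    (hB : ContDiffOn ℝ ∞ B U) : ContDiffOn ℝ ∞ (gaussMap u B) (gaussDomain u B U) := by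
  have hc := (contDiffOn_normalMap hU hu hB).mono
    (inter_subset_left (t := {p | normalMap u B p ≠ 0}))
  exact ((hc.norm ℝ fun p hp => hp.2).inv fun p hp => norm_ne_zero_iff.2 hp.2).smul hc

theorem inner_gaussMap_self {p : ℝ × ℂ} (hp : p ∈ gaussDomain u B U) :
    inner ℝ (gaussMap u B p) (gaussMap u B p) = 1 := by
  rw [real_inner_self_eq_norm_sq, gaussMap, norm_smul, norm_inv, norm_norm,
    inv_mul_cancel₀ (norm_ne_zero_iff.2 hp.2), one_pow]

theorem inner_gaussMap_frameMap (p : ℝ × ℂ) (i : Fin 2) :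
    inner ℝ (gaussMap u B p) (frameMap u B i p) = 0 := by
  rw [gaussMap, real_inner_smul_left, real_inner_comm]
  fin_cases i
  · exact mul_eq_zero_of_right _ (inner_cross_left _ _)
  · exact mul_eq_zero_of_right _ (inner_cross_right _ _)

theorem unitNormal_add_smul (hU : IsOpen U) (hu : ContDiffOn ℝ ∞ u U) (hB : ContDiffOn ℝ ∞ B U)
    (t : ℝ) {z : ℂ} (hz : z ∈ U) :
    unitNormal (fun y => u y + t • B y) z = gaussMap u B (t, z) := by
  have h := fun i => pd_add_smul (ContDiffOn.differentiableAt_of_mem hU hu hz)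
    (ContDiffOn.differentiableAt_of_mem hU hB hz) t i
  rw [unitNormal, h, h]
  rfl

theorem gaussMap_zero (u B : ℂ → E3) (z : ℂ) : gaussMap u B (0, z) = unitNormal u z := by
  simp [gaussMap, normalMap, frameMap, unitNormal]

theorem mem_gaussDomain_zero {z : ℂ} (hz : z ∈ U) (himm : cross (pd 0 u z) (pd 1 u z) ≠ 0) :
    ((0 : ℝ), z) ∈ gaussDomain u B U := by
  refine ⟨⟨mem_univ _, hz⟩, ?_⟩
  simpa [normalMap, frameMap] using himm

theorem contDiffOn_gaussForm (hU : IsOpen U) (hu : ContDiffOn ℝ ∞ u U)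
    (hB : ContDiffOn ℝ ∞ B U) (i : Fin 2) :
    ContDiffOn ℝ ∞ (gaussForm u B i) (gaussDomain u B U) :=
  contDiffOn_det3 (contDiffOn_gaussMap hU hu hB)
    (ContDiffOn.dirDeriv (isOpen_gaussDomain hU hu hB) (contDiffOn_gaussMap hU hu hB) _)
    (ContDiffOn.dirDeriv (isOpen_gaussDomain hU hu hB) (contDiffOn_gaussMap hU hu hB) _)

/-- Restriction of a smooth function on the space-time domain to time zero. -/
theorem contDiffOn_slice_zero {F : Type*} [NormedAddCommGroup F] [NormedSpace ℝ F]
    {g : ℝ × ℂ → F} (hg : ContDiffOn ℝ ∞ g (gaussDomain u B U))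
    (himm : ∀ z ∈ U, cross (pd 0 u z) (pd 1 u z) ≠ 0) :
    ContDiffOn ℝ ∞ (fun z => g (0, z)) U :=
  hg.comp (contDiff_const.prodMk contDiff_id).contDiffOn
    fun z hz => mem_gaussDomain_zero hz (himm z hz)

/-- The density of `K dvol` for `u + tB`. -/
theorem jetGauss_add_smul (hU : IsOpen U) (hu : ContDiffOn ℝ ∞ u U) (hB : ContDiffOn ℝ ∞ B U)
    {t : ℝ} {z : ℂ} (hz : (t, z) ∈ gaussDomain u B U) :
    jetGauss (jet u z + t • jet B z) / ‖jetNormal (jet u z + t • jet B z)‖ ^ 3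
      = det3 (gaussMap u B (t, z)) (dirDeriv (spaceDir 0) (gaussMap u B) (t, z))
        (dirDeriv (spaceDir 1) (gaussMap u B) (t, z)) := by
  have hO := isOpen_gaussDomain hU hu hB
  have hzU : z ∈ U := hz.1.2
  -- At time `t` the variation is known to be immersed only on this open slice, so the pull-back
  -- formula is applied there.
  set U' : Set ℂ := {y | (t, y) ∈ gaussDomain u B U} with hU'def
  have hU' : IsOpen U' := hO.preimage (Continuous.prodMk_right t)
  have hsub : U' ⊆ U := fun y hy => hy.1.2
  have hut : ContDiffOn ℝ ∞ (fun y => u y + t • B y) U' :=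
    (hu.mono hsub).add ((contDiffOn_const (c := t)).smul (hB.mono hsub))
  have hpd : ∀ y ∈ U, ∀ i, pd i (fun y => u y + t • B y) y = frameMap u B i (t, y) :=
    fun y hy i => pd_add_smul (ContDiffOn.differentiableAt_of_mem hU hu hy)
      (ContDiffOn.differentiableAt_of_mem hU hB hy) t i
  have himm : ∀ y ∈ U', cross (pd 0 (fun y => u y + t • B y) y)
      (pd 1 (fun y => u y + t • B y) y) ≠ 0 := by
    intro y hy
    rw [hpd y (hsub hy), hpd y (hsub hy)]
    exact hy.2
  rw [← jet_add_smul (contDiffAt_two hU hu hzU) (contDiffAt_two hU hB hzU),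
    jetGauss_div_eq_det3 hU' hut himm hz]
  have hev : unitNormal (fun y => u y + t • B y) =ᶠ[𝓝 z] fun y => gaussMap u B (t, y) := by
    filter_upwards [hU.mem_nhds hzU] with y hy using unitNormal_add_smul hU hu hB t hy
  have hd := ContDiffOn.differentiableAt_of_mem hO (contDiffOn_gaussMap hU hu hB) hz
  rw [pd_congr hev, pd_congr hev, pd_slice hd, pd_slice hd, hev.self_of_nhds]

/-- The velocity of the Gauss map against the coordinate fields. -/
theorem inner_dirDeriv_gaussMap (hU : IsOpen U) (hu : ContDiffOn ℝ ∞ u U)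
    (hB : ContDiffOn ℝ ∞ B U) {p : ℝ × ℂ} (hp : p ∈ gaussDomain u B U) (i : Fin 2) :
    inner ℝ (dirDeriv timeDir (gaussMap u B) p) (frameMap u B i p)
      = -inner ℝ (gaussMap u B p) (pd i B p.2) := by
  have hO := isOpen_gaussDomain hU hu hB
  have hf : DifferentiableAt ℝ (frameMap u B i) p := ContDiffOn.differentiableAt_of_mem
    (isOpen_univ.prod hU) (contDiffOn_frameMap hU hu hB i) hp.1
  have h := dirDeriv_inner (ContDiffOn.differentiableAt_of_mem hO
    (contDiffOn_gaussMap hU hu hB) hp) hf timeDir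
  have h0 : (fun y => inner ℝ (gaussMap u B y) (frameMap u B i y)) = fun _ => (0 : ℝ) :=
    funext fun y => inner_gaussMap_frameMap y i
  have h1 : dirDeriv timeDir (frameMap u B i) p = pd i B p.2 := by
    have hs : HasDerivAt (fun s : ℝ => pd i u p.2 + s • pd i B p.2) (pd i B p.2) p.1 := by
      simpa using ((hasDerivAt_id p.1).smul_const (pd i B p.2)).const_add (pd i u p.2)
    exact (hasDerivAt_slice (g := frameMap u B i) (t := p.1) (z := p.2) hf).unique hs
  rw [h0, h1] at h
  simp only [dirDeriv, fderiv_fun_const, Pi.zero_apply, _root_.zero_apply] at h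
  simp only [dirDeriv]
  linarith

/-- The acceleration of the Gauss map against the coordinate fields. -/
theorem inner_dirDeriv_dirDeriv_gaussMap (hU : IsOpen U) (hu : ContDiffOn ℝ ∞ u U)
    (hB : ContDiffOn ℝ ∞ B U) {p : ℝ × ℂ} (hp : p ∈ gaussDomain u B U) (i : Fin 2) :
    inner ℝ (dirDeriv timeDir (dirDeriv timeDir (gaussMap u B)) p) (frameMap u B i p)
      = -2 * inner ℝ (dirDeriv timeDir (gaussMap u B) p) (pd i B p.2) := by
  have hO := isOpen_gaussDomain hU hu hB
  have hν := contDiffOn_gaussMap hU hu hB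
  have hf : DifferentiableAt ℝ (frameMap u B i) p := ContDiffOn.differentiableAt_of_mem
    (isOpen_univ.prod hU) (contDiffOn_frameMap hU hu hB i) hp.1
  have hT := ContDiffOn.differentiableAt_of_mem hO (ContDiffOn.dirDeriv hO hν timeDir) hp
  have hn := ContDiffOn.differentiableAt_of_mem hO hν hp
  have h1 : HasDerivAt (fun s : ℝ => frameMap u B i (s, p.2)) (pd i B p.2) p.1 := by
    simpa [frameMap] using
      ((hasDerivAt_id p.1).smul_const (pd i B p.2)).const_add (pd i u p.2)
  -- The velocity identity is differentiated once more. The product `⟨∂ₜn, ∂ᵢB⟩` appears on both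
  -- sides, whence the factor `2`.
  have e1 := (hasDerivAt_slice (g := dirDeriv timeDir (gaussMap u B)) (t := p.1) (z := p.2)
    hT).inner ℝ h1
  have e2 := ((hasDerivAt_slice (g := gaussMap u B) (t := p.1) (z := p.2)
    hn).inner ℝ (hasDerivAt_const p.1 (pd i B p.2))).neg
  have hev : (fun s : ℝ => inner ℝ (dirDeriv timeDir (gaussMap u B) (s, p.2))
      (frameMap u B i (s, p.2))) =ᶠ[𝓝 p.1]
      fun s => -inner ℝ (gaussMap u B (s, p.2)) (pd i B p.2) := by
    have : ∀ᶠ s in 𝓝 p.1, (s, p.2) ∈ gaussDomain u B U :=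
      (Continuous.prodMk_left p.2).continuousAt.preimage_mem_nhds (hO.mem_nhds hp)
    filter_upwards [this] with s hs using inner_dirDeriv_gaussMap hU hu hB hs i
  have := (e1.congr_of_eventuallyEq hev.symm).unique e2
  simp only [inner_zero_right, zero_add, Prod.mk.eta] at this
  linarith

/-- The density `Q² / (4 s⁵)` part and the `K dvol` part of the Willmore integrand. -/
theorem jetWillmore_add_smul (hU : IsOpen U) (hu : ContDiffOn ℝ ∞ u U) (hB : ContDiffOn ℝ ∞ B U)
    {t : ℝ} {z : ℂ} (hz : (t, z) ∈ gaussDomain u B U) :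
    jetWillmore (jet u z + t • jet B z)
      = jetMean (jet u z + t • jet B z) ^ 2 * (4 * ‖jetNormal (jet u z + t • jet B z)‖ ^ 5)⁻¹
        - det3 (gaussMap u B (t, z)) (dirDeriv (spaceDir 0) (gaussMap u B) (t, z))
        (dirDeriv (spaceDir 1) (gaussMap u B) (t, z)) := by
  rw [jetWillmore, jetGauss_add_smul hU hu hB hz, div_eq_mul_inv]

/-- Second derivative of the Willmore integrand along `u + tB` at a point of vanishing mean
curvature. -/
theorem hasSecondDerivAt_jetWillmore (hU : IsOpen U) (hu : ContDiffOn ℝ ∞ u U)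
    (hB : ContDiffOn ℝ ∞ B U) {z : ℂ} (hz : z ∈ U) (himm : cross (pd 0 u z) (pd 1 u z) ≠ 0)
    (hmin : jetMean (jet u z) = 0) {q₁ : ℝ}
    (hq : HasDerivAt (fun t : ℝ => jetMean (jet u z + t • jet B z)) q₁ 0) :
    HasSecondDerivAt (fun t : ℝ => jetWillmore (jet u z + t • jet B z))
      (q₁ ^ 2 / (2 * volDensity u z ^ 5)
        - (dirDeriv (spaceDir 0) (dirDeriv timeDir (gaussForm u B 1)) (0, z)
          - dirDeriv (spaceDir 1) (dirDeriv timeDir (gaussForm u B 0)) (0, z))) 0 := by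
  have hO := isOpen_gaussDomain hU hu hB
  have hν := contDiffOn_gaussMap hU hu hB
  have hz0 := mem_gaussDomain_zero (B := B) hz himm
  have hline : ContDiff ℝ ∞ fun t : ℝ => jet u z + t • jet B z :=
    contDiff_const.add (contDiff_id.smul contDiff_const)
  have hJ0 : jet u z + (0 : ℝ) • jet B z = jet u z := by simp
  have h1 : HasSecondDerivAt (fun t : ℝ => jetMean (jet u z + t • jet B z) ^ 2
      * (4 * ‖jetNormal (jet u z + t • jet B z)‖ ^ 5)⁻¹)
      (2 * q₁ ^ 2 * (4 * ‖jetNormal (jet u z + (0 : ℝ) • jet B z)‖ ^ 5)⁻¹) 0 := by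
    refine hasSecondDerivAt_sq_mul (contDiff_jetMean.comp hline).contDiffAt ?_ ?_ hq
    · have hne : jetNormal (jet u z + (0 : ℝ) • jet B z) ≠ 0 := by
        rw [hJ0]
        exact himm
      exact (contDiffAt_const.mul (((contDiff_jetNormal.comp hline).contDiffAt.norm ℝ
        hne).pow 5)).inv (mul_ne_zero (by norm_num) (pow_ne_zero 5 (norm_ne_zero_iff.2 hne)))
    · rw [hJ0, hmin]
  have hk : ContDiffOn ℝ ∞ (fun p => det3 (gaussMap u B p)
      (dirDeriv (spaceDir 0) (gaussMap u B) p) (dirDeriv (spaceDir 1) (gaussMap u B) p))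
      (gaussDomain u B U) :=
    contDiffOn_det3 hν (ContDiffOn.dirDeriv hO hν _) (ContDiffOn.dirDeriv hO hν _)
  have h2 := hasSecondDerivAt_slice hO hk hz0
  -- Closedness of the area form of the sphere gives `∂ₜ(K dvol) = dβ` on a whole neighbourhood, so
  -- it can be differentiated again. The scalar `-1` keeps the right side a sum, as `dirDeriv_add`
  -- requires.
  have hdk : dirDeriv timeDir (fun p => det3 (gaussMap u B p)
      (dirDeriv (spaceDir 0) (gaussMap u B) p) (dirDeriv (spaceDir 1) (gaussMap u B) p))
      =ᶠ[𝓝 (0, z)] fun p => dirDeriv (spaceDir 0) (gaussForm u B 1) p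
        + (-1 : ℝ) • dirDeriv (spaceDir 1) (gaussForm u B 0) p := by
    filter_upwards [hO.mem_nhds hz0] with p hp
    rw [dirDeriv_det3_unit hO hν (fun x hx => inner_gaussMap_self hx) hp timeDir (spaceDir 0)
      (spaceDir 1)]
    simp only [smul_eq_mul, neg_mul, one_mul]
    rfl
  have hβ : ∀ i, ContDiffOn ℝ ∞ (gaussForm u B i) (gaussDomain u B U) :=
    contDiffOn_gaussForm hU hu hB
  have hβd : ∀ i v, DifferentiableAt ℝ (dirDeriv v (gaussForm u B i)) (0, z) := fun i v =>
    ContDiffOn.differentiableAt_of_mem hO (ContDiffOn.dirDeriv hO (hβ i) v) hz0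
  have hβ2 : ∀ i, ContDiffAt ℝ 2 (gaussForm u B i) (0, z) := fun i =>
    ((hβ i).contDiffAt (hO.mem_nhds hz0)).of_le two_le_infty
  have hval : dirDeriv timeDir (dirDeriv timeDir (fun p => det3 (gaussMap u B p)
      (dirDeriv (spaceDir 0) (gaussMap u B) p) (dirDeriv (spaceDir 1) (gaussMap u B) p))) (0, z)
      = dirDeriv (spaceDir 0) (dirDeriv timeDir (gaussForm u B 1)) (0, z)
          - dirDeriv (spaceDir 1) (dirDeriv timeDir (gaussForm u B 0)) (0, z) := by
    rw [dirDeriv_congr hdk, dirDeriv_add (hβd 1 _) ((hβd 0 _).fun_const_smul (-1 : ℝ)),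
      dirDeriv_comm (hβ2 1)]
    have : dirDeriv timeDir (fun p => (-1 : ℝ) • dirDeriv (spaceDir 1) (gaussForm u B 0) p) (0, z)
        = -dirDeriv timeDir (dirDeriv (spaceDir 1) (gaussForm u B 0)) (0, z) := by
      rw [dirDeriv, fderiv_fun_const_smul (hβd 0 _)]
      simp [dirDeriv]
    rw [this, dirDeriv_comm (hβ2 0)]
    ring
  rw [hval] at h2
  have h3 := h1.sub h2
  have hvd : volDensity u z = ‖jetNormal (jet u z)‖ := volDensity_eq u z
  have hc : 2 * q₁ ^ 2 * (4 * ‖jetNormal (jet u z + (0 : ℝ) • jet B z)‖ ^ 5)⁻¹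
      = q₁ ^ 2 / (2 * volDensity u z ^ 5) := by
    have hne : ‖jetNormal (jet u z)‖ ≠ 0 := norm_ne_zero_iff.2 himm
    rw [hJ0, hvd]
    field_simp
    ring
  rw [← hc]
  refine h3.congr ?_
  have : ∀ᶠ s in 𝓝 (0 : ℝ), (s, z) ∈ gaussDomain u B U :=
    (Continuous.prodMk_left z).continuousAt.preimage_mem_nhds (hO.mem_nhds hz0)
  filter_upwards [this] with s hs using (jetWillmore_add_smul hU hu hB hs).symm

/-- First derivative of the Willmore integrand along `u + tB` at a point of vanishing mean
curvature. -/
theorem hasDerivAt_jetWillmore (hU : IsOpen U) (hu : ContDiffOn ℝ ∞ u U)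
    (hB : ContDiffOn ℝ ∞ B U) {z : ℂ} (hz : z ∈ U) (himm : cross (pd 0 u z) (pd 1 u z) ≠ 0)
    (hmin : jetMean (jet u z) = 0) :
    HasDerivAt (fun t : ℝ => jetWillmore (jet u z + t • jet B z))
      (-d1 (fun i y => gaussForm u B i (0, y)) z) 0 := by
  have hO := isOpen_gaussDomain hU hu hB
  have hν := contDiffOn_gaussMap hU hu hB
  have hz0 := mem_gaussDomain_zero (B := B) hz himm
  have hline : ContDiff ℝ ∞ fun t : ℝ => jet u z + t • jet B z :=
    contDiff_const.add (contDiff_id.smul contDiff_const)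
  have hJ0 : jet u z + (0 : ℝ) • jet B z = jet u z := by simp
  have hne : jetNormal (jet u z + (0 : ℝ) • jet B z) ≠ 0 := by
    rw [hJ0]
    exact himm
  have hq := ((contDiff_jetMean.comp hline).contDiffAt (x := 0)).differentiableAt (by simp)
  have hr := ((contDiffAt_const (c := (4 : ℝ))).mul
    (((contDiff_jetNormal.comp hline).contDiffAt.norm ℝ hne).pow 5)).inv
      (mul_ne_zero (by norm_num) (pow_ne_zero 5 (norm_ne_zero_iff.2 hne)))
      |>.differentiableAt (by simp)
  have h1 := (hq.hasDerivAt.fun_pow 2).fun_mul hr.hasDerivAt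
  have hk : ContDiffOn ℝ ∞ (fun p => det3 (gaussMap u B p)
      (dirDeriv (spaceDir 0) (gaussMap u B) p) (dirDeriv (spaceDir 1) (gaussMap u B) p))
      (gaussDomain u B U) :=
    contDiffOn_det3 hν (ContDiffOn.dirDeriv hO hν _) (ContDiffOn.dirDeriv hO hν _)
  have h2 := hasDerivAt_slice (ContDiffOn.differentiableAt_of_mem hO hk hz0)
  have hβ : ∀ i, DifferentiableAt ℝ (gaussForm u B i) (0, z) := fun i =>
    ContDiffOn.differentiableAt_of_mem hO (contDiffOn_gaussForm hU hu hB i) hz0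
  rw [dirDeriv_det3_unit hO hν (fun x hx => inner_gaussMap_self hx) hz0 timeDir (spaceDir 0)
      (spaceDir 1)] at h2
  change HasDerivAt _ (dirDeriv (spaceDir 0) (gaussForm u B 1) (0, z)
    - dirDeriv (spaceDir 1) (gaussForm u B 0) (0, z)) 0 at h2
  have hd1 : d1 (fun i y => gaussForm u B i (0, y)) z
      = dirDeriv (spaceDir 0) (gaussForm u B 1) (0, z)
        - dirDeriv (spaceDir 1) (gaussForm u B 0) (0, z) := by
    rw [d1, pd_slice (hβ 1), pd_slice (hβ 0)]
  have h3 := h1.sub h2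
  have hev : (fun t : ℝ => jetWillmore (jet u z + t • jet B z)) =ᶠ[𝓝 0]
      fun t => jetMean (jet u z + t • jet B z) ^ 2
        * (4 * ‖jetNormal (jet u z + t • jet B z)‖ ^ 5)⁻¹
        - det3 (gaussMap u B (t, z)) (dirDeriv (spaceDir 0) (gaussMap u B) (t, z))
          (dirDeriv (spaceDir 1) (gaussMap u B) (t, z)) := by
    have : ∀ᶠ s in 𝓝 (0 : ℝ), (s, z) ∈ gaussDomain u B U :=
      (Continuous.prodMk_left z).continuousAt.preimage_mem_nhds (hO.mem_nhds hz0)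
    filter_upwards [this] with s hs using jetWillmore_add_smul hU hu hB hs
  refine (h3.congr_of_eventuallyEq hev).congr_deriv ?_
  rw [hd1]
  -- The derivative of `Q² r` keeps a factor `Q`, which is zero here; only the exact part remains.
  simp only [Function.comp_apply, hJ0, hmin]
  ring

/-- The variation of the Gauss map vanishes where the variation field vanishes locally. -/
theorem gaussForm_eq_zero {z : ℂ} (hB : B =ᶠ[𝓝 z] 0) (i : Fin 2)
    (hd : DifferentiableAt ℝ (gaussMap u B) (0, z)) : gaussForm u B i (0, z) = 0 := by
  have h0 : ∀ i, pd i B z = 0 := by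
    intro i
    rw [pd_congr hB i]
    simp [pd]
  have h1 : (fun s => gaussMap u B (s, z)) = fun _ => gaussMap u B (0, z) := by
    funext s
    simp [gaussMap, normalMap, frameMap, h0]
  have h2 := hasDerivAt_slice hd
  rw [h1] at h2
  rw [gaussForm, h2.unique (hasDerivAt_const _ _), det3_eq]
  simp

end Variation

/-! ### The second variation in normal directions -/

/-- The coefficients invert the Gram matrix of `a`, `b`, whose determinant is `|a × b|²`. It
supplies a tangent vector dual to `d|dw|²` at a point. -/
theorem exists_tangent_dual {a b : E3} (hab : cross a b ≠ 0) (c₀ c₁ : ℝ) :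
    ∃ Y : E3, inner ℝ Y (cross a b) = 0 ∧ inner ℝ Y a = c₀ ∧ inner ℝ Y b = c₁ := by
  have hs : ‖cross a b‖ ^ 2 ≠ 0 := pow_ne_zero 2 (norm_ne_zero_iff.2 hab)
  refine ⟨(‖cross a b‖ ^ 2)⁻¹ • ((inner ℝ b b * c₀ - inner ℝ a b * c₁) • a
    + (inner ℝ a a * c₁ - inner ℝ a b * c₀) • b), ?_, ?_, ?_⟩
  · simp only [real_inner_smul_left, inner_add_left, inner_cross_left, inner_cross_right]
    ring
  · simp only [real_inner_smul_left, inner_add_left, real_inner_comm a b]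
    field_simp
    rw [norm_cross_sq]
    ring
  · simp only [real_inner_smul_left, inner_add_left]
    field_simp
    rw [norm_cross_sq]
    ring

/-- The product rule, arranged as the left-hand side of `mean_variation_algebra` so that the two
match term by term. -/
theorem hasDerivAt_jetMean (J J' : Fin 5 → E3) :
    HasDerivAt (fun t : ℝ => jetMean (J + t • J'))
      (2 * inner ℝ (J' 1) (J 1) * inner ℝ (J 2) (cross (J 0) (J 1))
        + inner ℝ (J 1) (J 1) * (inner ℝ (J' 2) (cross (J 0) (J 1))
          + inner ℝ (J 2) (cross (J' 0) (J 1) + cross (J 0) (J' 1)))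
        - 2 * (inner ℝ (J' 0) (J 1) + inner ℝ (J 0) (J' 1)) * inner ℝ (J 3) (cross (J 0) (J 1))
        - 2 * inner ℝ (J 0) (J 1) * (inner ℝ (J' 3) (cross (J 0) (J 1))
          + inner ℝ (J 3) (cross (J' 0) (J 1) + cross (J 0) (J' 1)))
        + 2 * inner ℝ (J' 0) (J 0) * inner ℝ (J 4) (cross (J 0) (J 1))
        + inner ℝ (J 0) (J 0) * (inner ℝ (J' 4) (cross (J 0) (J 1))
          + inner ℝ (J 4) (cross (J' 0) (J 1) + cross (J 0) (J' 1)))) 0 := by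
  have hl : ∀ i, HasDerivAt (fun t : ℝ => (J + t • J') i) (J' i) 0 := by
    intro i
    simpa using ((hasDerivAt_id (0 : ℝ)).smul_const (J' i)).const_add (J i)
  have hn : HasDerivAt (fun t : ℝ => jetNormal (J + t • J'))
      (cross (J' 0) (J 1) + cross (J 0) (J' 1)) 0 := by
    have h := (crossL.hasFDerivAt_of_bilinear (hl 0).hasFDerivAt
      (hl 1).hasFDerivAt).hasDerivAt
    refine h.congr_deriv ?_
    simp [crossL_apply, add_comm]
  have hi : ∀ i j, HasDerivAt (fun t : ℝ => (inner ℝ ((J + t • J') i) ((J + t • J') j) : ℝ))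
      (inner ℝ (J i) (J' j) + inner ℝ (J' i) (J j)) 0 := by
    intro i j
    refine ((hl i).inner ℝ (hl j)).congr_deriv ?_
    simp
  have hin : ∀ i, HasDerivAt (fun t : ℝ => (inner ℝ ((J + t • J') i) (jetNormal (J + t • J')) : ℝ))
      (inner ℝ (J i) (cross (J' 0) (J 1) + cross (J 0) (J' 1))
        + inner ℝ (J' i) (cross (J 0) (J 1))) 0 := by
    intro i
    refine ((hl i).inner ℝ hn).congr_deriv ?_
    simp [jetNormal]
  refine ((((hi 1 1).fun_mul (hin 2)).fun_sub
    (((hi 0 1).const_mul 2).fun_mul (hin 3))).fun_add ((hi 0 0).fun_mul (hin 4))).congr_deriv ?_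
  simp only [zero_smul, add_zero, jetNormal]
  rw [real_inner_comm (J' 1) (J 1), real_inner_comm (J' 0) (J 0)]
  ring

section NormalVariation

variable {u B : ℂ → E3} {U : Set ℂ} {w : ℂ → ℝ}

theorem gaussCurv_eq_det3 (hU : IsOpen U) (hu : ContDiffOn ℝ ∞ u U)
    (himm : ∀ z ∈ U, cross (pd 0 u z) (pd 1 u z) ≠ 0) {z : ℂ} (hz : z ∈ U) :
    volDensity u z * gaussCurv u z
      = det3 (unitNormal u z) (pd 0 (unitNormal u) z) (pd 1 (unitNormal u) z) := by
  rw [mul_comm, gaussCurv_mul_volDensity (contDiffAt_two hU hu hz),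
    jetGauss_div_eq_det3 hU hu himm hz]

theorem pd_normal_variation (hU : IsOpen U) (hu : ContDiffOn ℝ ∞ u U)
    (himm : ∀ z ∈ U, cross (pd 0 u z) (pd 1 u z) ≠ 0) (hw : ContDiffOn ℝ ∞ w U)
    (hBw : ∀ y ∈ U, B y = w y • unitNormal u y) {z : ℂ} (hz : z ∈ U) (i : Fin 2) :
    pd i B z = pd i w z • unitNormal u z + w z • pd i (unitNormal u) z := by
  have hev : B =ᶠ[𝓝 z] fun y => w y • unitNormal u y := by
    filter_upwards [hU.mem_nhds hz] with y hy using hBw y hy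
  rw [pd_congr hev]
  exact dirDeriv_smul (ContDiffOn.differentiableAt_of_mem hU hw hz)
    (ContDiffOn.differentiableAt_of_mem hU (contDiffOn_unitNormal hU hu himm) hz) _

/-- The mixed products of `∂w` and `∂n` are tangential. The normal component of `∂ᵢ∂ⱼn` is `-⟨∂ᵢn,
∂ⱼn⟩`, as differentiating `⟨n, ∂ⱼn⟩ = 0` shows. -/
theorem inner_pd_pd_normal_variation (hU : IsOpen U) (hu : ContDiffOn ℝ ∞ u U)
    (himm : ∀ z ∈ U, cross (pd 0 u z) (pd 1 u z) ≠ 0) (hw : ContDiffOn ℝ ∞ w U)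
    (hBw : ∀ y ∈ U, B y = w y • unitNormal u y) {z : ℂ} (hz : z ∈ U) (i j : Fin 2) :
    inner ℝ (pd i (pd j B) z) (unitNormal u z)
      = pd i (pd j w) z - w z * inner ℝ (pd i (unitNormal u) z) (pd j (unitNormal u) z) := by
  have hn := contDiffOn_unitNormal hU hu himm
  have hnd := ContDiffOn.differentiableAt_of_mem hU hn hz
  have hnj := ContDiffOn.differentiableAt_of_mem hU (contDiffOn_pd hU hn j) hz
  have hwd := ContDiffOn.differentiableAt_of_mem hU hw hz
  have hwj := ContDiffOn.differentiableAt_of_mem hU (contDiffOn_pd hU hw j) hz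
  have hev : pd j B =ᶠ[𝓝 z]
      fun y => pd j w y • unitNormal u y + w y • pd j (unitNormal u) y := by
    filter_upwards [hU.mem_nhds hz] with y hy using pd_normal_variation hU hu himm hw hBw hy j
  have h1 := dirDeriv_add (hwj.fun_smul hnd) (hwd.fun_smul hnj) (![1, Complex.I] i)
  rw [dirDeriv_smul hwj hnd, dirDeriv_smul hwd hnj] at h1
  simp only [← pd_eq_dirDeriv] at h1
  rw [pd_congr hev, h1]
  have h2 := dirDeriv_inner hnd hnj (![1, Complex.I] i)
  have h3 : dirDeriv (![1, Complex.I] i)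
      (fun y => (inner ℝ (unitNormal u y) (pd j (unitNormal u) y) : ℝ)) z = 0 := by
    rw [dirDeriv_congr (g := fun _ => (0 : ℝ)) (by
      filter_upwards [hU.mem_nhds hz] with y hy
        using inner_unitNormal_pd_unitNormal hU hu himm hy j)]
    simp [dirDeriv]
  rw [h3] at h2
  simp only [← pd_eq_dirDeriv] at h2
  have h4 := inner_unitNormal_pd_unitNormal hU hu himm hz
  simp only [inner_add_left, real_inner_smul_left, inner_unitNormal_self (himm z hz),
    real_inner_comm (unitNormal u z) (pd i (unitNormal u) z),
    real_inner_comm (unitNormal u z) (pd j (unitNormal u) z),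
    real_inner_comm (unitNormal u z) (pd i (pd j (unitNormal u)) z), h4]
  linear_combination (-w z) * h2

/-- The tangential gradient of `w`, as minus the velocity of the Gauss map along `u + t w n`. -/
def velocityField (u B : ℂ → E3) (z : ℂ) : E3 := -dirDeriv timeDir (gaussMap u B) (0, z)

theorem contDiffOn_velocityField (hU : IsOpen U) (hu : ContDiffOn ℝ ∞ u U)
    (hB : ContDiffOn ℝ ∞ B U) (himm : ∀ z ∈ U, cross (pd 0 u z) (pd 1 u z) ≠ 0) :
    ContDiffOn ℝ ∞ (velocityField u B) U :=
  (contDiffOn_slice_zero (ContDiffOn.dirDeriv (isOpen_gaussDomain hU hu hB)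
    (contDiffOn_gaussMap hU hu hB) timeDir) himm).neg

theorem inner_velocityField_unitNormal (hU : IsOpen U) (hu : ContDiffOn ℝ ∞ u U)
    (hB : ContDiffOn ℝ ∞ B U) {z : ℂ} (hz : z ∈ U) (himm : cross (pd 0 u z) (pd 1 u z) ≠ 0) :
    inner ℝ (velocityField u B z) (unitNormal u z) = 0 := by
  have h := inner_dirDeriv_unit (isOpen_gaussDomain hU hu hB) (contDiffOn_gaussMap hU hu hB)
    (fun x hx => inner_gaussMap_self hx) (mem_gaussDomain_zero hz himm) timeDir
  rw [gaussMap_zero] at h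
  rw [velocityField, inner_neg_left, real_inner_comm, h, neg_zero]

/-- Against `n` only the normal part `∂ᵢw n` of `∂ᵢB` survives. With
`inner_velocityField_unitNormal` this identifies the field as the tangential gradient of `w`. -/
theorem inner_velocityField_pd (hU : IsOpen U) (hu : ContDiffOn ℝ ∞ u U)
    (hB : ContDiffOn ℝ ∞ B U) (himm : ∀ z ∈ U, cross (pd 0 u z) (pd 1 u z) ≠ 0)
    (hw : ContDiffOn ℝ ∞ w U) (hBw : ∀ y ∈ U, B y = w y • unitNormal u y)
    {z : ℂ} (hz : z ∈ U) (i : Fin 2) :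
    inner ℝ (velocityField u B z) (pd i u z) = pd i w z := by
  have h := inner_dirDeriv_gaussMap hU hu hB (mem_gaussDomain_zero (B := B) hz (himm z hz)) i
  rw [gaussMap_zero] at h
  have hf : frameMap u B i (0, z) = pd i u z := by simp [frameMap]
  rw [hf] at h
  rw [velocityField, inner_neg_left, h, neg_neg, pd_normal_variation hU hu himm hw hBw hz,
    inner_add_right, real_inner_smul_right, real_inner_smul_right,
    inner_unitNormal_self (himm z hz), inner_unitNormal_pd_unitNormal hU hu himm hz]
  ring

/-- Obtained by differentiating the gradient identity. It says that `⟨∂ᵢX, ∂ⱼu⟩` is the covariant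
Hessian of `w`, and so is symmetric. -/
theorem inner_pd_velocityField (hU : IsOpen U) (hu : ContDiffOn ℝ ∞ u U)
    (hB : ContDiffOn ℝ ∞ B U) (himm : ∀ z ∈ U, cross (pd 0 u z) (pd 1 u z) ≠ 0)
    (hw : ContDiffOn ℝ ∞ w U) (hBw : ∀ y ∈ U, B y = w y • unitNormal u y)
    {z : ℂ} (hz : z ∈ U) (i j : Fin 2) :
    inner ℝ (pd i (velocityField u B) z) (pd j u z)
      + inner ℝ (velocityField u B z) (pd i (pd j u) z) = pd i (pd j w) z := by
  have h := dirDeriv_inner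
    (ContDiffOn.differentiableAt_of_mem hU (contDiffOn_velocityField hU hu hB himm) hz)
    (ContDiffOn.differentiableAt_of_mem hU (contDiffOn_pd hU hu j) hz) (![1, Complex.I] i)
  rw [dirDeriv_congr (g := pd j w) (by
    filter_upwards [hU.mem_nhds hz] with y hy
      using inner_velocityField_pd hU hu hB himm hw hBw hy j)] at h
  simp only [← pd_eq_dirDeriv] at h
  exact h.symm

/-- The variation of the one-form `⟨n, ∂ₜn × dn⟩` along `u + t w n`. -/
theorem dirDeriv_gaussForm (hU : IsOpen U) (hu : ContDiffOn ℝ ∞ u U)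
    (hB : ContDiffOn ℝ ∞ B U) (himm : ∀ z ∈ U, cross (pd 0 u z) (pd 1 u z) ≠ 0)
    (hw : ContDiffOn ℝ ∞ w U) (hBw : ∀ y ∈ U, B y = w y • unitNormal u y)
    {z : ℂ} (hz : z ∈ U) (i : Fin 2) :
    dirDeriv timeDir (gaussForm u B i) (0, z) = boundaryOneForm u w i z := by
  have hO := isOpen_gaussDomain hU hu hB
  have hν := contDiffOn_gaussMap hU hu hB
  have hz0 := mem_gaussDomain_zero (B := B) hz (himm z hz)
  have hνd := ContDiffOn.differentiableAt_of_mem hO hν hz0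
  have hνd' := fun v => ContDiffOn.differentiableAt_of_mem hO (ContDiffOn.dirDeriv hO hν v) hz0
  have hν2 : ContDiffAt ℝ 2 (gaussMap u B) (0, z) :=
    (hν.contDiffAt (hO.mem_nhds hz0)).of_le two_le_infty
  have hXs := contDiffOn_velocityField hU hu hB himm
  have hXd := ContDiffOn.differentiableAt_of_mem hU hXs hz
  have hXn := fun y (hy : y ∈ U) => inner_velocityField_unitNormal hU hu hB hy (himm y hy)
  have hX := fun y (hy : y ∈ U) => inner_velocityField_pd hU hu hB himm hw hBw hy
  set X := velocityField u B with hXdef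
  have hTX : dirDeriv timeDir (gaussMap u B) (0, z) = -X z := by simp [hXdef, velocityField]
  have hn : ∀ i, dirDeriv (spaceDir i) (gaussMap u B) (0, z) = pd i (unitNormal u) z := by
    intro i
    rw [← pd_slice hνd]
    exact pd_congr (Eventually.of_forall fun y => gaussMap_zero u B y) i
  have hTi : ∀ i, dirDeriv timeDir (dirDeriv (spaceDir i) (gaussMap u B)) (0, z)
      = -pd i X z := by
    intro i
    rw [dirDeriv_comm hν2, ← pd_slice (hνd' timeDir)]
    have : (fun y => dirDeriv timeDir (gaussMap u B) (0, y)) = fun y => -X y := by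
      funext y
      simp [hXdef, velocityField]
    rw [this, pd, fderiv_fun_neg]
    rfl
  -- In the product rule the term containing `∂ₜn` twice is zero, and the signs of `-X` and `-∂ᵢX`
  -- cancel.
  have hLHS : ∀ i, dirDeriv timeDir (gaussForm u B i) (0, z)
      = det3 (unitNormal u z) (dirDeriv timeDir (dirDeriv timeDir (gaussMap u B)) (0, z))
          (pd i (unitNormal u) z) + det3 (unitNormal u z) (X z) (pd i X z) := by
    intro i
    have h := dirDeriv_det3 hνd (hνd' timeDir) (hνd' (spaceDir i)) timeDir
    rw [hTi, hTX, hn, gaussMap_zero] at h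
    refine h.trans ?_
    simp only [det3_eq, PiLp.neg_apply]
    ring
  have hT2 : ∀ i, inner ℝ (dirDeriv timeDir (dirDeriv timeDir (gaussMap u B)) (0, z)) (pd i u z)
      = 2 * w z * inner ℝ (X z) (pd i (unitNormal u) z) := by
    intro i
    have h := inner_dirDeriv_dirDeriv_gaussMap hU hu hB hz0 i
    have hf : frameMap u B i (0, z) = pd i u z := by simp [frameMap]
    rw [hf, hTX, pd_normal_variation hU hu himm hw hBw hz, inner_neg_left, inner_add_right,
      real_inner_smul_right, real_inner_smul_right, hXn z hz] at h
    rw [h]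
    ring
  have hnorm : ∀ j, pd j (normSqD u w) z = 2 * inner ℝ (X z) (pd j X z) := by
    intro j
    have hev : normSqD u w =ᶠ[𝓝 z] fun y => inner ℝ (X y) (X y) := by
      filter_upwards [hU.mem_nhds hz] with y hy
        using normSqD_eq_inner (himm y hy) (hXn y hy) (hX y hy)
    have h := dirDeriv_inner hXd hXd (![1, Complex.I] j)
    rw [pd_congr hev]
    refine h.trans ?_
    rw [real_inner_comm, ← pd_eq_dirDeriv]
    ring
  obtain ⟨Y, hYn, hY0, hY1⟩ := exists_tangent_dual (himm z hz)
    (pd 0 (normSqD u w) z) (pd 1 (normSqD u w) z)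
  have hs : ‖cross (pd 0 u z) (pd 1 u z)‖ ≠ 0 := norm_ne_zero_iff.2 (himm z hz)
  have hYn' : inner ℝ Y (unitNormal u z) = 0 := by
    rw [unitNormal, real_inner_smul_right, hYn, mul_zero]
  have hY : ∀ j, inner ℝ Y (pd j u z) = d0 (normSqD u w) j z := by
    intro j
    fin_cases j
    exacts [hY0, hY1]
  have hsym : inner ℝ (pd 0 (unitNormal u) z) (pd 1 u z)
      = inner ℝ (pd 1 (unitNormal u) z) (pd 0 u z) := by
    rw [inner_pd_unitNormal hU hu himm hz, inner_pd_unitNormal hU hu himm hz,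
      pd_comm (contDiffAt_two hU hu hz) 1 0]
  have hXsym : inner ℝ (pd 0 X z) (pd 1 u z) = inner ℝ (pd 1 X z) (pd 0 u z) := by
    have h1 := inner_pd_velocityField hU hu hB himm hw hBw hz 0 1
    have h2 := inner_pd_velocityField hU hu hB himm hw hBw hz 1 0
    rw [pd_comm (contDiffAt_two hU hu hz) 1 0, pd_comm (contDiffAt_two hU hw hz) 1 0, ← h1] at h2
    linarith
  have hvol := volDensity_eq u z
  have key := gauss_variation_algebra (cross_eq_smul_unitNormal u z) hs
    (inner_unitNormal_self (himm z hz)) (hXn z hz) hsym (hT2 0) (hT2 1) hXsym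
    (by rw [← hvol]; exact volDensity_mul_laplacian hU hu himm hXs hXn hX hz)
    (by rw [← hvol]; exact gaussCurv_eq_det3 hU hu himm hz)
    (by rw [hY0, hnorm]) (by rw [hY1, hnorm])
  have hstar := hodgeStar_eq_det3 (α := d0 w) (himm z hz) (hXn z hz) (hX z hz) i
  have hstar' := hodgeStar_eq_det3 (himm z hz) hYn' hY i
  rw [hLHS, boundaryOneForm, hstar, hstar']
  fin_cases i
  exacts [key.1, key.2]

/-- Divided by `2 s³` this is the classical `H' = ½ (Δw + |A|² w)`, with `A` the second fundamental
form, since `|A|² = -2K` on a minimal surface. -/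
theorem hasDerivAt_jetMean_normal (hU : IsOpen U) (hu : ContDiffOn ℝ ∞ u U)
    (hB : ContDiffOn ℝ ∞ B U) (himm : ∀ z ∈ U, cross (pd 0 u z) (pd 1 u z) ≠ 0)
    (hw : ContDiffOn ℝ ∞ w U) (hBw : ∀ y ∈ U, B y = w y • unitNormal u y)
    {z : ℂ} (hz : z ∈ U) (hmin : jetMean (jet u z) = 0) :
    HasDerivAt (fun t : ℝ => jetMean (jet u z + t • jet B z))
      (volDensity u z ^ 3 * (laplacian u w z - 2 * gaussCurv u z * w z)) 0 := by
  refine (hasDerivAt_jetMean (jet u z) (jet B z)).congr_deriv ?_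
  have hs : ‖cross (pd 0 u z) (pd 1 u z)‖ ≠ 0 := norm_ne_zero_iff.2 (himm z hz)
  have hXs := contDiffOn_velocityField hU hu hB himm
  have hXn := fun y (hy : y ∈ U) => inner_velocityField_unitNormal hU hu hB hy (himm y hy)
  have hX := fun y (hy : y ∈ U) => inner_velocityField_pd hU hu hB himm hw hBw hy
  have hvol := volDensity_eq u z
  have hXX := inner_pd_velocityField hU hu hB himm hw hBw hz
  have hnn := inner_pd_unitNormal hU hu himm hz
  have hBB := inner_pd_pd_normal_variation hU hu himm hw hBw hz
  have hsymu := pd_comm (contDiffAt_two hU hu hz) 1 0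
  have hsymw := pd_comm (contDiffAt_two hU hw hz) 1 0
  have hX21 := hXX 1 0
  have hn21 := hnn 1 0
  rw [hsymu, hsymw] at hX21
  rw [hsymu] at hn21
  rw [hvol]
  refine mean_variation_algebra (cross_eq_smul_unitNormal u z) hs
    (inner_unitNormal_self (himm z hz)) (hXn z hz) (hX z hz 0) (hX z hz 1)
    (inner_unitNormal_pd_unitNormal hU hu himm hz 0)
    (inner_unitNormal_pd_unitNormal hU hu himm hz 1) (hnn 0 0) (hnn 0 1) hn21 (hnn 1 1)
    (hXX 0 0) (hXX 0 1) hX21 (hXX 1 1)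
    (pd_normal_variation hU hu himm hw hBw hz 0) (pd_normal_variation hU hu himm hw hBw hz 1)
    (hBB 0 0) (hBB 0 1) (hBB 1 1)
    (by rw [← hvol]; exact volDensity_mul_laplacian hU hu himm hXs hXn hX hz)
    (by rw [← hvol]; exact gaussCurv_eq_det3 hU hu himm hz) ?_
  have hJ : jetNormal (jet u z)
      = ‖cross (pd 0 u z) (pd 1 u z)‖ • unitNormal u z := cross_eq_smul_unitNormal u z
  rw [jetMean, hJ] at hmin
  simp only [real_inner_smul_right] at hmin
  refine mul_left_cancel₀ hs ?_
  linear_combination hmin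

/-- The second variation of the Willmore integrand of a minimal surface in normal directions. -/
theorem hasSecondDerivAt_normal_variation (hU : IsOpen U) (hu : ContDiffOn ℝ ∞ u U)
    (hB : ContDiffOn ℝ ∞ B U) (himm : ∀ z ∈ U, cross (pd 0 u z) (pd 1 u z) ≠ 0)
    (hw : ContDiffOn ℝ ∞ w U) (hBw : ∀ y ∈ U, B y = w y • unitNormal u y)
    {z : ℂ} (hz : z ∈ U) (hmin : jetMean (jet u z) = 0) :
    HasSecondDerivAt (fun t : ℝ => jetWillmore (jet u z + t • jet B z))
      (1 / 2 * (laplacian u w z - 2 * gaussCurv u z * w z) ^ 2 * volDensity u z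
        - d1 (boundaryOneForm u w) z) 0 := by
  have h := hasSecondDerivAt_jetWillmore hU hu hB hz (himm z hz) hmin
    (hasDerivAt_jetMean_normal hU hu hB himm hw hBw hz hmin)
  have hO := isOpen_gaussDomain hU hu hB
  have hz0 := mem_gaussDomain_zero (B := B) hz (himm z hz)
  have hd : ∀ i j, dirDeriv (spaceDir i) (dirDeriv timeDir (gaussForm u B j)) (0, z)
      = pd i (boundaryOneForm u w j) z := by
    intro i j
    rw [← pd_slice (ContDiffOn.differentiableAt_of_mem hO
      (ContDiffOn.dirDeriv hO (contDiffOn_gaussForm hU hu hB j) timeDir) hz0)]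
    refine pd_congr ?_ i
    filter_upwards [hU.mem_nhds hz] with y hy
      using dirDeriv_gaussForm hU hu hB himm hw hBw hy j
  have hs : volDensity u z ≠ 0 := by
    rw [volDensity_eq]
    exact norm_ne_zero_iff.2 (himm z hz)
  have hq : (volDensity u z ^ 3 * (laplacian u w z - 2 * gaussCurv u z * w z)) ^ 2
      / (2 * volDensity u z ^ 5)
      = 1 / 2 * (laplacian u w z - 2 * gaussCurv u z * w z) ^ 2 * volDensity u z := by
    field_simp
  rw [hd, hd, hq] at h
  exact h

end NormalVariation

/-! ### Holomorphic changes of coordinates -/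

section Holomorphic

variable {u : ℂ → E3} {τ : ℂ → ℂ} {z : ℂ}

theorem hasFDerivAt_real_of_differentiableAt (h : DifferentiableAt ℂ τ z) :
    HasFDerivAt τ ((ContinuousLinearMap.mul ℝ ℂ) (deriv τ z)) z := by
  refine h.hasDerivAt.hasFDerivAt.restrictScalars ℝ |>.congr_fderiv ?_
  ext
  simp [mul_comm]

theorem det_mul_complex (c : ℂ) :
    ((ContinuousLinearMap.mul ℝ ℂ) c).det = c.re ^ 2 + c.im ^ 2 := by
  rw [ContinuousLinearMap.det, ← LinearMap.det_toMatrix Complex.basisOneI, Matrix.det_fin_two]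
  simp [LinearMap.toMatrix_apply]
  ring

theorem pd_comp (hu : DifferentiableAt ℝ u (τ z)) (h : DifferentiableAt ℂ τ z) :
    pd 0 (u ∘ τ) z = (deriv τ z).re • pd 0 u (τ z) + (deriv τ z).im • pd 1 u (τ z) ∧
    pd 1 (u ∘ τ) z = -(deriv τ z).im • pd 0 u (τ z) + (deriv τ z).re • pd 1 u (τ z) := by
  have h1 := (hu.hasFDerivAt.comp z (hasFDerivAt_real_of_differentiableAt h)).fderiv
  simp only [pd, h1, ← map_smul, ← map_add, Matrix.cons_val_zero, Matrix.cons_val_one,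
    ContinuousLinearMap.comp_apply, ContinuousLinearMap.mul_apply']
  constructor
  · congr 1
    apply Complex.ext <;> simp
  · congr 1
    apply Complex.ext <;> simp

/-- The chain rule twice. By the Cauchy-Riemann equations all second derivatives of `τ` are read off
from `τ''`. -/
theorem jet_comp (hu : ContDiffAt ℝ 2 u (τ z)) (h : AnalyticAt ℂ τ z) :
    jet (u ∘ τ) z = jetChange (deriv τ z).re (deriv τ z).im (deriv (deriv τ) z).re
      (deriv (deriv τ) z).im (jet u (τ z)) := by
  have hd := hu.differentiableAt (by simp)
  have hτ := h.differentiableAt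
  have hev : ∀ᶠ y in 𝓝 z, DifferentiableAt ℝ u (τ y) ∧ DifferentiableAt ℂ τ y := by
    have h1 : ∀ᶠ x in 𝓝 (τ z), DifferentiableAt ℝ u x := by
      filter_upwards [hu.eventually (by simp)] with x hx using hx.differentiableAt (by simp)
    filter_upwards [h.continuousAt.eventually h1, h.eventually_analyticAt] with y hy hy'
      using ⟨hy, hy'.differentiableAt⟩
  have hpd : ∀ j, DifferentiableAt ℝ (pd j u) (τ z) := fun j =>
    ((hu.fderiv_right (m := 1) (by norm_num)).differentiableAt (by norm_num)).clm_apply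
      (differentiableAt_const _)
  have hpτ : ∀ j, DifferentiableAt ℝ (fun y => pd j u (τ y)) z := fun j =>
    (hpd j).comp z (hasFDerivAt_real_of_differentiableAt hτ).differentiableAt
  have hdτ := hasFDerivAt_real_of_differentiableAt h.deriv.differentiableAt
  have hre : HasFDerivAt (fun y => (deriv τ y).re) _ z :=
    Complex.reCLM.hasFDerivAt.comp z hdτ
  have him : HasFDerivAt (fun y => (deriv τ y).im) _ z :=
    Complex.imCLM.hasFDerivAt.comp z hdτ
  have e0 : pd 0 (u ∘ τ) =ᶠ[𝓝 z]
      fun y => (deriv τ y).re • pd 0 u (τ y) + (deriv τ y).im • pd 1 u (τ y) := by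
    filter_upwards [hev] with y hy using (pd_comp hy.1 hy.2).1
  have e1 : pd 1 (u ∘ τ) =ᶠ[𝓝 z]
      fun y => (-(deriv τ y).im) • pd 0 u (τ y) + (deriv τ y).re • pd 1 u (τ y) := by
    filter_upwards [hev] with y hy using (pd_comp hy.1 hy.2).2
  have l0 := fun v => dirDeriv_add (hre.differentiableAt.fun_smul (hpτ 0))
    (him.differentiableAt.fun_smul (hpτ 1)) v
  have l1 := fun v => dirDeriv_add (him.differentiableAt.fun_neg.fun_smul (hpτ 0))
    (hre.differentiableAt.fun_smul (hpτ 1)) v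
  simp only [dirDeriv_smul hre.differentiableAt (hpτ _),
    dirDeriv_smul him.differentiableAt (hpτ _),
    dirDeriv_smul him.differentiableAt.fun_neg (hpτ _)] at l0 l1
  have hdre : ∀ v, dirDeriv v (fun y => (deriv τ y).re) z = (deriv (deriv τ) z * v).re := by
    intro v
    rw [dirDeriv, hre.fderiv]
    simp
  have hdim : ∀ v, dirDeriv v (fun y => (deriv τ y).im) z = (deriv (deriv τ) z * v).im := by
    intro v
    rw [dirDeriv, him.fderiv]
    simp
  have hdnim : ∀ v, dirDeriv v (fun y => -(deriv τ y).im) z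
      = -(deriv (deriv τ) z * v).im := by
    intro v
    rw [dirDeriv, him.fun_neg.fderiv]
    simp
  have c := fun j => pd_comp (hpd j) hτ
  have c0 : ∀ j, dirDeriv (1 : ℂ) (fun y => pd j u (τ y)) z = _ := fun j => (c j).1
  have c1 : ∀ j, dirDeriv Complex.I (fun y => pd j u (τ y)) z = _ := fun j => (c j).2
  have h10 := pd_comm hu 1 0
  have a00 := l0 1
  have a01 := l1 1
  have a11 := l1 Complex.I
  rw [c0, c0, hdre, hdim] at a00
  rw [c0, c0, hdre, hdnim] at a01
  rw [c1, c1, hdre, hdnim] at a11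
  simp only [mul_one, Complex.mul_re, Complex.mul_im, Complex.I_re, Complex.I_im, mul_zero,
    zero_sub, add_zero, h10] at a00 a01 a11
  funext k
  fin_cases k
  · exact (pd_comp hd hτ).1
  · exact (pd_comp hd hτ).2
  · change pd 0 (pd 0 (u ∘ τ)) z = _
    rw [pd_congr e0]
    refine Eq.trans a00 ?_
    simp only [jetChange, jet, Matrix.cons_val, Fin.reduceFinMk]
    module
  · change pd 0 (pd 1 (u ∘ τ)) z = _
    rw [pd_congr e1]
    refine Eq.trans a01 ?_
    simp only [jetChange, jet, Matrix.cons_val, Fin.reduceFinMk]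
    module
  · change pd 1 (pd 1 (u ∘ τ)) z = _
    rw [pd_congr e1]
    refine Eq.trans a11 ?_
    simp only [jetChange, jet, Matrix.cons_val, Fin.reduceFinMk]
    module

theorem sq_add_sq_pos_of_ne_zero {c : ℂ} (hc : c ≠ 0) : 0 < c.re ^ 2 + c.im ^ 2 := by
  have := Complex.normSq_pos.2 hc
  rw [Complex.normSq_apply] at this
  nlinarith

theorem unitNormal_eq_jetNormal (u : ℂ → E3) (z : ℂ) :
    unitNormal u z = ‖jetNormal (jet u z)‖⁻¹ • jetNormal (jet u z) := rfl

/-- A holomorphic change of coordinates multiplies `∂₁u × ∂₂u` by `|τ'|² > 0`, which normalisation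
removes. -/
theorem unitNormal_comp (hu : ContDiffAt ℝ 2 u (τ z)) (h : AnalyticAt ℂ τ z)
    (h0 : deriv τ z ≠ 0) : unitNormal (u ∘ τ) z = unitNormal u (τ z) := by
  have hp := sq_add_sq_pos_of_ne_zero h0
  rw [unitNormal_eq_jetNormal, jet_comp hu h, jetNormal_jetChange, norm_smul, smul_smul,
    Real.norm_of_nonneg hp.le, unitNormal_eq_jetNormal]
  congr 1
  field_simp

end Holomorphic

/-! ### Charts -/

theorem comp_symm_eventuallyEq {M F : Type*} [TopologicalSpace M] (f : M → F) {e e' : OpenPartialHomeomorph M ℂ} {z : ℂ}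
    (hz : z ∈ (e.symm ≫ₕ e').source) :
    f ∘ e.symm =ᶠ[𝓝 z] (f ∘ e'.symm) ∘ (e' ∘ e.symm) := by
  filter_upwards [(e.symm ≫ₕ e').open_source.mem_nhds hz] with y hy
  have hy2 : e.symm y ∈ e'.source := by simpa using hy.2
  simp [e'.left_inv hy2]

section Charts

variable {M : Type*} [TopologicalSpace M] [ChartedSpace ℂ M]

theorem mem_transition_chartAt {e : OpenPartialHomeomorph M ℂ} {z : ℂ} (hz : z ∈ e.target) :
    z ∈ (e.symm ≫ₕ chartAt ℂ (e.symm z)).source := by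
  simp [hz]

theorem contDiffOn_transition [IsManifold 𝓘(ℂ, ℂ) ω M] {e e' : OpenPartialHomeomorph M ℂ}
    (he : e ∈ atlas ℂ M) (he' : e' ∈ atlas ℂ M) :
    ContDiffOn ℂ ω (e' ∘ e.symm) (e.symm ≫ₕ e').source := by
  have h := HasGroupoid.compatible (G := contDiffGroupoid ω 𝓘(ℂ, ℂ)) he he'
  simpa [contDiffPregroupoid] using (mem_groupoid_of_pregroupoid.1 h).1

theorem isManifold_real [IsManifold 𝓘(ℂ, ℂ) ω M] : IsManifold 𝓘(ℝ, ℂ) ∞ M := by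
  refine isManifold_of_contDiffOn _ _ _ fun e e' he he' => ?_
  have h := ((contDiffOn_transition he he').restrict_scalars ℝ).of_le (m := ∞) le_top
  simpa using h

theorem IsSmooth.contDiffOn [IsManifold 𝓘(ℝ, ℂ) ∞ M] {F : Type*} [NormedAddCommGroup F]
    [NormedSpace ℝ F] {f : M → F} (hf : IsSmooth f) {e : OpenPartialHomeomorph M ℂ}
    (he : e ∈ atlas ℂ M) : ContDiffOn ℝ ∞ (f ∘ e.symm) e.target := by
  have h1 := contMDiffOn_symm_of_mem_maximalAtlas (I := 𝓘(ℝ, ℂ)) (n := ∞)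
    (IsManifold.subset_maximalAtlas he)
  exact contMDiffOn_iff_contDiffOn.1
    ((ContMDiff.contMDiffOn hf (s := univ)).comp h1 fun _ _ => mem_univ _)

/-- If the cross product vanished, the Gram determinant of `a = L 1`, `b = L I` would be zero, and
`⟨a, a⟩ b - ⟨a, b⟩ a` would have norm zero. Injectivity then forces `⟨a, a⟩ = 0`, hence `L 1 = 0`, a
contradiction. -/
theorem cross_ne_zero_of_injective {L : ℂ →L[ℝ] E3} (hL : Function.Injective L) :
    cross (L 1) (L Complex.I) ≠ 0 := by
  intro h
  have hg := norm_cross_sq (L 1) (L Complex.I)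
  rw [h, norm_zero] at hg
  have hv : L ((inner ℝ (L 1) (L 1) : ℝ) • Complex.I - (inner ℝ (L 1) (L Complex.I) : ℝ) • 1)
      = 0 := by
    rw [map_sub, map_smul, map_smul, ← inner_self_eq_zero (𝕜 := ℝ)]
    simp only [inner_sub_left, inner_sub_right, real_inner_smul_left, real_inner_smul_right]
    rw [real_inner_comm (L 1) (L Complex.I)]
    linear_combination (-inner ℝ (L 1) (L 1)) * hg
  have h0 := hL (hv.trans (map_zero L).symm)
  have him : L 1 = 0 := by
    have := congrArg Complex.im h0
    rw [← inner_self_eq_zero (𝕜 := ℝ)]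
    simpa only [Complex.sub_im, Complex.smul_im, Complex.I_im, Complex.one_im, smul_zero, sub_zero,
      smul_eq_mul, mul_one, mul_zero, Complex.zero_im] using this
  have h1 := hL (him.trans (map_zero L).symm)
  exact one_ne_zero h1

theorem IsImmersedAt.jetNormal_ne_zero [IsManifold 𝓘(ℝ, ℂ) ∞ M] {ψ : M → E3}
    (hψ : IsSmooth ψ) {e : OpenPartialHomeomorph M ℂ} (he : e ∈ atlas ℂ M) {z : ℂ}
    (hz : z ∈ e.target) (himm : IsImmersedAt ψ (e.symm z)) :
    jetNormal (jet (ψ ∘ e.symm) z) ≠ 0 := by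
  have : IsManifold 𝓘(ℝ, ℂ) 1 M := IsManifold.of_le (n := ∞) (by simp)
  have hm := mdifferentiable_of_mem_atlas (I := 𝓘(ℝ, ℂ)) he
  have h1 := hm.symm.mfderiv_injective (x := z) hz
  have hd : MDifferentiableAt 𝓘(ℝ, ℂ) 𝓘(ℝ, E3) ψ (e.symm z) :=
    (ContMDiff.mdifferentiable hψ (by simp)) _
  have hc := mfderiv_comp z hd (hm.mdifferentiableAt_symm hz)
  rw [mfderiv_eq_fderiv] at hc
  have hinj : Function.Injective (fderiv ℝ (ψ ∘ e.symm) z) := by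
    rw [hc]
    exact himm.comp h1
  exact cross_ne_zero_of_injective hinj

/-! ### Transition functions and independence of the chart -/

variable [IsManifold 𝓘(ℂ, ℂ) ω M]

/-- The basic facts about a transition function at a point. -/
theorem transition_facts {e e' : OpenPartialHomeomorph M ℂ} (he : e ∈ atlas ℂ M)
    (he' : e' ∈ atlas ℂ M) {z : ℂ} (hz : z ∈ (e.symm ≫ₕ e').source) :
    AnalyticAt ℂ (e' ∘ e.symm) z ∧ deriv (e' ∘ e.symm) z ≠ 0 := by
  have hA : ∀ {e e' : OpenPartialHomeomorph M ℂ}, e ∈ atlas ℂ M → e' ∈ atlas ℂ M →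
      ∀ {z}, z ∈ (e.symm ≫ₕ e').source → AnalyticAt ℂ (e' ∘ e.symm) z := by
    intro e e' he he' z hz
    exact ((contDiffOn_transition he he').contDiffAt
      ((e.symm ≫ₕ e').open_source.mem_nhds hz)).analyticAt
  refine ⟨hA he he' hz, fun h0 => ?_⟩
  have hz1 : z ∈ e.target := by
    simpa using hz.1
  have hz2 : e.symm z ∈ e'.source := by
    simpa using hz.2
  have hz' : (e' ∘ e.symm) z ∈ (e'.symm ≫ₕ e).source := by
    simp [hz2, e.map_target hz1]
  have h1 := (hA he he' hz).differentiableAt.hasDerivAt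
  have h2 := (hA he' he hz').differentiableAt.hasDerivAt
  have h3 := h2.comp z h1
  have hid : (e ∘ e'.symm) ∘ (e' ∘ e.symm) =ᶠ[𝓝 z] id := by
    filter_upwards [(e.symm ≫ₕ e').open_source.mem_nhds hz] with y hy
    have hy1 : y ∈ e.target := by simpa using hy.1
    have hy2 : e.symm y ∈ e'.source := by simpa using hy.2
    simp [e'.left_inv hy2, e.right_inv hy1]
  have h4 := (h3.congr_of_eventuallyEq hid.symm).unique (hasDerivAt_id z)
  rw [h0, mul_zero] at h4
  exact zero_ne_one h4

/-- The two-jets of a smooth map in two charts. -/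
theorem jet_transition {f : M → E3} (hf : IsSmooth f) {e e' : OpenPartialHomeomorph M ℂ}
    (he : e ∈ atlas ℂ M) (he' : e' ∈ atlas ℂ M) {z : ℂ} (hz : z ∈ (e.symm ≫ₕ e').source) :
    jet (f ∘ e.symm) z = jetChange (deriv (e' ∘ e.symm) z).re (deriv (e' ∘ e.symm) z).im
      (deriv (deriv (e' ∘ e.symm)) z).re (deriv (deriv (e' ∘ e.symm)) z).im
      (jet (f ∘ e'.symm) (e' (e.symm z))) := by
  have := isManifold_real (M := M)
  have hz' : e' (e.symm z) ∈ e'.target := by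
    have hz2 : e.symm z ∈ e'.source := by simpa using hz.2
    exact e'.map_source hz2
  rw [jet_congr (comp_symm_eventuallyEq f hz)]
  exact jet_comp (contDiffAt_two e'.open_target (hf.contDiffOn he') hz')
    (transition_facts he he' hz).1

theorem IsMinimalImmersion.jetNormal_ne_zero {φ : M → E3} (hφ : IsMinimalImmersion φ)
    {e : OpenPartialHomeomorph M ℂ} (he : e ∈ atlas ℂ M) {z : ℂ} (hz : z ∈ e.target) :
    jetNormal (jet (φ ∘ e.symm) z) ≠ 0 := by
  have := isManifold_real (M := M)
  exact IsImmersedAt.jetNormal_ne_zero hφ.smooth he hz (hφ.immersed _)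

/-- Minimality is stated only in the preferred chart at each point. Since `Q` is multiplied by a
power of `|τ'|²`, its vanishing passes to every chart of the atlas. -/
theorem IsMinimalImmersion.jetMean_eq_zero {φ : M → E3} (hφ : IsMinimalImmersion φ)
    {e : OpenPartialHomeomorph M ℂ} (he : e ∈ atlas ℂ M) {z : ℂ} (hz : z ∈ e.target) :
    jetMean (jet (φ ∘ e.symm) z) = 0 := by
  have := isManifold_real (M := M)
  have hc := chart_mem_atlas ℂ (e.symm z)
  have hz' : chartAt ℂ (e.symm z) (e.symm z) ∈ (chartAt ℂ (e.symm z)).target :=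
    mem_chart_target ℂ _
  rw [jet_transition hφ.smooth he hc (mem_transition_chartAt hz), jetMean_jetChange]
  have h := hφ.meanCurv_eq_zero (e.symm z)
  rw [meanCurv_eq (contDiffAt_two (chartAt ℂ (e.symm z)).open_target
    (hφ.smooth.contDiffOn hc) hz'), div_eq_zero_iff] at h
  rw [h.resolve_right (mul_ne_zero two_ne_zero
    (pow_ne_zero 3 (norm_ne_zero_iff.2 (hφ.jetNormal_ne_zero hc hz')))), mul_zero]

theorem normalField_symm {φ : M → E3} (hφ : IsSmooth φ)
    {e : OpenPartialHomeomorph M ℂ} (he : e ∈ atlas ℂ M) {z : ℂ} (hz : z ∈ e.target) :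
    normalField φ (e.symm z) = unitNormal (φ ∘ e.symm) z := by
  have := isManifold_real (M := M)
  have hc := chart_mem_atlas ℂ (e.symm z)
  have ht := mem_transition_chartAt (M := M) hz
  have hz' : chartAt ℂ (e.symm z) (e.symm z) ∈ (chartAt ℂ (e.symm z)).target :=
    mem_chart_target ℂ _
  obtain ⟨h1, h2⟩ := transition_facts he hc ht
  have hj := comp_symm_eventuallyEq φ ht
  have h3 := unitNormal_comp (u := φ ∘ (chartAt ℂ (e.symm z)).symm)
    (contDiffAt_two (chartAt ℂ (e.symm z)).open_target (hφ.contDiffOn hc) hz') h1 h2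
  rw [unitNormal_eq_jetNormal (φ ∘ e.symm), jet_congr hj, ← unitNormal_eq_jetNormal, h3]
  rfl

end Charts

/-! ### Coordinate regions -/

theorem continuousAt_prod_nat {X Y : Type*} [TopologicalSpace X] [TopologicalSpace Y]
    {f : ℕ × X → Y} {n : ℕ} {z : X} (h : ContinuousAt (fun y => f (n, y)) z) :
    ContinuousAt f (n, z) := by
  rw [ContinuousAt, nhds_prod_eq, nhds_discrete, Filter.pure_prod, Filter.tendsto_map'_iff]
  exact h

theorem coordMeasure_lt_top {C : Set (ℕ × ℂ)} (hC : IsCompact C) : coordMeasure C < ⊤ := by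
  have h1 : (Prod.fst '' C).Finite := (hC.image continuous_fst).finite_of_discrete
  have h2 : IsCompact (Prod.snd '' C) := hC.image continuous_snd
  have hsub : C ⊆ (Prod.fst '' C) ×ˢ (Prod.snd '' C) := fun x hx =>
    ⟨mem_image_of_mem _ hx, mem_image_of_mem _ hx⟩
  refine (measure_mono hsub).trans_lt ?_
  rw [coordMeasure, Measure.prod_prod]
  exact ENNReal.mul_lt_top (Measure.count_apply_lt_top.2 h1) h2.measure_lt_top

section Regions

variable {M : Type*} [TopologicalSpace M] [MeasurableSpace M]

theorem measurableSet_chart_preimage [BorelSpace M] (e : OpenPartialHomeomorph M ℂ) {S : Set M}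
    (hS : MeasurableSet S) : MeasurableSet {z | z ∈ e.target ∧ e.symm z ∈ S} := by
  have hc : Continuous (e.target.domRestrict e.symm) := e.continuousOn_symm.domRestrict
  have h := MeasurableSet.subtype_image e.open_target.measurableSet (hc.measurable hS)
  convert h using 1
  ext z
  simp [Set.domRestrict, and_comm]

variable [ChartedSpace ℂ M] (P : ChartPartition M)

/-- The coordinates of all points in the domains of the charts of a partition. -/
def ChartPartition.domain : Set (ℕ × ℂ) := {x | x.2 ∈ (P.chart x.1).target}

/-- The point of the surface with given coordinates. -/
def ChartPartition.point (x : ℕ × ℂ) : M := (P.chart x.1).symm x.2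

/-- The coordinates of the points of `K` in the closed pieces of a partition. -/
def ChartPartition.closedRegion (K : Set M) : Set (ℕ × ℂ) :=
  {x | x.2 ∈ (P.chart x.1).target ∧ (P.chart x.1).symm x.2 ∈ closure (P.piece x.1) ∩ K}

theorem ChartPartition.isOpen_domain : IsOpen P.domain := by
  rw [isOpen_iff_mem_nhds]
  rintro ⟨n, z⟩ hz
  rw [nhds_prod_eq, nhds_discrete, Filter.pure_prod]
  exact (P.chart n).open_target.mem_nhds hz

theorem ChartPartition.closedRegion_subset_domain (K : Set M) : P.closedRegion K ⊆ P.domain :=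
  fun _ hx => hx.1

theorem ChartPartition.mem_closedRegion {x : ℕ × ℂ} {Ω K : Set M} (hx : x ∈ P.region Ω)
    (hK : P.point x ∈ K) : x ∈ P.closedRegion K :=
  ⟨hx.1, subset_closure hx.2.1, hK⟩

/-- By local finiteness only finitely many closed pieces meet `K`. Each has compact closure inside
its chart domain, so its part of `K` has compact coordinate image; the pieces themselves are merely
Borel, hence the closures. -/
theorem ChartPartition.isCompact_closedRegion {K : Set M} (hK : IsCompact K)
    (hKc : IsClosed K) : IsCompact (P.closedRegion K) := by
  have hfin := P.locallyFinite.closure.finite_nonempty_inter_compact hK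
  have heq : P.closedRegion K = ⋃ n ∈ {n | (closure (P.piece n) ∩ K).Nonempty},
      ({n} : Set ℕ) ×ˢ (P.chart n '' (closure (P.piece n) ∩ K)) := by
    ext ⟨n, z⟩
    simp only [closedRegion, mem_ofPred_eq, mem_iUnion, mem_prod, mem_singleton_iff, mem_image,
      exists_prop]
    constructor
    · rintro ⟨h1, h2⟩
      exact ⟨n, ⟨_, h2⟩, rfl, _, h2, (P.chart n).right_inv h1⟩
    · rintro ⟨m, -, rfl, p, hp, rfl⟩
      have := P.closure_subset n hp.1
      exact ⟨(P.chart n).map_source this, by rwa [(P.chart n).left_inv this]⟩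
  rw [heq]
  refine hfin.isCompact_biUnion fun n _ => isCompact_singleton.prod ?_
  exact ((P.isCompact_closure n).inter_right hKc).image_of_continuousOn
    ((P.chart n).continuousOn.mono fun p hp => P.closure_subset n hp.1)

theorem ChartPartition.measurableSet_region [BorelSpace M] {Ω : Set M} (hΩ : MeasurableSet Ω) :
    MeasurableSet (P.region Ω) := by
  have heq : P.region Ω = ⋃ n, ({n} : Set ℕ) ×ˢ
      {z | z ∈ (P.chart n).target ∧ (P.chart n).symm z ∈ P.piece n ∩ Ω} := by
    ext ⟨n, z⟩
    simp only [region, mem_ofPred_eq, mem_iUnion, mem_prod, mem_singleton_iff]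
    constructor
    · intro h
      exact ⟨n, rfl, h⟩
    · rintro ⟨m, rfl, h⟩
      exact h
  rw [heq]
  exact MeasurableSet.iUnion fun n => (measurableSet_singleton n).prod
    (measurableSet_chart_preimage _ ((P.measurableSet_piece n).inter hΩ))

/-- The integral of a form is the sum of the integrals over the pieces. -/
theorem ChartPartition.hasSum_formIntegral [BorelSpace M] {Ω : Set M} (hΩ : MeasurableSet Ω)
    {η : TwoForm M} (hη : P.FormIntegrableOn Ω η) :
    HasSum (fun n => ∫ z in {z | z ∈ (P.chart n).target ∧ (P.chart n).symm z ∈ P.piece n ∩ Ω},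
      η (P.chart n) z) (P.formIntegral Ω η) := by
  have hR := P.measurableSet_region hΩ
  have hRn : ∀ n, MeasurableSet
      {z | z ∈ (P.chart n).target ∧ (P.chart n).symm z ∈ P.piece n ∩ Ω} := fun n =>
    measurableSet_chart_preimage _ ((P.measurableSet_piece n).inter hΩ)
  have hi : Integrable ((P.region Ω).indicator (P.coeff η)) coordMeasure := hη.integrable_indicator hR
  have h1 := integral_prod _ hi
  have hsec : ∀ n, (∫ z, (P.region Ω).indicator (P.coeff η) (n, z))
      = ∫ z in {z | z ∈ (P.chart n).target ∧ (P.chart n).symm z ∈ P.piece n ∩ Ω},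
      η (P.chart n) z := by
    intro n
    rw [← integral_indicator (hRn n)]
    rfl
  have hi' : Integrable (fun n => ∫ z, (P.region Ω).indicator (P.coeff η) (n, z))
      (Measure.count : Measure ℕ) := Integrable.integral_prod_left hi
  have h2 := integral_countable hi'
  simp only [Measure.real, Measure.count_singleton, ENNReal.toReal_one, one_smul] at h2
  have hs : Summable fun n => ∫ z, (P.region Ω).indicator (P.coeff η) (n, z) :=
    (integrable_count_iff.1 hi').of_norm
  have h3 := hs.hasSum
  rw [← h2] at h3
  simp only [hsec] at h3 h1
  rw [formIntegral, ← integral_indicator hR]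
  change HasSum _ (∫ x, (P.region Ω).indicator (P.coeff η) x ∂(Measure.count.prod volume))
  rw [h1]
  exact h3

theorem ChartPartition.continuousOn_coeff {η : TwoForm M}
    (hη : ∀ e ∈ atlas ℂ M, ContinuousOn (η e) e.target) : ContinuousOn (P.coeff η) P.domain := by
  rintro ⟨n, z⟩ hz
  refine ContinuousAt.continuousWithinAt (continuousAt_prod_nat ?_)
  exact (hη _ (P.chart_mem n)).continuousAt ((P.chart n).open_target.mem_nhds hz)

/-- A continuous form with compact support is integrable. -/
theorem ChartPartition.formIntegrableOn_of_compact [BorelSpace M] [T2Space M] {η : TwoForm M}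
    (hη : ∀ e ∈ atlas ℂ M, ContinuousOn (η e) e.target) {K : Set M} (hK : IsCompact K)
    (h0 : ∀ e ∈ atlas ℂ M, ∀ z ∈ e.target, e.symm z ∉ K → η e z = 0) {Ω : Set M}
    (hΩ : MeasurableSet Ω) : P.FormIntegrableOn Ω η := by
  have hC := P.isCompact_closedRegion hK hK.isClosed
  have hc := (P.continuousOn_coeff hη).mono (P.closedRegion_subset_domain K)
  have hm := coordMeasure_lt_top hC
  have h1 : IntegrableOn (P.coeff η) (P.closedRegion K) coordMeasure := by
    obtain ⟨b, hb⟩ := hC.exists_bound_of_continuousOn hc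
    exact IntegrableOn.of_bound hm (hc.aestronglyMeasurable hC.measurableSet) b
      ((ae_restrict_iff' hC.measurableSet).2 (Eventually.of_forall hb))
  refine IntegrableOn.of_forall_sdiff_eq_zero h1 (P.measurableSet_region hΩ) ?_
  rintro x ⟨hx, hxC⟩
  exact h0 _ (P.chart_mem x.1) x.2 hx.1 fun hxK => hxC (P.mem_closedRegion hx hxK)

end Regions

/-! ### The integral of a derivative with compact support -/

theorem integral_pd_eq_zero {f : ℂ → ℝ} (hf : ContDiff ℝ 1 f) (hc : HasCompactSupport f)
    (i : Fin 2) : ∫ z, pd i f z = 0 := by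
  have hcont : Continuous fun z => fderiv ℝ f z (![1, Complex.I] i) :=
    (hf.continuous_fderiv (by simp)).clm_apply continuous_const
  have hc' : HasCompactSupport fun z => fderiv ℝ f z (![1, Complex.I] i) :=
    (hc.fderiv (𝕜 := ℝ)).comp_left (g := fun L : ℂ →L[ℝ] ℝ => L (![1, Complex.I] i)) rfl
  -- Integration by parts against the constant function `1`.
  have h := integral_mul_fderiv_eq_neg_fderiv_mul_of_integrable (μ := (volume : Measure ℂ))
    (f := fun _ => (1 : ℝ)) (g := f) (v := ![1, Complex.I] i)
    (by simp) (by simpa using hcont.integrable_of_hasCompactSupport hc')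
    (by simpa using hf.continuous.integrable_of_hasCompactSupport hc)
    (fun x _ => differentiableAt_const _) (fun x _ => hf.differentiable (by simp) x)
  simpa [pd] using h

/-! ### The first variation -/

theorem comp_symm_eventuallyEq_zero {M : Type*} [TopologicalSpace M] {B : M → E3} {e : OpenPartialHomeomorph M ℂ} {z : ℂ}
    (hz : z ∈ e.target) (hB : e.symm z ∉ tsupport B) : B ∘ e.symm =ᶠ[𝓝 z] 0 := by
  have h1 : B =ᶠ[𝓝 (e.symm z)] 0 := notMem_tsupport_iff_eventuallyEq.1 hB
  exact (e.continuousAt_symm hz).eventually h1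

section FirstVariation

variable {M : Type*} [TopologicalSpace M]

/-- The first variation of the two-form `(|H|² - K) dvol` in the direction `B`. -/
def firstVariationForm (φ B : M → E3) : TwoForm M := fun e z =>
  fderiv ℝ jetWillmore (jet (φ ∘ e.symm) z) (jet (B ∘ e.symm) z)

theorem hasFDerivAt_jetWillmore_of_regular {J : Fin 5 → E3} (hJ : J ∈ regularJets) :
    HasFDerivAt jetWillmore (fderiv ℝ jetWillmore J) J :=
  (ContDiffOn.differentiableAt_of_mem isOpen_regularJets contDiffOn_jetWillmore hJ).hasFDerivAt

theorem hasDerivAt_jetWillmore_line {J : Fin 5 → E3} (hJ : J ∈ regularJets) (J' : Fin 5 → E3) :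
    HasDerivAt (fun t : ℝ => jetWillmore (J + t • J')) (fderiv ℝ jetWillmore J J') 0 := by
  have hl : HasDerivAt (fun t : ℝ => J + t • J') J' 0 := by
    simpa using ((hasDerivAt_id (0 : ℝ)).smul_const J').const_add J
  have h0 : J + (0 : ℝ) • J' = J := by simp
  have h := hasFDerivAt_jetWillmore_of_regular hJ
  rw [← h0] at h
  have := h.comp_hasDerivAt (0 : ℝ) hl
  rwa [h0] at this

theorem jetChange_add_smul (p q p₁ q₁ t : ℝ) (J J' : Fin 5 → E3) :
    jetChange p q p₁ q₁ (J + t • J') = jetChange p q p₁ q₁ J + t • jetChange p q p₁ q₁ J' := by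
  funext k
  fin_cases k <;>
  · simp only [jetChange, Pi.add_apply, Pi.smul_apply, Matrix.cons_val, Fin.reduceFinMk,
      Fin.zero_eta, Fin.mk_one]
    module

/-- The transformation law of the density is differentiated along `J + t J'`; this works because
`jetChange` is linear in the jet. -/
theorem fderiv_jetWillmore_jetChange {p q p₁ q₁ : ℝ} (hpq : 0 < p ^ 2 + q ^ 2)
    {J : Fin 5 → E3} (hJ : J ∈ regularJets) (J' : Fin 5 → E3) :
    fderiv ℝ jetWillmore (jetChange p q p₁ q₁ J) (jetChange p q p₁ q₁ J')
      = (p ^ 2 + q ^ 2) * fderiv ℝ jetWillmore J J' := by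
  have hJ' : jetChange p q p₁ q₁ J ∈ regularJets := by
    change jetNormal _ ≠ 0
    rw [jetNormal_jetChange]
    exact smul_ne_zero hpq.ne' hJ
  have h1 := hasDerivAt_jetWillmore_line hJ' (jetChange p q p₁ q₁ J')
  simp only [← jetChange_add_smul, jetWillmore_jetChange] at h1
  exact h1.unique ((hasDerivAt_jetWillmore_line hJ J').const_mul _)

theorem continuousOn_jet {u : ℂ → E3} {U : Set ℂ} (hU : IsOpen U) (hu : ContDiffOn ℝ ∞ u U) :
    ContinuousOn (jet u) U := by
  have h1 := contDiffOn_pd hU hu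
  have h2 := fun i j => contDiffOn_pd hU (h1 j) i
  refine continuousOn_pi.2 fun k => ?_
  fin_cases k
  exacts [(h1 0).continuousOn, (h1 1).continuousOn, (h2 0 0).continuousOn,
    (h2 0 1).continuousOn, (h2 1 1).continuousOn]

theorem firstVariationForm_eq_zero (φ : M → E3) {B : M → E3} {e : OpenPartialHomeomorph M ℂ}
    {z : ℂ} (hz : z ∈ e.target) (hB : e.symm z ∉ tsupport B) : firstVariationForm φ B e z = 0 := by
  have hd : ∀ i : Fin 2, pd i (0 : ℂ → E3) = 0 := by
    intro i
    funext y
    simp [pd]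
  have h0 : jet (B ∘ e.symm) z = 0 := by
    rw [jet_congr (comp_symm_eventuallyEq_zero hz hB)]
    funext k
    fin_cases k <;> simp [jet, hd]
  rw [firstVariationForm, h0, map_zero]

theorem jet_sum {ι : Type*} [DecidableEq ι] {u : ι → ℂ → E3} (s : Finset ι) {z : ℂ}
    (hu : ∀ i ∈ s, ContDiffAt ℝ 2 (u i) z) :
    jet (fun y => ∑ i ∈ s, u i y) z = ∑ i ∈ s, jet (u i) z := by
  induction s using Finset.induction_on with
  | empty =>
    have hd : ∀ i : Fin 2, pd i (fun _ : ℂ => (0 : E3)) = fun _ => 0 := by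
      intro i
      funext y
      simp [pd]
    funext k
    fin_cases k <;> simp [jet, hd]
  | insert a s ha ih =>
    have h1 : ContDiffAt ℝ 2 (fun y => ∑ i ∈ s, u i y) z :=
      ContDiffAt.sum fun i hi => hu i (Finset.mem_insert_of_mem hi)
    have h2 := jet_add_smul (hu a (Finset.mem_insert_self a s)) h1 1
    simp only [one_smul] at h2
    simp only [Finset.sum_insert ha]
    rw [h2, ih fun i hi => hu i (Finset.mem_insert_of_mem hi)]

/-! ### The first variation form of a minimal immersion: exactness and Stokes in one chart -/

variable [ChartedSpace ℂ M] [IsManifold 𝓘(ℂ, ℂ) ω M] {φ B : M → E3}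

theorem continuousOn_firstVariationForm (hφ : IsMinimalImmersion φ) (hB : IsSmooth B)
    {e : OpenPartialHomeomorph M ℂ} (he : e ∈ atlas ℂ M) :
    ContinuousOn (firstVariationForm φ B e) e.target := by
  have := isManifold_real (M := M)
  have h1 := continuousOn_jet e.open_target (hφ.smooth.contDiffOn he)
  have h2 := continuousOn_jet e.open_target (hB.contDiffOn he)
  have h3 : ContinuousOn (fderiv ℝ jetWillmore) regularJets :=
    (contDiffOn_jetWillmore.fderiv_of_isOpen (m := ∞) isOpen_regularJets (by simp)).continuousOn
  exact (h3.comp h1 fun z hz => hφ.jetNormal_ne_zero he hz).clm_apply h2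

theorem firstVariationForm_transition (hφ : IsMinimalImmersion φ) (hB : IsSmooth B)
    {e e' : OpenPartialHomeomorph M ℂ} (he : e ∈ atlas ℂ M) (he' : e' ∈ atlas ℂ M) {z : ℂ}
    (hz : z ∈ (e.symm ≫ₕ e').source) :
    firstVariationForm φ B e z = |((ContinuousLinearMap.mul ℝ ℂ) (deriv (e' ∘ e.symm) z)).det|
      * firstVariationForm φ B e' (e' (e.symm z)) := by
  have hpos := sq_add_sq_pos_of_ne_zero (transition_facts he he' hz).2
  have hz' : e' (e.symm z) ∈ e'.target := by
    have hz2 : e.symm z ∈ e'.source := by simpa using hz.2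
    exact e'.map_source hz2
  rw [det_mul_complex, abs_of_pos hpos, firstVariationForm, jet_transition hφ.smooth he he' hz,
    jet_transition hB he he' hz,
    fderiv_jetWillmore_jetChange hpos (hφ.jetNormal_ne_zero he' hz')]
  rfl

/-- The first variation at a minimal surface is exact. -/
theorem firstVariationForm_eq_d1 (hφ : IsMinimalImmersion φ) (hB : IsSmooth B)
    {e : OpenPartialHomeomorph M ℂ} (he : e ∈ atlas ℂ M) {z : ℂ} (hz : z ∈ e.target) :
    firstVariationForm φ B e z
      = -d1 (fun i y => gaussForm (φ ∘ e.symm) (B ∘ e.symm) i (0, y)) z := by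
  have := isManifold_real (M := M)
  have himm := hφ.jetNormal_ne_zero he hz
  exact (hasDerivAt_jetWillmore_line himm _).unique (hasDerivAt_jetWillmore e.open_target
    (hφ.smooth.contDiffOn he) (hB.contDiffOn he) hz himm (hφ.jetMean_eq_zero he hz))

/-- The integral of the first variation over a coordinate domain that contains the support of the
variation field. -/
theorem integral_firstVariationForm_chart [T2Space M] (hφ : IsMinimalImmersion φ)
    (hB : IsSmooth B)
    (hBc : HasCompactSupport B) {e : OpenPartialHomeomorph M ℂ} (he : e ∈ atlas ℂ M)
    (hBe : tsupport B ⊆ e.source) :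
    IntegrableOn (firstVariationForm φ B e) e.target ∧
      ∫ z in e.target, firstVariationForm φ B e z = 0 := by
  have := isManifold_real (M := M)
  have hu := hφ.smooth.contDiffOn he
  have hb := hB.contDiffOn he
  set K : Set ℂ := e '' tsupport B with hKdef
  have hK : IsCompact K := hBc.isCompact.image_of_continuousOn (e.continuousOn.mono hBe)
  have hKt : K ⊆ e.target := by
    rintro _ ⟨p, hp, rfl⟩
    exact e.map_source (hBe hp)
  have hnK : ∀ z ∈ e.target, z ∉ K → e.symm z ∉ tsupport B := fun z hz hzK hzB =>
    hzK ⟨_, hzB, e.right_inv hz⟩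
  have hO := isOpen_gaussDomain e.open_target hu hb
  have himm : ∀ z ∈ e.target, cross (pd 0 (φ ∘ e.symm) z) (pd 1 (φ ∘ e.symm) z) ≠ 0 :=
    fun z hz => hφ.jetNormal_ne_zero he hz
  -- The form is extended by zero off the chart. It vanishes outside the compact image of the
  -- support of `B`, so the extension is `C¹` on all of `ℂ` with compact support, and `dβ`
  -- integrates to zero.
  let β : Fin 2 → ℂ → ℝ := fun i => e.target.indicator
    fun y => gaussForm (φ ∘ e.symm) (B ∘ e.symm) i (0, y)
  have hβK : ∀ i, ∀ z ∉ K, β i z = 0 := by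
    intro i z hzK
    by_cases hz : z ∈ e.target
    · simp only [β, indicator_of_mem hz]
      exact gaussForm_eq_zero (comp_symm_eventuallyEq_zero hz (hnK z hz hzK)) i
        (ContDiffOn.differentiableAt_of_mem hO (contDiffOn_gaussMap e.open_target hu hb)
          (mem_gaussDomain_zero hz (himm z hz)))
    · simp only [β, indicator_of_notMem hz]
  have hβev : ∀ i, ∀ z ∈ e.target,
      β i =ᶠ[𝓝 z] fun y => gaussForm (φ ∘ e.symm) (B ∘ e.symm) i (0, y) := by
    intro i z hz
    filter_upwards [e.open_target.mem_nhds hz] with y hy using indicator_of_mem hy _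
  have hβ0 : ∀ i, ∀ z ∉ K, β i =ᶠ[𝓝 z] 0 := by
    intro i z hz
    filter_upwards [hK.isClosed.isOpen_compl.mem_nhds hz] with y hy using hβK i y hy
  have hβs : ∀ i, ContDiff ℝ 1 (β i) := by
    intro i
    refine contDiff_iff_contDiffAt.2 fun z => ?_
    by_cases hz : z ∈ K
    · have hs := contDiffOn_slice_zero
        (contDiffOn_gaussForm e.open_target hu hb i) himm
      exact ((hs.contDiffAt (e.open_target.mem_nhds (hKt hz))).of_le (by simp)).congr_of_eventuallyEq
        (hβev i z (hKt hz))
    · exact contDiffAt_const.congr_of_eventuallyEq (hβ0 i z hz)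
  have hβc : ∀ i, HasCompactSupport (β i) := fun i =>
    HasCompactSupport.intro hK fun z hz => hβK i z hz
  have heq : ∀ z ∈ e.target, firstVariationForm φ B e z = -d1 β z := by
    intro z hz
    rw [firstVariationForm_eq_d1 hφ hB he hz, d1, d1, pd_congr (hβev 1 z hz),
      pd_congr (hβev 0 z hz)]
  have hout : ∀ z ∉ K, d1 β z = 0 := by
    intro z hz
    rw [d1, pd_congr (hβ0 1 z hz), pd_congr (hβ0 0 z hz)]
    simp [pd]
  have hint : ∀ i j, Integrable (pd i (β j)) := by
    intro i j
    have hcont : Continuous fun z => fderiv ℝ (β j) z (![1, Complex.I] i) :=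
      ((hβs j).continuous_fderiv (by simp)).clm_apply continuous_const
    refine hcont.integrable_of_hasCompactSupport ?_
    exact ((hβc j).fderiv (𝕜 := ℝ)).comp_left (g := fun L : ℂ →L[ℝ] ℝ => L (![1, Complex.I] i)) rfl
  have hi : Integrable fun z => -d1 β z := ((hint 0 1).sub (hint 1 0)).neg
  constructor
  · exact (hi.integrableOn).congr_fun (fun z hz => (heq z hz).symm) e.open_target.measurableSet
  · rw [setIntegral_congr_fun e.open_target.measurableSet heq,
      setIntegral_eq_integral_of_forall_compl_eq_zero]
    · rw [integral_neg, neg_eq_zero]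
      change ∫ z, (pd 0 (β 1) z - pd 1 (β 0) z) = 0
      rw [integral_sub (hint 0 1) (hint 1 0), integral_pd_eq_zero (hβs 1) (hβc 1),
        integral_pd_eq_zero (hβs 0) (hβc 0), sub_zero]
    · intro z hz
      rw [hout z fun h => hz (hKt h), neg_zero]

/-! ### The integral of the first variation over the surface -/

variable [MeasurableSpace M] [BorelSpace M] (P : ChartPartition M)

theorem formIntegrableOn_firstVariationForm [T2Space M] (hφ : IsMinimalImmersion φ)
    (hB : IsSmooth B) (hBc : HasCompactSupport B) {Ω : Set M} (hΩ : MeasurableSet Ω) :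
    P.FormIntegrableOn Ω (firstVariationForm φ B) :=
  P.formIntegrableOn_of_compact (fun _ he => continuousOn_firstVariationForm hφ hB he) hBc
    (fun _ _ _ hz hzB => firstVariationForm_eq_zero φ hz hzB) hΩ

/-- The first variation in a direction supported in one chart. -/
theorem formIntegral_firstVariationForm_of_subset [T2Space M] (hφ : IsMinimalImmersion φ)
    (hB : IsSmooth B) (hBc : HasCompactSupport B) {e : OpenPartialHomeomorph M ℂ}
    (he : e ∈ atlas ℂ M) (hBe : tsupport B ⊆ e.source) :
    P.formIntegral univ (firstVariationForm φ B) = 0 := by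
  obtain ⟨hi, h0⟩ := integral_firstVariationForm_chart hφ hB hBc he hBe
  have hsum := P.hasSum_formIntegral MeasurableSet.univ
    (formIntegrableOn_firstVariationForm P hφ hB hBc MeasurableSet.univ)
  -- The target of `e` is cut along the pieces of the partition, so that the integral in `e` and the
  -- integral defined by the partition become series comparable term by term.
  let D : ℕ → Set ℂ := fun n => {z | z ∈ e.target ∧ e.symm z ∈ P.piece n}
  have hD : ∀ n, MeasurableSet (D n) := fun n =>
    measurableSet_chart_preimage e (P.measurableSet_piece n)
  have hDd : Pairwise (Function.onFun Disjoint D) := by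
    intro m n hmn
    refine disjoint_left.2 fun z hm hn => ?_
    exact disjoint_left.1 (P.disjoint hmn) hm.2 hn.2
  have hDu : ⋃ n, D n = e.target := by
    ext z
    simp only [mem_iUnion]
    constructor
    · rintro ⟨n, hn⟩
      exact hn.1
    · intro hz
      have : e.symm z ∈ ⋃ n, P.piece n := by
        rw [P.iUnion_piece]
        exact mem_univ _
      obtain ⟨n, hn⟩ := mem_iUnion.1 this
      exact ⟨n, hz, hn⟩
  have hsum' := hasSum_integral_iUnion hD hDd (by rw [hDu]; exact hi)
  rw [hDu, h0] at hsum'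
  refine hsum.unique ?_
  suffices heq : (fun n => ∫ z in {z | z ∈ (P.chart n).target ∧ (P.chart n).symm z
      ∈ P.piece n ∩ univ}, firstVariationForm φ B (P.chart n) z)
      = fun n => ∫ z in D n, firstVariationForm φ B e z by
    rw [heq]
    exact hsum'
  funext n
  set en := P.chart n with hen
  have hn : en ∈ atlas ℂ M := P.chart_mem n
  -- The part of the `n`-th coordinate piece that `e` also covers. The transition maps it
  -- bijectively onto `D n` with Jacobian `|τ'|²`; on the rest of the piece the form vanishes, as
  -- the support of `B` lies in the domain of `e`.
  set S : Set ℂ := {z | z ∈ en.target ∧ en.symm z ∈ P.piece n ∩ e.source} with hS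
  have hSm : MeasurableSet S := measurableSet_chart_preimage en
    ((P.measurableSet_piece n).inter e.open_source.measurableSet)
  have hSs : ∀ z ∈ S, z ∈ (en.symm ≫ₕ e).source := by
    intro z hz
    simp [hz.1, hz.2.2]
  have hpS : ∀ p ∈ P.piece n, p ∈ en.source := fun p hp =>
    P.closure_subset n (subset_closure hp)
  have himg : (e ∘ en.symm) '' S = D n := by
    ext y
    constructor
    · rintro ⟨z, hz, rfl⟩
      refine ⟨e.map_source hz.2.2, ?_⟩
      simp only [Function.comp_apply, e.left_inv hz.2.2]
      exact hz.2.1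
    · rintro ⟨hy1, hy2⟩
      have hs := hpS _ hy2
      refine ⟨en (e.symm y), ⟨en.map_source hs, ?_⟩, ?_⟩
      · rw [en.left_inv hs]
        exact ⟨hy2, e.map_target hy1⟩
      · simp [en.left_inv hs, e.right_inv hy1]
  have hinj : InjOn (e ∘ en.symm) S := by
    intro z hz z' hz' h
    exact en.symm.injOn hz.1 hz'.1 (e.injOn hz.2.2 hz'.2.2 h)
  have hcv := integral_image_eq_integral_abs_det_fderiv_smul volume hSm
    (f' := fun z => (ContinuousLinearMap.mul ℝ ℂ) (deriv (e ∘ en.symm) z))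
    (fun z hz => (hasFDerivAt_real_of_differentiableAt
      (transition_facts hn he (hSs z hz)).1.differentiableAt).hasFDerivWithinAt) hinj
    (firstVariationForm φ B e)
  rw [himg] at hcv
  rw [hcv]
  have hsub : S ⊆ {z | z ∈ en.target ∧ en.symm z ∈ P.piece n ∩ univ} := fun z hz =>
    ⟨hz.1, hz.2.1, mem_univ _⟩
  refine (setIntegral_eq_of_subset_of_forall_sdiff_eq_zero
    (measurableSet_chart_preimage en ((P.measurableSet_piece n).inter MeasurableSet.univ))
    hsub ?_).trans ?_
  rotate_left
  · refine setIntegral_congr_fun hSm fun z hz => ?_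
    exact firstVariationForm_transition hφ hB hn he (hSs z hz)
  · rintro z ⟨hz, hzS⟩
    refine firstVariationForm_eq_zero φ hz.1 fun hzB =>
      hzS ⟨hz.1, hz.2.1, hBe hzB⟩

variable [SecondCountableTopology M]

/-- The first variation at a minimal surface in a direction of compact support vanishes. -/
theorem formIntegral_firstVariationForm_univ [T2Space M] (hφ : IsMinimalImmersion φ)
    (hB : IsSmooth B) (hBc : HasCompactSupport B) :
    P.formIntegral univ (firstVariationForm φ B) = 0 := by
  classical
  have := isManifold_real (M := M)
  have : LocallyCompactSpace M := ChartedSpace.locallyCompactSpace ℂ M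
  obtain ⟨ρ, hρ⟩ := SmoothPartitionOfUnity.exists_isSubordinate 𝓘(ℝ, ℂ)
    (isClosed_tsupport B) (fun p : M => (chartAt ℂ p).source)
    (fun p => (chartAt ℂ p).open_source)
    (fun p _ => mem_iUnion.2 ⟨p, mem_chart_source ℂ p⟩)
  have hfin := ρ.locallyFinite.finite_nonempty_inter_compact hBc.isCompact
  -- Each `ρᵢ B` lives in one chart, and compactness of the support of `B` leaves finitely many
  -- nonzero ones. Their sum is `B`, and the first variation is linear in the field.
  let C : M → M → E3 := fun i p => ρ i p • B p
  have hCs : ∀ i, IsSmooth (C i) := fun i => (ρ i).contMDiff.smul hB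
  have hCt : ∀ i, tsupport (C i) ⊆ tsupport B := fun i => tsupport_smul_subset_right _ _
  have hCc : ∀ i, HasCompactSupport (C i) := fun i =>
    hBc.isCompact.of_isClosed_subset (isClosed_tsupport _) (hCt i)
  have hCe : ∀ i, tsupport (C i) ⊆ (chartAt ℂ i).source := fun i =>
    (tsupport_smul_subset_left _ _).trans (hρ i)
  have hsum : ∀ p, B p = ∑ i ∈ hfin.toFinset, C i p := by
    intro p
    by_cases hp : p ∈ tsupport B
    · have h1 := ρ.sum_eq_one hp
      rw [finsum_eq_sum_of_support_subset _ (s := hfin.toFinset) (by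
        intro i hi
        simp only [Finite.coe_toFinset]
        exact ⟨p, hi, hp⟩)] at h1
      simp only [C]
      rw [← Finset.sum_smul, h1, one_smul]
    · have : B p = 0 := image_eq_zero_of_notMem_tsupport hp
      simp [C, this]
  have hform : ∀ x ∈ P.region univ, P.coeff (firstVariationForm φ B) x
      = ∑ i ∈ hfin.toFinset, P.coeff (firstVariationForm φ (C i)) x := by
    rintro ⟨n, z⟩ hx
    have hn := P.chart_mem n
    have hz : z ∈ (P.chart n).target := hx.1
    have hjet : jet (B ∘ (P.chart n).symm) z
        = ∑ i ∈ hfin.toFinset, jet (C i ∘ (P.chart n).symm) z := by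
      have hB' : B ∘ (P.chart n).symm
          = fun y => ∑ i ∈ hfin.toFinset, (C i ∘ (P.chart n).symm) y := by
        funext y
        exact hsum _
      rw [hB']
      exact jet_sum _ fun i _ => contDiffAt_two (P.chart n).open_target
        ((hCs i).contDiffOn hn) hz
    simp only [ChartPartition.coeff, firstVariationForm]
    rw [hjet, map_sum]
  rw [ChartPartition.formIntegral,
    setIntegral_congr_fun (P.measurableSet_region MeasurableSet.univ) hform, integral_finsetSum]
  · exact Finset.sum_eq_zero fun i _ => formIntegral_firstVariationForm_of_subset P hφ (hCs i)
      (hCc i) (chart_mem_atlas ℂ i) (hCe i)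
  · exact fun i _ => formIntegrableOn_firstVariationForm P hφ (hCs i) (hCc i) MeasurableSet.univ

theorem formIntegral_firstVariationForm [T2Space M] (hφ : IsMinimalImmersion φ)
    (hB : IsSmooth B) (hBc : HasCompactSupport B) {Ω : Set M} (hBΩ : tsupport B ⊆ Ω) :
    P.formIntegral Ω (firstVariationForm φ B) = 0 := by
  rw [← formIntegral_firstVariationForm_univ P hφ hB hBc]
  refine (setIntegral_eq_of_subset_of_forall_sdiff_eq_zero
    (P.measurableSet_region MeasurableSet.univ) (fun x hx => ⟨hx.1, hx.2.1, mem_univ _⟩) ?_).symm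
  rintro x ⟨hx, hxΩ⟩
  exact firstVariationForm_eq_zero φ hx.1 fun h => hxΩ ⟨hx.1, hx.2.1, hBΩ h⟩

end FirstVariation

/-! ### Families of immersions -/

section Composition

variable {X : Type*} [NormedAddCommGroup X] [NormedSpace ℝ X] {O : Set X} {f : X → ℝ}

/-- The first time derivative of `f` along a curve. -/
def curveDeriv (f : X → ℝ) (J J' : X) : ℝ := fderiv ℝ f J J'

/-- The second time derivative of `f` along a curve. -/
def curveDeriv₂ (f : X → ℝ) (J J' J'' : X) : ℝ :=
  fderiv ℝ (fderiv ℝ f) J J' J' + fderiv ℝ f J J''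

theorem hasDerivAt_comp_curve (hO : IsOpen O) (hf : ContDiffOn ℝ ∞ f O) {γ : ℝ → X} {γ' : X}
    {t : ℝ} (hγ : HasDerivAt γ γ' t) (ht : γ t ∈ O) :
    HasDerivAt (fun s => f (γ s)) (curveDeriv f (γ t) γ') t :=
  (ContDiffOn.differentiableAt_of_mem hO hf ht).hasFDerivAt.comp_hasDerivAt t hγ

theorem hasDerivAt_curveDeriv (hO : IsOpen O) (hf : ContDiffOn ℝ ∞ f O) {γ γ' : ℝ → X} {γ'' : X}
    {t : ℝ} (hγ : HasDerivAt γ (γ' t) t) (hγ' : HasDerivAt γ' γ'' t) (ht : γ t ∈ O) :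
    HasDerivAt (fun s => curveDeriv f (γ s) (γ' s)) (curveDeriv₂ f (γ t) (γ' t) γ'') t := by
  have h1 : ContDiffOn ℝ ∞ (fderiv ℝ f) O := hf.fderiv_of_isOpen hO (by simp)
  have h2 := (ContDiffOn.differentiableAt_of_mem hO h1 ht).hasFDerivAt.comp_hasDerivAt t hγ
  exact h2.clm_apply hγ'

theorem continuousOn_curveDeriv (hO : IsOpen O) (hf : ContDiffOn ℝ ∞ f O) :
    ContinuousOn (fun p : X × X => curveDeriv f p.1 p.2) (O ×ˢ univ) := by
  have h1 : ContinuousOn (fderiv ℝ f) O :=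
    (hf.fderiv_of_isOpen (m := ∞) hO (by simp)).continuousOn
  exact (h1.comp continuousOn_fst fun p hp => hp.1).clm_apply continuousOn_snd

theorem continuousOn_curveDeriv₂ (hO : IsOpen O) (hf : ContDiffOn ℝ ∞ f O) :
    ContinuousOn (fun p : X × X × X => curveDeriv₂ f p.1 p.2.1 p.2.2) (O ×ˢ univ) := by
  have h1 : ContDiffOn ℝ ∞ (fderiv ℝ f) O := hf.fderiv_of_isOpen hO (by simp)
  have h2 : ContinuousOn (fderiv ℝ (fderiv ℝ f)) O :=
    (h1.fderiv_of_isOpen (m := ∞) hO (by simp)).continuousOn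
  have c1 : ContinuousOn (fun p : X × X × X => p.2.1) (O ×ˢ univ) := by fun_prop
  have c2 : ContinuousOn (fun p : X × X × X => p.2.2) (O ×ˢ univ) := by fun_prop
  exact (((h2.comp continuousOn_fst fun p hp => hp.1).clm_apply c1).clm_apply c1).add
    ((h1.continuousOn.comp continuousOn_fst fun p hp => hp.1).clm_apply c2)

end Composition

/-- Differentiation under the integral sign, twice. -/
theorem hasSecondDerivAt_integral {α : Type*} [MeasurableSpace α] {μ : Measure α}
    {F F₁ F₂ : ℝ → α → ℝ} {G : α → ℝ} {ε : ℝ} (hε : 0 < ε) (hG : Integrable G μ)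
    (hF : ∀ t, |t| < ε → AEStronglyMeasurable (F t) μ)
    (hF₁ : ∀ t, |t| < ε → AEStronglyMeasurable (F₁ t) μ)
    (hF₂ : AEStronglyMeasurable (F₂ 0) μ)
    (hd : ∀ᵐ x ∂μ, ∀ t, |t| < ε → HasDerivAt (fun s => F s x) (F₁ t x) t)
    (hd₁ : ∀ᵐ x ∂μ, ∀ t, |t| < ε → HasDerivAt (fun s => F₁ s x) (F₂ t x) t)
    (hb : ∀ᵐ x ∂μ, ∀ t, |t| < ε → |F t x| ≤ G x ∧ |F₁ t x| ≤ G x ∧ |F₂ t x| ≤ G x) :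
    (∀ t, |t| < ε → Integrable (F t) μ) ∧ Integrable (F₂ 0) μ ∧
      HasSecondDerivAt (fun t => ∫ x, F t x ∂μ) (∫ x, F₂ 0 x ∂μ) 0 := by
  have hFi : ∀ t, |t| < ε → Integrable (F t) μ := fun t ht =>
    hG.mono' (hF t ht) (hb.mono fun x hx => (hx t ht).1)
  have hF₁i : ∀ t, |t| < ε → Integrable (F₁ t) μ := fun t ht =>
    hG.mono' (hF₁ t ht) (hb.mono fun x hx => (hx t ht).2.1)
  have hmem : ∀ t, |t| < ε → {s : ℝ | |s| < ε} ∈ 𝓝 t := fun t ht =>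
    (isOpen_lt continuous_abs continuous_const).mem_nhds ht
  have h0 : |(0 : ℝ)| < ε := by simpa using hε
  -- The integral of `F₁` is differentiated only at time zero, that of `F` at every nearby time; the
  -- same `G` dominates both.
  have hmain := hasDerivAt_integral_of_dominated_loc_of_deriv_le (hmem 0 h0)
    (eventually_of_mem (hmem 0 h0) hF₁) (hF₁i 0 h0) hF₂
    (hb.mono fun x hx t ht => (hx t ht).2.2) hG hd₁
  refine ⟨hFi, hmain.1, fun t => ∫ x, F₁ t x ∂μ, ?_, hmain.2⟩
  filter_upwards [hmem 0 h0] with t ht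
  exact (hasDerivAt_integral_of_dominated_loc_of_deriv_le (hmem t ht)
    (eventually_of_mem (hmem t ht) hF) (hFi t ht) (hF₁ t ht)
    (hb.mono fun x hx t ht => (hx t ht).2.1) hG hd).2

section Families

variable {M : Type*} [TopologicalSpace M] [ChartedSpace ℂ M]

theorem pd_eq_iteratedFDeriv {u : ℂ → E3} (z : ℂ) (i : Fin 2) :
    pd i u z = iteratedFDeriv ℝ 1 u z (fun _ => ![1, Complex.I] i) := by
  rw [iteratedFDeriv_one_apply]
  rfl

theorem pd_pd_eq_iteratedFDeriv {u : ℂ → E3} {z : ℂ} (hu : ContDiffAt ℝ 2 u z) (i j : Fin 2) :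
    pd i (pd j u) z
      = iteratedFDeriv ℝ 2 u z ![![1, Complex.I] i, ![1, Complex.I] j] := by
  have hd : DifferentiableAt ℝ (fderiv ℝ u) z :=
    (hu.fderiv_right (m := 1) (by norm_num)).differentiableAt (by norm_num)
  rw [iteratedFDeriv_two_apply]
  change fderiv ℝ (fun y => fderiv ℝ u y _) z _ = _
  rw [fderiv_clm_apply hd (differentiableAt_const _)]
  simp

variable [IsManifold 𝓘(ℝ, ℂ) ∞ M] {I : Set ℝ} {Φ V : ℝ → M → E3}

theorem IsContinuousFamily.continuousOn_jet (hΦ : IsContinuousFamily I Φ)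
    {e : OpenPartialHomeomorph M ℂ} (he : e ∈ atlas ℂ M) :
    ContinuousOn (fun x : ℝ × ℂ => jet (Φ x.1 ∘ e.symm) x.2) (I ×ˢ e.target) := by
  have h1 : ∀ i, ContinuousOn (fun x : ℝ × ℂ => pd i (Φ x.1 ∘ e.symm) x.2) (I ×ˢ e.target) := by
    intro i
    simp only [pd_eq_iteratedFDeriv]
    exact (ContinuousMultilinearMap.apply ℝ (fun _ : Fin 1 => ℂ) E3
      (fun _ => ![1, Complex.I] i)).continuous.comp_continuousOn
      (hΦ.continuousOn e he 1)
  have h2 : ∀ i j, ContinuousOn (fun x : ℝ × ℂ => pd i (pd j (Φ x.1 ∘ e.symm)) x.2)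
      (I ×ˢ e.target) := by
    intro i j
    refine ((ContinuousMultilinearMap.apply ℝ (fun _ : Fin 2 => ℂ) E3
      ![![1, Complex.I] i, ![1, Complex.I] j]).continuous.comp_continuousOn
      (hΦ.continuousOn e he 2)).congr ?_
    rintro ⟨t, z⟩ ⟨ht, hz⟩
    exact pd_pd_eq_iteratedFDeriv
      (contDiffAt_two e.open_target ((hΦ.smooth t ht).contDiffOn he) hz) i j
  refine continuousOn_pi.2 fun k => ?_
  fin_cases k
  exacts [h1 0, h1 1, h2 0 0, h2 0 1, h2 1 1]

theorem IsTimeDeriv.hasDerivAt_jet (hI : IsOpen I) (hΦ : IsContinuousFamily I Φ)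
    (hV : IsContinuousFamily I V) (hd : IsTimeDeriv I Φ V) {e : OpenPartialHomeomorph M ℂ}
    (he : e ∈ atlas ℂ M) {t : ℝ} (ht : t ∈ I) {z : ℂ} (hz : z ∈ e.target) :
    HasDerivAt (fun s => jet (Φ s ∘ e.symm) z) (jet (V t ∘ e.symm) z) t := by
  have h1 : ∀ i, HasDerivAt (fun s => pd i (Φ s ∘ e.symm) z) (pd i (V t ∘ e.symm) z) t := by
    intro i
    simp only [pd_eq_iteratedFDeriv]
    exact (ContinuousMultilinearMap.apply ℝ (fun _ : Fin 1 => ℂ) E3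
      (fun _ => ![1, Complex.I] i)).hasFDerivAt.comp_hasDerivAt t (hd e he 1 t ht z hz)
  have h2 : ∀ i j, HasDerivAt (fun s => pd i (pd j (Φ s ∘ e.symm)) z)
      (pd i (pd j (V t ∘ e.symm)) z) t := by
    intro i j
    rw [pd_pd_eq_iteratedFDeriv (contDiffAt_two e.open_target ((hV.smooth t ht).contDiffOn he) hz)]
    refine ((ContinuousMultilinearMap.apply ℝ (fun _ : Fin 2 => ℂ) E3
      ![![1, Complex.I] i, ![1, Complex.I] j]).hasFDerivAt.comp_hasDerivAt t
      (hd e he 2 t ht z hz)).congr_of_eventuallyEq ?_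
    filter_upwards [hI.mem_nhds ht] with s hs
    exact pd_pd_eq_iteratedFDeriv
      (contDiffAt_two e.open_target ((hΦ.smooth s hs).contDiffOn he) hz) i j
  refine hasDerivAt_pi.2 fun k => ?_
  fin_cases k
  exacts [h1 0, h1 1, h2 0 0, h2 0 1, h2 1 1]

variable [MeasurableSpace M] (P : ChartPartition M)

/-- The two-jet of a map on the coordinate pieces. -/
def ChartPartition.jetAt (ψ : M → E3) (x : ℕ × ℂ) : Fin 5 → E3 :=
  jet (ψ ∘ (P.chart x.1).symm) x.2

theorem ChartPartition.coeff_willmoreForm {ψ : M → E3} (hψ : IsSmooth ψ) {x : ℕ × ℂ}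
    (hx : x ∈ P.domain) : P.coeff (willmoreForm ψ) x = jetWillmore (P.jetAt ψ x) :=
  willmore_coeff (contDiffAt_two (P.chart x.1).open_target
    (hψ.contDiffOn (P.chart_mem x.1)) hx)

theorem IsContinuousFamily.continuousOn_jetAt (hI : IsOpen I) (hΦ : IsContinuousFamily I Φ) :
    ContinuousOn (fun p : ℝ × ℕ × ℂ => P.jetAt (Φ p.1) p.2) (I ×ˢ P.domain) := by
  rintro ⟨t, n, z⟩ ⟨ht, hz⟩
  have h := (hΦ.continuousOn_jet (P.chart_mem n)).continuousAt
    ((hI.prod (P.chart n).open_target).mem_nhds (show (t, z) ∈ _ from ⟨ht, hz⟩))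
  have h' : ContinuousAt (fun q : ℕ × ℝ × ℂ => P.jetAt (Φ q.2.1) (q.1, q.2.2)) (n, t, z) :=
    continuousAt_prod_nat h
  have hg : ContinuousAt (fun p : ℝ × ℕ × ℂ => (p.2.1, p.1, p.2.2)) (t, n, z) := by fun_prop
  exact (ContinuousAt.comp (f := fun p : ℝ × ℕ × ℂ => (p.2.1, p.1, p.2.2)) h' hg).continuousWithinAt

end Families

/-! ### The second variation of the Willmore energy -/

section Energy

variable {M : Type*} [TopologicalSpace M] [ChartedSpace ℂ M] [MeasurableSpace M]
  (P : ChartPartition M) {I : Set ℝ} {Φ V A : ℝ → M → E3}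

/-- The first time derivative of the Willmore integrand of a family. -/
def ChartPartition.willmoreDeriv (Φ V : ℝ → M → E3) (t : ℝ) (x : ℕ × ℂ) : ℝ :=
  curveDeriv jetWillmore (P.jetAt (Φ t) x) (P.jetAt (V t) x)

/-- The second time derivative of the Willmore integrand of a family. -/
def ChartPartition.willmoreDeriv₂ (Φ V A : ℝ → M → E3) (t : ℝ) (x : ℕ × ℂ) : ℝ :=
  curveDeriv₂ jetWillmore (P.jetAt (Φ t) x) (P.jetAt (V t) x) (P.jetAt (A t) x)

/-- The times and coordinates at which a family is an immersion. -/
def ChartPartition.regularSet (I : Set ℝ) (Φ : ℝ → M → E3) : Set (ℝ × ℕ × ℂ) :=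
  (I ×ˢ P.domain) ∩ {p | P.jetAt (Φ p.1) p.2 ∈ regularJets}

/-- Continuity on the regular set gives measurability at fixed times. -/
theorem ChartPartition.aestronglyMeasurable_slice [BorelSpace M] {Ω : Set M}
    (hΩ : MeasurableSet Ω) {F : ℝ × ℕ × ℂ → ℝ} (hF : ContinuousOn F (P.regularSet I Φ)) {t : ℝ}
    (ht : ∀ x ∈ P.region Ω, (t, x) ∈ P.regularSet I Φ) :
    AEStronglyMeasurable (fun x => F (t, x)) (coordMeasure.restrict (P.region Ω)) := by
  have h : ContinuousOn (fun x => F (t, x)) (P.region Ω) :=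
    hF.comp (Continuous.prodMk_right t).continuousOn ht
  exact h.aestronglyMeasurable (P.measurableSet_region hΩ)

variable [IsManifold 𝓘(ℝ, ℂ) ∞ M]

theorem ChartPartition.isOpen_regularSet (hI : IsOpen I) (hΦ : IsContinuousFamily I Φ) :
    IsOpen (P.regularSet I Φ) :=
  (hΦ.continuousOn_jetAt P hI).isOpen_inter_preimage (hI.prod P.isOpen_domain) isOpen_regularJets

theorem IsC2Family.continuousOn_willmore (h : IsC2Family I Φ V A) :
    ContinuousOn (fun p : ℝ × ℕ × ℂ => P.coeff (willmoreForm (Φ p.1)) p.2) (P.regularSet I Φ) := by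
  refine ((contDiffOn_jetWillmore.continuousOn.comp
    ((h.continuous_zero.continuousOn_jetAt P h.isOpen).mono inter_subset_left)
    fun p hp => hp.2)).congr fun p hp => ?_
  exact P.coeff_willmoreForm (h.continuous_zero.smooth _ hp.1.1) hp.1.2

theorem IsC2Family.continuousOn_willmoreDeriv (h : IsC2Family I Φ V A) :
    ContinuousOn (fun p : ℝ × ℕ × ℂ => P.willmoreDeriv Φ V p.1 p.2) (P.regularSet I Φ) :=
  (continuousOn_curveDeriv isOpen_regularJets contDiffOn_jetWillmore).comp
    (((h.continuous_zero.continuousOn_jetAt P h.isOpen).mono inter_subset_left).prodMk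
      ((h.continuous_one.continuousOn_jetAt P h.isOpen).mono inter_subset_left))
    fun _ hp => ⟨hp.2, mem_univ _⟩

theorem IsC2Family.continuousOn_willmoreDeriv₂ (h : IsC2Family I Φ V A) :
    ContinuousOn (fun p : ℝ × ℕ × ℂ => P.willmoreDeriv₂ Φ V A p.1 p.2) (P.regularSet I Φ) :=
  (continuousOn_curveDeriv₂ isOpen_regularJets contDiffOn_jetWillmore).comp
    (((h.continuous_zero.continuousOn_jetAt P h.isOpen).mono inter_subset_left).prodMk
      (((h.continuous_one.continuousOn_jetAt P h.isOpen).mono inter_subset_left).prodMk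
        ((h.continuous_two.continuousOn_jetAt P h.isOpen).mono inter_subset_left)))
    fun _ hp => ⟨hp.2, mem_univ _⟩

theorem IsC2Family.hasDerivAt_willmore (h : IsC2Family I Φ V A) {t : ℝ} {x : ℕ × ℂ}
    (hx : (t, x) ∈ P.regularSet I Φ) :
    HasDerivAt (fun s => P.coeff (willmoreForm (Φ s)) x) (P.willmoreDeriv Φ V t x) t := by
  have h1 := h.deriv_zero.hasDerivAt_jet h.isOpen h.continuous_zero h.continuous_one
    (P.chart_mem x.1) hx.1.1 hx.1.2
  refine (hasDerivAt_comp_curve isOpen_regularJets contDiffOn_jetWillmore h1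
    hx.2).congr_of_eventuallyEq ?_
  filter_upwards [h.isOpen.mem_nhds hx.1.1] with s hs
  exact P.coeff_willmoreForm (h.continuous_zero.smooth s hs) hx.1.2

theorem IsC2Family.hasDerivAt_willmoreDeriv (h : IsC2Family I Φ V A) {t : ℝ} {x : ℕ × ℂ}
    (hx : (t, x) ∈ P.regularSet I Φ) :
    HasDerivAt (fun s => P.willmoreDeriv Φ V s x) (P.willmoreDeriv₂ Φ V A t x) t := by
  have h1 := h.deriv_zero.hasDerivAt_jet h.isOpen h.continuous_zero h.continuous_one
    (P.chart_mem x.1) hx.1.1 hx.1.2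
  have h2 := h.deriv_one.hasDerivAt_jet h.isOpen h.continuous_one h.continuous_two
    (P.chart_mem x.1) hx.1.1 hx.1.2
  exact hasDerivAt_curveDeriv isOpen_regularJets contDiffOn_jetWillmore
    (γ := fun s => P.jetAt (Φ s) x) (γ' := fun s => P.jetAt (V s) x) h1 h2 hx.2

/-- A family is uniformly regular near time zero: it is an immersion and the Willmore integrand
and its first two time derivatives are bounded by one integrable function. -/
def ChartPartition.IsUniformlyRegular (P : ChartPartition M) (Ω : Set M) (I : Set ℝ)
    (Φ V A : ℝ → M → E3) (ε : ℝ) (G : ℕ × ℂ → ℝ) : Prop :=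
  ∀ x ∈ P.region Ω, ∀ t : ℝ, |t| < ε → (t, x) ∈ P.regularSet I Φ ∧
    |P.coeff (willmoreForm (Φ t)) x| ≤ G x ∧ |P.willmoreDeriv Φ V t x| ≤ G x ∧
    |P.willmoreDeriv₂ Φ V A t x| ≤ G x

/-- Being an immersion is an open condition that holds at time zero along the compact
`closedRegion`, so the tube lemma yields a uniform time interval. On the compact product the three
functions are bounded by continuity, and constants are integrable because the region has finite
measure. -/
theorem IsC2Family.exists_isUniformlyRegular_of_isCompact [T2Space M]
    (h : IsC2Family I Φ V A) (h0 : ∀ x ∈ P.domain, P.jetAt (Φ 0) x ∈ regularJets)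
    {Ω : Set M} (hΩ : IsCompact (closure Ω)) :
    ∃ ε > 0, ∃ G : ℕ × ℂ → ℝ, IntegrableOn G (P.region Ω) coordMeasure ∧
      P.IsUniformlyRegular Ω I Φ V A ε G := by
  have hC := P.isCompact_closedRegion hΩ isClosed_closure
  have hRC : P.region Ω ⊆ P.closedRegion (closure Ω) := fun x hx =>
    P.mem_closedRegion hx (subset_closure hx.2.2)
  have hsub : ({0} : Set ℝ) ×ˢ P.closedRegion (closure Ω) ⊆ P.regularSet I Φ := by
    rintro ⟨t, x⟩ ⟨rfl, hx⟩
    exact ⟨⟨h.zero_mem, hx.1⟩, h0 x hx.1⟩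
  obtain ⟨u, v, hu, -, h0u, hCv, huv⟩ := generalized_tube_lemma isCompact_singleton hC
    (P.isOpen_regularSet h.isOpen h.continuous_zero) hsub
  obtain ⟨ε, hε, hεu⟩ := Metric.nhds_basis_closedBall.mem_iff.1
    (hu.mem_nhds (h0u (mem_singleton 0)))
  have hK : IsCompact (Metric.closedBall (0 : ℝ) ε ×ˢ P.closedRegion (closure Ω)) :=
    (isCompact_closedBall 0 ε).prod hC
  have hKr : Metric.closedBall (0 : ℝ) ε ×ˢ P.closedRegion (closure Ω) ⊆ P.regularSet I Φ :=
    (prod_mono hεu hCv).trans huv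
  obtain ⟨b₀, hb₀⟩ := hK.exists_bound_of_continuousOn ((h.continuousOn_willmore P).mono hKr)
  obtain ⟨b₁, hb₁⟩ := hK.exists_bound_of_continuousOn ((h.continuousOn_willmoreDeriv P).mono hKr)
  obtain ⟨b₂, hb₂⟩ := hK.exists_bound_of_continuousOn ((h.continuousOn_willmoreDeriv₂ P).mono hKr)
  have hfin : coordMeasure (P.region Ω) < ⊤ := (measure_mono hRC).trans_lt (coordMeasure_lt_top hC)
  refine ⟨ε, hε, fun _ => max b₀ (max b₁ b₂), integrableOn_const hfin.ne, ?_⟩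
  intro x hx t ht
  have hmem : (t, x) ∈ Metric.closedBall (0 : ℝ) ε ×ˢ P.closedRegion (closure Ω) :=
    ⟨by simpa using ht.le, hRC hx⟩
  exact ⟨hKr hmem, (hb₀ _ hmem).trans (le_max_left _ _),
    (hb₁ _ hmem).trans ((le_max_left _ _).trans (le_max_right _ _)),
    (hb₂ _ hmem).trans ((le_max_right _ _).trans (le_max_right _ _))⟩

/-- The assumed bound concerns iterated time derivatives. Since the family stays immersed on `Ω`,
these equal the chain-rule expressions near each time in `I`. -/
theorem IsC2Family.exists_isUniformlyRegular_of_isDominatedOn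
    (h : IsC2Family I Φ V A) {Ω : Set M} (himm : ∀ t ∈ I, ∀ p ∈ Ω, IsImmersedAt (Φ t) p)
    (hdom : IsDominatedOn P Ω Φ) :
    ∃ ε > 0, ∃ G : ℕ × ℂ → ℝ, IntegrableOn G (P.region Ω) coordMeasure ∧
      P.IsUniformlyRegular Ω I Φ V A ε G := by
  obtain ⟨ε, hε, G, hG, hb⟩ := hdom
  obtain ⟨δ, hδ, hδI⟩ := Metric.isOpen_iff.1 h.isOpen 0 h.zero_mem
  have hreg : ∀ x ∈ P.region Ω, ∀ t ∈ I, (t, x) ∈ P.regularSet I Φ := fun x hx t ht =>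
    ⟨⟨ht, hx.1⟩, IsImmersedAt.jetNormal_ne_zero (h.continuous_zero.smooth t ht)
      (P.chart_mem x.1) hx.1 (himm t ht _ hx.2.2)⟩
  -- The radius `δ` keeps the times inside `I`.
  refine ⟨min ε δ, lt_min hε hδ, G, hG, fun x hx t ht => ?_⟩
  have htI : t ∈ I := hδI (by simpa using ht.trans_le (min_le_right _ _))
  have htε : |t| < ε := ht.trans_le (min_le_left _ _)
  have hd : deriv (fun s => P.coeff (willmoreForm (Φ s)) x)
      =ᶠ[𝓝 t] fun s => P.willmoreDeriv Φ V s x := by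
    filter_upwards [h.isOpen.mem_nhds htI] with s hs
    exact (h.hasDerivAt_willmore P (hreg x hx s hs)).deriv
  have e₀ := hb x hx t htε 0 (by norm_num)
  have e₁ := hb x hx t htε 1 (by norm_num)
  have e₂ := hb x hx t htε 2 le_rfl
  rw [iteratedDeriv_zero] at e₀
  rw [iteratedDeriv_one, hd.self_of_nhds] at e₁
  rw [iteratedDeriv_succ, iteratedDeriv_one, hd.deriv_eq,
    (h.hasDerivAt_willmoreDeriv P (hreg x hx t htI)).deriv] at e₂
  exact ⟨hreg x hx t htI, e₀, e₁, e₂⟩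

theorem IsC2Family.hasSecondDerivAt_willmoreEnergy [BorelSpace M] (h : IsC2Family I Φ V A)
    {Ω : Set M} (hΩ : MeasurableSet Ω) {ε : ℝ} (hε : 0 < ε) {G : ℕ × ℂ → ℝ}
    (hG : IntegrableOn G (P.region Ω) coordMeasure)
    (hreg : P.IsUniformlyRegular Ω I Φ V A ε G) :
    (∀ t, |t| < ε → P.FormIntegrableOn Ω (willmoreForm (Φ t))) ∧
      IntegrableOn (P.willmoreDeriv₂ Φ V A 0) (P.region Ω) coordMeasure ∧
      HasSecondDerivAt (fun t => willmoreEnergy P Ω (Φ t))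
        (∫ x in P.region Ω, P.willmoreDeriv₂ Φ V A 0 x ∂coordMeasure) 0 := by
  have hae : ∀ {Q : ℕ × ℂ → Prop}, (∀ x ∈ P.region Ω, Q x) →
      ∀ᵐ x ∂(coordMeasure.restrict (P.region Ω)), Q x := fun hQ =>
    (ae_restrict_iff' (P.measurableSet_region hΩ)).2 (Eventually.of_forall hQ)
  have h0 : |(0 : ℝ)| < ε := by simpa using hε
  exact hasSecondDerivAt_integral hε hG
    (fun t ht => P.aestronglyMeasurable_slice hΩ (h.continuousOn_willmore P)
      fun x hx => (hreg x hx t ht).1)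
    (fun t ht => P.aestronglyMeasurable_slice hΩ (h.continuousOn_willmoreDeriv P)
      fun x hx => (hreg x hx t ht).1)
    (P.aestronglyMeasurable_slice hΩ (h.continuousOn_willmoreDeriv₂ P)
      fun x hx => (hreg x hx 0 h0).1)
    (hae fun x hx t ht => h.hasDerivAt_willmore P (hreg x hx t ht).1)
    (hae fun x hx t ht => h.hasDerivAt_willmoreDeriv P (hreg x hx t ht).1)
    (hae fun x hx t ht => (hreg x hx t ht).2)

end Energy

/-- At time zero the second derivative of the Willmore integrand is the second variation in the
normal direction plus the first variation in the direction of the acceleration. -/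
theorem willmoreDeriv₂_zero {M : Type*} [TopologicalSpace M] [ChartedSpace ℂ M]
    [IsManifold 𝓘(ℂ, ℂ) ω M] [MeasurableSpace M] (P : ChartPartition M) {φ : M → E3}
    (hφ : IsMinimalImmersion φ) {w : M → ℝ} (hw : IsSmooth w) {I : Set ℝ} {Φ V A : ℝ → M → E3}
    (hΦ : IsC2Family I Φ V A) (hΦ_zero : Φ 0 = φ)
    (hV_zero : ∀ p, V 0 p = w p • normalField φ p) {x : ℕ × ℂ} (hx : x ∈ P.domain) :
    P.willmoreDeriv₂ Φ V A 0 x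
      = P.coeff (secondVariationForm φ w) x + P.coeff (firstVariationForm φ (A 0)) x := by
  have := isManifold_real (M := M)
  have he := P.chart_mem x.1
  have hx' : x.2 ∈ (P.chart x.1).target := hx
  have hreg : P.jetAt φ x ∈ regularJets := hφ.jetNormal_ne_zero he hx'
  have hV := hΦ.continuous_one.smooth 0 hΦ.zero_mem
  have h1 := hasSecondDerivAt_normal_variation (P.chart x.1).open_target
    (hφ.smooth.contDiffOn he) (hV.contDiffOn he) (fun z hz => hφ.jetNormal_ne_zero he hz)
    (hw.contDiffOn he) (fun y hy => by
      simp only [Function.comp_apply]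
      rw [hV_zero, normalField_symm hφ.smooth he hy]) hx' (hφ.jetMean_eq_zero he hx')
  have hl : ∀ t : ℝ, HasDerivAt (fun t : ℝ => P.jetAt φ x + t • P.jetAt (V 0) x)
      (P.jetAt (V 0) x) t := by
    intro t
    simpa using ((hasDerivAt_id t).smul_const (P.jetAt (V 0) x)).const_add (P.jetAt φ x)
  have hl0 : P.jetAt φ x + (0 : ℝ) • P.jetAt (V 0) x = P.jetAt φ x := by simp
  -- The same straight line of jets, now by the chain rule. It has no acceleration, so uniqueness of
  -- the second derivative identifies `D²f(J)[J', J']` with the second variation form.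
  have h2 : HasSecondDerivAt (fun t : ℝ => jetWillmore (P.jetAt φ x + t • P.jetAt (V 0) x))
      (curveDeriv₂ jetWillmore (P.jetAt φ x) (P.jetAt (V 0) x) 0) 0 := by
    refine ⟨fun t => curveDeriv jetWillmore (P.jetAt φ x + t • P.jetAt (V 0) x)
      (P.jetAt (V 0) x), ?_, ?_⟩
    · have : ∀ᶠ t : ℝ in 𝓝 0, P.jetAt φ x + t • P.jetAt (V 0) x ∈ regularJets :=
        (hl 0).continuousAt.eventually_mem (isOpen_regularJets.mem_nhds (by rwa [hl0]))
      filter_upwards [this] with t ht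
      exact hasDerivAt_comp_curve isOpen_regularJets contDiffOn_jetWillmore (hl t) ht
    · have := hasDerivAt_curveDeriv isOpen_regularJets contDiffOn_jetWillmore
        (γ' := fun _ => P.jetAt (V 0) x) (hl 0) (hasDerivAt_const 0 _) (by rwa [hl0])
      rwa [hl0] at this
  have h3 := h1.unique h2
  have h4 : P.coeff (secondVariationForm φ w) x
      = curveDeriv₂ jetWillmore (P.jetAt φ x) (P.jetAt (V 0) x) 0 := h3
  rw [h4, ChartPartition.willmoreDeriv₂, hΦ_zero, curveDeriv₂, curveDeriv₂, map_zero, add_zero]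
  rfl

end

end WillmoreSurface

/-! ### The second variation formula -/

open WillmoreSurface
theorem mainTheorem2 {M : Type*} [TopologicalSpace M] [T2Space M] [SecondCountableTopology M]
    [ChartedSpace ℂ M] [IsManifold 𝓘(ℂ, ℂ) ω M] [MeasurableSpace M] [BorelSpace M]
    (P : ChartPartition M)
    (φ : M → E3) (hφ : IsMinimalImmersion φ)
    (w : M → ℝ) (hw : IsSmooth w)
    (Ω : Set M) (hΩ : MeasurableSet Ω)
    (I : Set ℝ) (Φ V A : ℝ → M → E3) (hΦ : IsC2Family I Φ V A)
    (hΦ_immersed : ∀ t ∈ I, ∀ p ∈ Ω, IsImmersedAt (Φ t) p)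
    (hΦ_zero : Φ 0 = φ)
    (hV_zero : ∀ p, V 0 p = w p • normalField φ p)
    (hA_compact : HasCompactSupport (A 0)) (hA_interior : tsupport (A 0) ⊆ interior Ω)
    (h_finite : IsCompact (closure Ω) ∨ IsDominatedOn P Ω Φ) :
    (∀ᶠ t in 𝓝 (0 : ℝ), P.FormIntegrableOn Ω (willmoreForm (Φ t))) ∧
      P.FormIntegrableOn Ω (secondVariationForm φ w) ∧
      HasSecondDerivAt (fun t => willmoreEnergy P Ω (Φ t))
        (P.formIntegral Ω (secondVariationForm φ w)) 0 := by
  have := isManifold_real (M := M)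
  obtain ⟨ε, hε, G, hG, hreg⟩ : ∃ ε > 0, ∃ G : ℕ × ℂ → ℝ,
      IntegrableOn G (P.region Ω) coordMeasure ∧ P.IsUniformlyRegular Ω I Φ V A ε G := by
    rcases h_finite with hc | hd
    · refine hΦ.exists_isUniformlyRegular_of_isCompact P (fun x hx => ?_) hc
      rw [hΦ_zero]
      exact hφ.jetNormal_ne_zero (P.chart_mem x.1) hx
    · exact hΦ.exists_isUniformlyRegular_of_isDominatedOn P hΦ_immersed hd
  obtain ⟨h1, h2, h3⟩ := hΦ.hasSecondDerivAt_willmoreEnergy P hΩ hε hG hreg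
  have hA := hΦ.continuous_two.smooth 0 hΦ.zero_mem
  have hfi := formIntegrableOn_firstVariationForm P hφ hA hA_compact hΩ
  have hf0 := formIntegral_firstVariationForm P hφ hA hA_compact
    (hA_interior.trans interior_subset)
  have hR := P.measurableSet_region hΩ
  have heq : ∀ x ∈ P.region Ω, P.willmoreDeriv₂ Φ V A 0 x
      = P.coeff (secondVariationForm φ w) x + P.coeff (firstVariationForm φ (A 0)) x :=
    fun x hx => willmoreDeriv₂_zero P hφ hw hΦ hΦ_zero hV_zero hx.1
  -- Integrability comes by difference: the full second time derivative is dominated, and the first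
  -- variation form is continuous with compact support.
  have hsi : P.FormIntegrableOn Ω (secondVariationForm φ w) := by
    refine (h2.sub hfi).congr_fun (fun x hx => ?_) hR
    simp only [Pi.sub_apply, heq x hx, add_sub_cancel_right]
  have hval : ∫ x in P.region Ω, P.willmoreDeriv₂ Φ V A 0 x ∂coordMeasure
      = P.formIntegral Ω (secondVariationForm φ w) := by
    rw [setIntegral_congr_fun hR heq, integral_add hsi hfi]
    change _ + P.formIntegral Ω (firstVariationForm φ (A 0)) = _
    rw [hf0, add_zero]
    rfl
  refine ⟨?_, hsi, hval ▸ h3⟩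
  filter_upwards [(isOpen_lt continuous_abs continuous_const).mem_nhds
    (show |(0 : ℝ)| < ε by simpa using hε)] with t ht using h1 t ht
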